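/- Let $H=\mathbb C\times\mathbb R$ be the real Heisenberg group, with product topology and multiplication $(z,t)(z',t')=(z+z',\,t+t'+\tfrac12\operatorname{Im}(\overline z z'))$. Let $Z(H)=\{0\}\times\mathbb R$ be its centre, $p:H\to\mathbb C$, $(z,t)\mapsto z$, and $\operatorname{Aut}(H)$ the group of continuous automorphisms of $H$. For a locally compact group $G$, let $\mathcal C(G)$ be the set of closed subgroups of $G$ with the Chabauty topology, in which a basis of neighbourhoods of $C$ is given by the sets $\{D : D\cap K\subset CU,\ C\cap K\subset DU\}$ with $K\subset G$ compact and $U$ an open neighbourhood of the identity. A lattice in $G$ is a discrete subgroup $\Lambda$ such that $G/\Lambda$ carries a $G$-invariant Borel probability measure; $\mathcal L(G)\subset\mathcal C(G)$ is the subspace of lattices. For an integer $n\ge1$, let $\mathcal L_n(H)\subset\mathcal L(H)$ be the subspace of those lattices $\Lambda$ for which $[\Lambda,\Lambda]$ has index $n$ in $\Lambda\cap Z(H)$, and let $\Lambda'_n$ be the subgroup of $H$ generated by $(1,\frac12)$, $(i,\frac12)$, $(0,\frac1n)$. Proposition 7.7 / 7.8. (a) For every $n\ge1$, $\Lambda\mapsto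 p(\Lambda)$ defines a map $p_n:\mathcal L_n(H)\to\mathcal L(\mathbb C)$, which is a (locally trivial) fibre bundle with fibre the $2$-torus. For all $n,n'\ge1$ the bundles $p_n$ and $p_{n'}$ are isomorphic over the identity: there is a homeomorphism $e:\mathcal L_n(H)\to\mathcal L_{n'}(H)$ with $p_{n'}\circ e=p_n$. In particular $\mathcal L_n(H)$ and $\mathcal L_{n'}(H)$ are homeomorphic. (b) For every $n\ge1$, $\mathcal L_n(H)$ is a connected $6$-dimensional topological manifold and an Eilenberg–MacLane space $K(\pi,1)$: it is path connected, its homotopy groups $\pi_k$, $k\ge2$, are trivial, and its fundamental group is isomorphic to $\pi=\mathbb Z^2\rtimes\widetilde{SL}_2(\mathbb Z)$. Here $\widetilde{SL}_2(\mathbb Z)$ is the inverse image of $SL_2(\mathbb Z)$ in the universal covering group of $SL_2(\mathbb R)$, acting on $\mathbb Z^2$ through $SL_2(\mathbb Z)$ in the standard way. (c) For every $n\ge1$, $\Lambda'_n\in\mathcal L_n(H)$, and the stabiliser of $\Lambda'_n$ in $\operatorname{Aut}(H)$ is $(\frac1n\mathbb Z)^2\rtimes GL_2(\mathbb Z)$.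 That is, $(w,g)\mapsto\Phi_{w,g}$ is an isomorphism from this (standard) semidirect product onto the stabiliser, where for $w=(u,v)\in\mathbb R^2$ and $g=\begin{pmatrix}a&b\\c&d\end{pmatrix}\in GL_2(\mathbb R)$ the automorphism $\Phi_{w,g}$ is $(x+iy,t)\mapsto\big((ax+by)+i(cx+dy),\,(ad-bc)t\big)$ followed by conjugation $h\mapsto(u+iv,0)\,h\,(u+iv,0)^{-1}$. -/

import Mathlib

open scoped Pointwise Topology unitInterval

noncomputable section

namespace HeisLattice

/-! ## The Chabauty space of closed subgroups and the space of lattices -/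

section Chabauty

variable {G : Type*} [Group G] [TopologicalSpace G]

/-- The basic neighbourhood `V_{K,U}(C)` of a closed subgroup `C`: all closed subgroups `D` with
`D ∩ K ⊆ C U` and `C ∩ K ⊆ D U`. -/
def chabautyNhd (K U : Set G) (C : ClosedSubgroup G) : Set (ClosedSubgroup G) :=
  {D | (D : Set G) ∩ K ⊆ (C : Set G) * U ∧ (C : Set G) ∩ K ⊆ (D : Set G) * U}

/-- The Chabauty topology on the space of closed subgroups: a set is open if with each of its
points `C` it contains some `V_{K,U}(C)`, `K` compact and `U` an open neighbourhood of `1`. -/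
instance chabautyTopology : TopologicalSpace (ClosedSubgroup G) where
  IsOpen S := ∀ C ∈ S, ∃ K U : Set G, IsCompact K ∧ IsOpen U ∧ (1 : G) ∈ U ∧
    chabautyNhd K U C ⊆ S
  isOpen_univ := fun _ _ =>
    ⟨∅, Set.univ, isCompact_empty, isOpen_univ, Set.mem_univ _, Set.subset_univ _⟩
  isOpen_inter := by
    rintro S T hS hT C ⟨hCS, hCT⟩
    obtain ⟨K, U, hK, hU, h1, h⟩ := hS C hCS
    obtain ⟨K', U', hK', hU', h1', h'⟩ := hT C hCT
    refine ⟨K ∪ K', U ∩ U', hK.union hK', hU.inter hU', ⟨h1, h1'⟩, ?_⟩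
    rintro D ⟨hD1, hD2⟩
    refine ⟨h ⟨?_, ?_⟩, h' ⟨?_, ?_⟩⟩
    · exact fun x hx => Set.mul_subset_mul_left Set.inter_subset_left (hD1 ⟨hx.1, Or.inl hx.2⟩)
    · exact fun x hx => Set.mul_subset_mul_left Set.inter_subset_left (hD2 ⟨hx.1, Or.inl hx.2⟩)
    · exact fun x hx => Set.mul_subset_mul_left Set.inter_subset_right (hD1 ⟨hx.1, Or.inr hx.2⟩)
    · exact fun x hx => Set.mul_subset_mul_left Set.inter_subset_right (hD2 ⟨hx.1, Or.inr hx.2⟩)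
  isOpen_sUnion := by
    rintro 𝒮 h C ⟨S, hS, hC⟩
    obtain ⟨K, U, hK, hU, h1, hsub⟩ := h S hS C hC
    exact ⟨K, U, hK, hU, h1, hsub.trans (Set.subset_sUnion_of_mem hS)⟩

/-- A lattice: a discrete subgroup `Λ` such that `G ⧸ Λ` carries a `G`-invariant Borel probability
measure. -/
def IsLattice (Λ : Subgroup G) : Prop :=
  DiscreteTopology Λ ∧
    letI : MeasurableSpace (G ⧸ Λ) := borel (G ⧸ Λ)
    ∃ μ : MeasureTheory.Measure (G ⧸ Λ),
      MeasureTheory.IsProbabilityMeasure μ ∧ MeasureTheory.SMulInvariantMeasure G (G ⧸ Λ) μ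

variable (G) in
/-- The space of lattices of `G`, with the topology induced by the Chabauty topology. -/
abbrev LatticeSpace : Type _ := {Λ : ClosedSubgroup G // IsLattice Λ.toSubgroup}

end Chabauty

/-! ## The Heisenberg group -/

/-- The real Heisenberg group `ℂ × ℝ` with
`(z, t) (z', t') = (z + z', t + t' + Im (conj z * z') / 2)`. -/
@[ext]
structure Heis where
  /-- the coordinate in `ℂ` -/
  z : ℂ
  /-- the central coordinate -/
  t : ℝ

namespace Heis

/-- The product topology of `ℂ × ℝ`. -/
instance : TopologicalSpace Heis :=
  TopologicalSpace.induced (fun h => (h.z, h.t)) inferInstance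

instance : Mul Heis :=
  ⟨fun a b => ⟨a.z + b.z, a.t + b.t + ((starRingEnd ℂ) a.z * b.z).im / 2⟩⟩

instance : One Heis := ⟨⟨0, 0⟩⟩

instance : Inv Heis := ⟨fun a => ⟨-a.z, -a.t⟩⟩

@[simp] theorem mul_z (a b : Heis) : (a * b).z = a.z + b.z := rfl
@[simp] theorem mul_t (a b : Heis) :
    (a * b).t = a.t + b.t + ((starRingEnd ℂ) a.z * b.z).im / 2 := rfl
@[simp] theorem one_z : (1 : Heis).z = 0 := rfl
@[simp] theorem one_t : (1 : Heis).t = 0 := rfl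
@[simp] theorem inv_z (a : Heis) : (a⁻¹).z = -a.z := rfl
@[simp] theorem inv_t (a : Heis) : (a⁻¹).t = -a.t := rfl

instance : Group Heis :=
  Group.ofLeftAxioms
    (by
      intro a b c
      ext
      · exact add_assoc _ _ _
      · simp
        ring)
    (by intro a; ext <;> simp)
    (by
      intro a
      ext
      · simp
      · simp [mul_comm])

/-- The projection `(z, t) ↦ z` onto the additive group `ℂ`. -/
def proj : Heis →* Multiplicative ℂ where
  toFun h := Multiplicative.ofAdd h.z
  map_one' := rfl
  map_mul' _ _ := rfl

/-- The group of continuous automorphisms. -/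
def contAut : Subgroup (MulAut Heis) where
  carrier := {Φ | Continuous Φ ∧ Continuous Φ.symm}
  mul_mem' := by
    rintro a b ⟨ha, ha'⟩ ⟨hb, hb'⟩
    exact ⟨ha.comp hb, hb'.comp ha'⟩
  one_mem' := ⟨continuous_id, continuous_id⟩
  inv_mem' := by
    rintro a ⟨ha, ha'⟩
    exact ⟨ha', ha⟩

/-- The stabiliser of a subgroup in the group of continuous automorphisms. -/
def stabilizer (Λ : Subgroup Heis) : Subgroup contAut where
  carrier := {Φ | Λ.map (Φ : MulAut Heis).toMonoidHom = Λ}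
  mul_mem' := by
    intro a b ha hb
    have h : ((a * b : contAut) : MulAut Heis).toMonoidHom
        = (a : MulAut Heis).toMonoidHom.comp (b : MulAut Heis).toMonoidHom := rfl
    simp only [Set.mem_ofPred_eq] at ha hb ⊢
    rw [h, ← Subgroup.map_map, hb, ha]
  one_mem' := Subgroup.map_id Λ
  inv_mem' := by
    intro a ha
    have h : ((a⁻¹ : contAut) : MulAut Heis).toMonoidHom.comp (a : MulAut Heis).toMonoidHom
        = MonoidHom.id Heis := by
      ext1 x
      exact (a : MulAut Heis).symm_apply_apply x
    simp only [Set.mem_ofPred_eq] at ha ⊢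
    conv_lhs => rw [← ha]
    rw [Subgroup.map_map, h, Subgroup.map_id]

/-- A vector `(u, v)` of `ℝ²`, placed in the Heisenberg group as `(u + i v, 0)`. -/
def ofVec (w : Fin 2 → ℝ) : Heis := ⟨⟨w 0, w 1⟩, 0⟩

/-- A real matrix `!![a, b; c, d]` acting on the Heisenberg group by
`(x + i y, t) ↦ ((a x + b y) + i (c x + d y), (a d - b c) t)`. -/
def matAct (g : Matrix (Fin 2) (Fin 2) ℝ) (h : Heis) : Heis :=
  ⟨⟨g 0 0 * h.z.re + g 0 1 * h.z.im, g 1 0 * h.z.re + g 1 1 * h.z.im⟩, g.det * h.t⟩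

end Heis

/-- The space of those lattices `Λ` of the Heisenberg group for which `[Λ, Λ]` has index `n` in the
intersection of `Λ` with the centre. -/
abbrev LatticeSpaceN (n : ℕ+) : Type :=
  {Λ : ClosedSubgroup Heis // IsLattice Λ.toSubgroup ∧
    ⁅Λ.toSubgroup, Λ.toSubgroup⁆.relIndex (Λ.toSubgroup ⊓ Subgroup.center Heis) = n}

/-- The subgroup generated by `(1, 1/2)`, `(i, 1/2)` and `(0, 1/n)`. -/
def baseLattice (n : ℕ+) : Subgroup Heis :=
  Subgroup.closure {⟨1, 1 / 2⟩, ⟨Complex.I, 1 / 2⟩, ⟨0, 1 / (n : ℝ)⟩}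

/-! ## The semidirect product `((1/n)ℤ)² ⋊ GL₂(ℤ)` -/

/-- The subgroup `((1/n)ℤ)²` of `ℝ²`. -/
def fracLattice (n : ℕ+) : AddSubgroup (Fin 2 → ℝ) where
  carrier := {w | ∀ i, ∃ k : ℤ, w i = k / (n : ℝ)}
  add_mem' := by
    intro a b ha hb i
    obtain ⟨k, hk⟩ := ha i
    obtain ⟨l, hl⟩ := hb i
    exact ⟨k + l, by simp [hk, hl, add_div]⟩
  zero_mem' := fun _ => ⟨0, by simp⟩
  neg_mem' := by
    intro a ha i
    obtain ⟨k, hk⟩ := ha i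
    exact ⟨-k, by simp [hk, neg_div]⟩

/-- An integral matrix viewed as a real matrix. -/
def toReal (g : Matrix (Fin 2) (Fin 2) ℤ) : Matrix (Fin 2) (Fin 2) ℝ := g.map (Int.cast)

theorem toReal_mul (g h : Matrix (Fin 2) (Fin 2) ℤ) : toReal (g * h) = toReal g * toReal h :=
  Matrix.map_mul_intCast g h

theorem toReal_one : toReal 1 = 1 := by
  simp [toReal]

theorem toReal_mulVec_mem (n : ℕ+) (g : Matrix (Fin 2) (Fin 2) ℤ) {w : Fin 2 → ℝ}
    (hw : w ∈ fracLattice n) : (toReal g).mulVec w ∈ fracLattice n := by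
  intro i
  obtain ⟨k, hk⟩ := hw 0
  obtain ⟨l, hl⟩ := hw 1
  refine ⟨g i 0 * k + g i 1 * l, ?_⟩
  simp [Matrix.mulVec, dotProduct, Fin.sum_univ_two, toReal, hk, hl]
  ring

/-- The standard action of `GL₂(ℤ)` on `((1/n)ℤ)²`. -/
def fracAction (n : ℕ+) :
    GL (Fin 2) ℤ →* MulAut (Multiplicative (fracLattice n)) where
  toFun g := AddEquiv.toMultiplicative
    { toFun := fun w => ⟨(toReal g.1).mulVec w.1, toReal_mulVec_mem n g.1 w.2⟩
      invFun := fun w => ⟨(toReal (g⁻¹).1).mulVec w.1, toReal_mulVec_mem n (g⁻¹).1 w.2⟩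
      left_inv := fun w => Subtype.ext <| by
        simp only [Matrix.mulVec_mulVec, ← toReal_mul, ← Units.val_mul, inv_mul_cancel,
          Units.val_one, toReal_one, Matrix.one_mulVec]
      right_inv := fun w => Subtype.ext <| by
        simp only [Matrix.mulVec_mulVec, ← toReal_mul, ← Units.val_mul, mul_inv_cancel,
          Units.val_one, toReal_one, Matrix.one_mulVec]
      map_add' := fun v w => Subtype.ext <| by
        simp only [AddSubgroup.coe_add, Matrix.mulVec_add] }
  map_one' := by
    ext w : 1
    refine Subtype.ext ?_
    change (toReal 1).mulVec _ = _
    rw [toReal_one, Matrix.one_mulVec]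
    rfl
  map_mul' g h := by
    ext w : 1
    refine Subtype.ext ?_
    change (toReal (g.1 * h.1)).mulVec _ = (toReal g.1).mulVec ((toReal h.1).mulVec _)
    rw [toReal_mul, Matrix.mulVec_mulVec]

/-! ## The universal covering group and `ℤ² ⋊ SL₂(ℤ)~` -/

section UniversalCover

variable (G : Type*) [Group G] [TopologicalSpace G] [IsTopologicalGroup G]

/-- The group, under pointwise multiplication, of paths in `G` that start at `1`. -/
def basedPaths : Subgroup C(I, G) where
  carrier := {γ | γ 0 = 1}
  mul_mem' := by
    intro a b ha hb
    simp only [Set.mem_ofPred_eq] at ha hb ⊢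
    simp [ha, hb]
  one_mem' := rfl
  inv_mem' := by
    intro a ha
    simp only [Set.mem_ofPred_eq] at ha ⊢
    simp [ha]

/-- The loops at `1` that are homotopic, relative to the endpoints, to the constant loop. -/
def nullLoops : Subgroup (basedPaths G) where
  carrier := {γ | (γ : C(I, G)).HomotopicRel 1 {0, 1}}
  mul_mem' := by
    rintro a b ⟨F⟩ ⟨F'⟩
    refine ⟨⟨⟨⟨fun x => F x * F' x, by fun_prop⟩, ?_, ?_⟩, ?_⟩⟩
    · intro x
      simp
    · intro x
      simp
    · intro t x hx
      have h1 := F.eq_fst t hx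
      have h2 := F'.eq_fst t hx
      simp [h1, h2]
  one_mem' := ContinuousMap.HomotopicRel.refl _
  inv_mem' := by
    rintro a ⟨F⟩
    refine ⟨⟨⟨⟨fun x => (F x)⁻¹, by fun_prop⟩, ?_, ?_⟩, ?_⟩⟩
    · intro x
      simp
    · intro x
      simp
    · intro t x hx
      have h1 := F.eq_fst t hx
      simp [h1]

instance nullLoops_normal : (nullLoops G).Normal where
  conj_mem := by
    rintro a ⟨F⟩ c
    refine ⟨⟨⟨⟨fun x => (c : C(I, G)) x.2 * F x * ((c : C(I, G)) x.2)⁻¹, by fun_prop⟩, ?_, ?_⟩,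
      ?_⟩⟩
    · intro x
      simp
    · intro x
      simp
    · intro t x hx
      have h1 := F.eq_fst t hx
      simp [h1]

/-- The universal covering group of a (connected, locally simply connected) topological group `G`,
as an abstract group: paths starting at `1` up to homotopy relative to the endpoints, with pointwise
multiplication. -/
abbrev UniversalCover : Type _ := basedPaths G ⧸ nullLoops G

/-- The covering homomorphism, which sends the class of a path to its endpoint. -/
def coverHom : UniversalCover G →* G :=
  QuotientGroup.lift (nullLoops G)
    { toFun := fun γ => (γ : C(I, G)) 1
      map_one' := rfl
      map_mul' := fun _ _ => rfl }
    (by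
      rintro a ⟨F⟩
      have := F.fst_eq_snd (x := (1 : I)) (by simp)
      exact this)

end UniversalCover

/-- The inclusion of `SL₂(ℤ)` in `SL₂(ℝ)`. -/
def slInclusion : Matrix.SpecialLinearGroup (Fin 2) ℤ →* Matrix.SpecialLinearGroup (Fin 2) ℝ :=
  Matrix.SpecialLinearGroup.map (Int.castRingHom ℝ)

theorem slInclusion_injective : Function.Injective slInclusion :=
  Matrix.SpecialLinearGroup.map_intCast_injective

/-- The inverse image of `SL₂(ℤ)` in the universal covering group of `SL₂(ℝ)`. -/
def SL2ZTilde : Subgroup (UniversalCover (Matrix.SpecialLinearGroup (Fin 2) ℝ)) :=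
  slInclusion.range.comap (coverHom (Matrix.SpecialLinearGroup (Fin 2) ℝ))

/-- The covering projection, restricted to the inverse image of `SL₂(ℤ)`. -/
def SL2ZTilde.toSL2Z : SL2ZTilde →* Matrix.SpecialLinearGroup (Fin 2) ℤ :=
  (MonoidHom.ofInjective slInclusion_injective).symm.toMonoidHom.comp
    ((coverHom (Matrix.SpecialLinearGroup (Fin 2) ℝ)).subgroupComap slInclusion.range)

/-- The standard action of `SL₂(ℤ)` on `ℤ²`. -/
def slAction : Matrix.SpecialLinearGroup (Fin 2) ℤ →* MulAut (Multiplicative (Fin 2 → ℤ)) where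
  toFun g := AddEquiv.toMultiplicative (Matrix.SpecialLinearGroup.toLin' g).toAddEquiv
  map_one' := by
    rw [map_one]
    rfl
  map_mul' g h := by
    rw [map_mul]
    rfl

/-- The group `ℤ² ⋊ SL₂(ℤ)~`, where `SL₂(ℤ)~` acts through its projection to `SL₂(ℤ)`. -/
abbrev JacobiTilde : Type :=
  Multiplicative (Fin 2 → ℤ) ⋊[slAction.comp SL2ZTilde.toSL2Z] SL2ZTilde

/-! ## Topological notions -/

section Topological

/-- `p` is a (locally trivial) fibre bundle with fibre `F`. -/
def IsFibreBundle (F : Type*) [TopologicalSpace F] {E B : Type*} [TopologicalSpace E]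
    [TopologicalSpace B] (p : E → B) : Prop :=
  ∀ b : B, ∃ e : Bundle.Trivialization F p, b ∈ e.baseSet

/-- A topological manifold of dimension `d`, without boundary. -/
def IsTopologicalManifold (d : ℕ) (X : Type*) [TopologicalSpace X] : Prop :=
  T2Space X ∧ SecondCountableTopology X ∧ Nonempty (ChartedSpace (EuclideanSpace ℝ (Fin d)) X)

/-- An Eilenberg–MacLane space `K(π, 1)`: path connected, with fundamental group `π` and vanishing
higher homotopy groups. -/
def IsEilenbergMacLane (π : Type*) [Group π] (X : Type*) [TopologicalSpace X] : Prop :=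
  PathConnectedSpace X ∧ ∀ x : X, Nonempty (FundamentalGroup X x ≃* π) ∧
    ∀ k : ℕ, 2 ≤ k → Subsingleton (HomotopyGroup.Pi k X x)

end Topological

end HeisLattice

end

open scoped Pointwise Topology unitInterval

noncomputable section

namespace HeisLattice

/-! ### The Chabauty topology: neighbourhoods, separation, continuity of families -/

section

section ChabautyTopology

open Filter Set

variable {G : Type*} [Group G] [TopologicalSpace G] [IsTopologicalGroup G]

/-! Parametrisation. A commutator in `Heis` is central, and its central coordinate is the value of
the symplectic form `omega` on the projections. Hence, if a lattice Λ projects onto the plane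
lattice with positive basis u, then [Λ, Λ] is generated by (0, covol u), and the index condition
says that the central part of Λ is generated by (0, covol u / n). What remains is the choice of
lifts of the two basis vectors. It is recorded by two real numbers s, measured in units of the
central generator from the offset covol u / 2. Every lattice in question is therefore some
`heisLattice n u s` (`exists_eq_heisLattice`).

The offset is the decisive choice. Central coordinates over the vector with coordinates k are
measured from half the value of k₁ + k₂ + k₁k₂. Modulo 2 this is the quadratic form of Arf invariant
one. It is odd at every vector that is not zero modulo 2, in particular at the rows of an element of
SL₂(ℤ). A change of basis γ combined with a change of lifts w therefore acts by s ↦ γ s + w, with no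
correction term, and this relation does not involve n (`heisLattice_eq_iff`). For every n the space
of lattices is thus the quotient of `PosBasis` × ℝ² by the same affine action of ℤ² ⋊ SL₂(ℤ).
Forgetting s gives the torus bundle over the plane lattices, and the identity on parameters gives
the isomorphisms between the bundles.

Topology. The parametrisations are continuous because only finitely many indexed elements stay in a
compact set, locally uniformly in the parameters. They are open because a nearby subgroup contains
approximations of the generators, while avoiding a suitable compact set prevents it from being
strictly finer than what these generate (`isOpenMap_planeMk`, `isOpenMap_heisMk`). They are locally
injective because an integral matrix close to the identity is the identity.

Homotopy. A positive basis is (τz, z) with z ≠ 0 and τ in the upper half plane, so `expBasis` covers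
`PosBasis` by ℂ × ℍ. The universal covering group of SL₂(ℝ) acts on ℂ × ℍ by lifting paths, freely
because of the equivariant map `frame` to SL₂(ℝ). Hence ℤ² ⋊ SL₂(ℤ)~ acts freely on (ℂ × ℍ) × ℝ²,
which is homeomorphic to ℝ⁶, and the quotient map is a covering of the space of lattices
(`isQuotientCoveringMap_latticeCover`). The manifold structure, the fundamental group and the
vanishing of higher homotopy groups follow.

Stabiliser. A continuous automorphism has the form (z, t) ↦ (f z, r t + χ z) with f, χ linear and
`omega` scaled by r under f. Preservation of the base lattice makes f integral with determinant r =
±1 and χ valued in (1/n)ℤ on ℤ². Since `omega` is nondegenerate, χ is then the effect of conjugation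
by a unique vector of ((1/n)ℤ)². -/

theorem chabautyNhd_mem_nhds [LocallyCompactSpace G] {K U : Set G} (hK : IsCompact K)
    (hU : IsOpen U) (h1 : (1 : G) ∈ U) (C : ClosedSubgroup G) : chabautyNhd K U C ∈ 𝓝 C := by
  -- Openness is prescribed pointwise, so a basic set is not open by definition. The set S of points
  -- around which it contains a basic set serves as its interior.
  let S : Set (ClosedSubgroup G) := {D | ∃ K' U' : Set G, IsCompact K' ∧ IsOpen U' ∧
    (1 : G) ∈ U' ∧ chabautyNhd K' U' D ⊆ chabautyNhd K U C}
  have hsub : S ⊆ chabautyNhd K U C := by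
    rintro D ⟨K', U', -, -, h1', h⟩
    have hD : (D : Set G) ⊆ (D : Set G) * U' := fun x hx => ⟨x, hx, 1, h1', mul_one x⟩
    exact h ⟨inter_subset_left.trans hD, inter_subset_left.trans hD⟩
  have hopen : IsOpen S := by
    rintro D ⟨K', U', hK', hU', h1', h⟩
    obtain ⟨W, hWo, hW1, hWW⟩ := exists_open_nhds_one_mul_subset (hU'.mem_nhds h1')
    obtain ⟨V, hV1, hVW, hVc⟩ := local_compact_nhds (hWo.mem_nhds hW1)
    let U₂ := interior V
    have hVi : (1 : G) ∈ U₂ := mem_interior_iff_mem_nhds.2 hV1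
    refine ⟨K' * V⁻¹, U₂, hK'.mul hVc.inv, isOpen_interior, hVi, ?_⟩
    -- Triangle inequality: the approximating point b of B lies only in K' V⁻¹, which is why the
    -- compact set has to be enlarged.
    have key : ∀ A B E : ClosedSubgroup G, (A : Set G) ∩ K' ⊆ (B : Set G) * U₂ →
        (B : Set G) ∩ (K' * V⁻¹) ⊆ (E : Set G) * U₂ → (A : Set G) ∩ K' ⊆ (E : Set G) * U' := by
      rintro A B E hAB hBE x ⟨hxA, hxK⟩
      obtain ⟨b, hb, v, hv, rfl⟩ := hAB ⟨hxA, hxK⟩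
      obtain ⟨e, he, w, hw, hbe⟩ := hBE ⟨hb, b * v, hxK, v⁻¹,
        Set.inv_mem_inv.2 (interior_subset hv), mul_inv_cancel_right b v⟩
      refine ⟨e, he, w * v, hWW (mul_mem_mul (hVW (interior_subset hw))
        (hVW (interior_subset hv))), ?_⟩
      simp only [← hbe, mul_assoc]
    have hsubK : K' ⊆ K' * V⁻¹ := fun x hx =>
      ⟨x, hx, 1, by simpa using mem_of_mem_nhds hV1, mul_one x⟩
    rintro E ⟨hE1, hE2⟩
    refine ⟨K' * V⁻¹, U₂, hK'.mul hVc.inv, isOpen_interior, hVi, ?_⟩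
    rintro F ⟨hF1, hF2⟩
    exact h ⟨key F E D ((inter_subset_inter_right _ hsubK).trans hF1) hE1,
      key D E F ((inter_subset_inter_right _ hsubK).trans hE2) hF2⟩
  exact mem_of_superset (hopen.mem_nhds ⟨K, U, hK, hU, h1, subset_rfl⟩) hsub

/-- The Chabauty space of a locally compact group is Hausdorff. -/
theorem t2Space_closedSubgroup [LocallyCompactSpace G] : T2Space (ClosedSubgroup G) := by
  have key : ∀ C D : ClosedSubgroup G, ∀ x ∈ C, x ∉ D →
      ∃ u v : Set (ClosedSubgroup G), u ∈ 𝓝 C ∧ v ∈ 𝓝 D ∧ Disjoint u v := by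
    intro C D x hxC hxD
    have hDc : IsOpen ((D : Set G)ᶜ) := D.isClosed'.isOpen_compl
    obtain ⟨W, hW, hWD⟩ := compact_open_separated_mul_right (isCompact_singleton (x := x)) hDc
      (by simpa using hxD)
    -- A common neighbour E would have an element near x, and D an element near that one. Two steps
    -- in W' stay inside W⁻¹, whereas x W misses D.
    obtain ⟨W', hW'o, hW'1, hWW⟩ := exists_open_nhds_one_mul_subset (inv_mem_nhds_one G hW)
    obtain ⟨V, hV1, hVW, hVc⟩ := local_compact_nhds (hW'o.mem_nhds hW'1)
    have hVi : (1 : G) ∈ interior V := mem_interior_iff_mem_nhds.2 hV1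
    refine ⟨_, _, chabautyNhd_mem_nhds (isCompact_singleton (x := x)) isOpen_interior hVi C,
      chabautyNhd_mem_nhds (isCompact_singleton.mul hVc.inv : IsCompact ({x} * V⁻¹))
        isOpen_interior hVi D, Set.disjoint_left.2 ?_⟩
    rintro E ⟨-, h1⟩ ⟨h2, -⟩
    obtain ⟨e, he, v, hv, hev⟩ := h1 ⟨hxC, rfl⟩
    have hev : e * v = x := hev
    obtain ⟨d, hd, w, hw, hdw⟩ := h2 ⟨he, x, rfl, v⁻¹, Set.inv_mem_inv.2 (interior_subset hv), by
      simp [← hev]⟩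
    have hdw : d * w = e := hdw
    have hmem : (w * v)⁻¹ ∈ W := by
      simpa using hWW (mul_mem_mul (hVW (interior_subset hw)) (hVW (interior_subset hv)))
    refine hWD (mul_mem_mul (mem_singleton x) hmem) ?_
    rw [← hev, ← hdw]
    simpa [mul_assoc] using hd
  refine ⟨fun C D hCD => ?_⟩
  suffices h : ∃ u v : Set (ClosedSubgroup G), u ∈ 𝓝 C ∧ v ∈ 𝓝 D ∧ Disjoint u v by
    obtain ⟨u, v, hu, hv, huv⟩ := h
    exact ⟨interior u, interior v, isOpen_interior, isOpen_interior,
      mem_interior_iff_mem_nhds.2 hu, mem_interior_iff_mem_nhds.2 hv,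
      huv.mono interior_subset interior_subset⟩
  by_cases h : ∃ x ∈ C, x ∉ D
  · obtain ⟨x, hx, hx'⟩ := h
    exact key C D x hx hx'
  · push Not at h
    obtain ⟨x, hx, hx'⟩ : ∃ x ∈ D, x ∉ C := by
      by_contra! h'
      exact hCD (ClosedSubgroup.toSubgroup_injective (le_antisymm h h'))
    obtain ⟨u, v, hu, hv, huv⟩ := key D C x hx hx'
    exact ⟨v, u, hv, hu, huv.symm⟩

/-- A family of closed subgroups given by continuously varying elements, of which only finitely
many stay in a given compact set, is continuous for the Chabauty topology. -/
theorem continuous_closedSubgroup_of_range {P ι : Type*} [TopologicalSpace P]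
    (C : P → ClosedSubgroup G) (ev : P → ι → G) (hC : ∀ p, (C p : Set G) = range (ev p))
    (hev : ∀ i, Continuous fun p => ev p i)
    (hfin : ∀ (p₀ : P) (K : Set G), IsCompact K →
      ∃ F : Set ι, F.Finite ∧ ∀ᶠ p in 𝓝 p₀, ∀ i, ev p i ∈ K → i ∈ F) :
    Continuous C := by
  refine continuous_def.2 fun S hS => isOpen_iff_mem_nhds.2 fun p₀ hp₀ => ?_
  obtain ⟨K, U, hK, hU, h1, hKU⟩ := hS (C p₀) hp₀
  obtain ⟨F, hF, hFK⟩ := hfin p₀ K hK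
  have hnear : ∀ᶠ p in 𝓝 p₀, ∀ i ∈ F, (ev p₀ i)⁻¹ * ev p i ∈ U ∧ (ev p i)⁻¹ * ev p₀ i ∈ U := by
    refine (Set.Finite.eventually_all hF).2 fun i _ => ?_
    have h : ContinuousAt (fun p => (ev p₀ i)⁻¹ * ev p i) p₀ :=
      (continuous_const.mul (hev i)).continuousAt
    have h' : ContinuousAt (fun p => (ev p i)⁻¹ * ev p₀ i) p₀ :=
      ((hev i).inv.mul continuous_const).continuousAt
    exact (h.eventually_mem (hU.mem_nhds (by simpa using h1))).and
      (h'.eventually_mem (hU.mem_nhds (by simpa using h1)))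
  filter_upwards [hnear, hFK] with p hp hpK
  refine hKU ⟨?_, ?_⟩
  · rintro x ⟨hx, hxK⟩
    rw [hC] at hx
    obtain ⟨i, rfl⟩ := hx
    exact ⟨ev p₀ i, by rw [hC]; exact mem_range_self i, _, (hp i (hpK i hxK)).1, by simp⟩
  · rintro x ⟨hx, hxK⟩
    rw [hC] at hx
    obtain ⟨i, rfl⟩ := hx
    exact ⟨ev p i, by rw [hC]; exact mem_range_self i, _,
      (hp i (hFK.self_of_nhds i hxK)).2, by simp⟩

/-- A criterion for local finiteness by means of a continuous coordinate function. -/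
theorem exists_finite_eventually_of_coord {P ι X : Type*} [TopologicalSpace P] [TopologicalSpace X]
    {E : Type*} [NormedAddCommGroup E] (ev : P → ι → X) (coord : P × X → E)
    (hcoord : Continuous coord) (j : ι → E) (hj : ∀ R : ℝ, {i | ‖j i‖ < R}.Finite)
    (h : ∀ p i, coord (p, ev p i) = j i) (p₀ : P) (K : Set X) (hK : IsCompact K) :
    ∃ F : Set ι, F.Finite ∧ ∀ᶠ p in 𝓝 p₀, ∀ i, ev p i ∈ K → i ∈ F := by
  have hcomp : IsCompact ((fun x => ‖coord (p₀, x)‖) '' K) := hK.image (by fun_prop)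
  obtain ⟨R, hR⟩ := hcomp.bddAbove
  -- The coordinate is bounded by R on K at p₀. By the tube lemma the weaker bound R + 1 persists
  -- for nearby parameters.
  have hopen : IsOpen {y : P × X | ‖coord y‖ < R + 1} :=
    isOpen_lt (by fun_prop) continuous_const
  obtain ⟨u, v, hu, -, hpu, hKv, huv⟩ := generalized_tube_lemma (isCompact_singleton (x := p₀)) hK
    hopen (by
      rintro ⟨p, x⟩ ⟨rfl, hx⟩
      exact (hR (mem_image_of_mem _ hx)).trans_lt (lt_add_one R))
  refine ⟨_, hj (R + 1), ?_⟩
  filter_upwards [hu.mem_nhds (hpu rfl)] with p hp i hi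
  have := huv (mk_mem_prod hp (hKv hi))
  rwa [Set.mem_ofPred_eq, h] at this

end ChabautyTopology

end

/-! ### The Heisenberg group and an explicit family of subgroups -/

section

open Filter Set MeasureTheory

/-- The standard symplectic form `Im (conj z * w)`. -/
def omega (z w : ℂ) : ℝ := z.re * w.im - z.im * w.re

@[fun_prop]
theorem continuous_omega {X : Type*} [TopologicalSpace X] {f g : X → ℂ} (hf : Continuous f)
    (hg : Continuous g) : Continuous fun x => omega (f x) (g x) := by
  unfold omega
  have h1 := Complex.continuous_re.comp hf
  have h2 := Complex.continuous_im.comp hf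
  have h3 := Complex.continuous_re.comp hg
  have h4 := Complex.continuous_im.comp hg
  exact (h1.mul h4).sub (h2.mul h3)

theorem im_conj_mul (z w : ℂ) : ((starRingEnd ℂ) z * w).im = omega z w := by
  simp [omega]
  ring

namespace Heis

theorem mul_t_omega (a b : Heis) : (a * b).t = a.t + b.t + omega a.z b.z / 2 := by
  rw [mul_t, im_conj_mul]

/-- The identification of the Heisenberg group with `ℂ × ℝ` as a topological space. -/
def homeoProd : Heis ≃ₜ ℂ × ℝ where
  toFun h := (h.z, h.t)
  invFun p := ⟨p.1, p.2⟩
  left_inv _ := rfl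
  right_inv _ := rfl
  continuous_toFun := continuous_induced_dom
  continuous_invFun := continuous_induced_rng.2 continuous_id

@[fun_prop]
theorem continuous_z : Continuous Heis.z := continuous_fst.comp homeoProd.continuous

@[fun_prop]
theorem continuous_t : Continuous Heis.t := continuous_snd.comp homeoProd.continuous

@[fun_prop]
theorem continuous_mk {X : Type*} [TopologicalSpace X] {f : X → ℂ} {g : X → ℝ}
    (hf : Continuous f) (hg : Continuous g) : Continuous fun x => (⟨f x, g x⟩ : Heis) :=
  homeoProd.symm.continuous.comp (hf.prodMk hg)

instance : IsTopologicalGroup Heis where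
  continuous_mul := by
    have : (fun p : Heis × Heis => p.1 * p.2) = fun p =>
        ⟨p.1.z + p.2.z, p.1.t + p.2.t + omega p.1.z p.2.z / 2⟩ := by
      ext p
      · rfl
      · exact mul_t_omega _ _
    rw [this]
    fun_prop
  continuous_inv := by
    change Continuous fun h : Heis => (⟨-h.z, -h.t⟩ : Heis)
    fun_prop

instance : LocallyCompactSpace Heis := homeoProd.isClosedEmbedding.locallyCompactSpace

instance : T2Space Heis := homeoProd.symm.t2Space

theorem mem_center_iff {h : Heis} : h ∈ Subgroup.center Heis ↔ h.z = 0 := by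
  rw [Subgroup.mem_center_iff]
  constructor
  · intro hh
    have h1 := congrArg Heis.t (hh ⟨1, 0⟩)
    have h2 := congrArg Heis.t (hh ⟨Complex.I, 0⟩)
    simp only [mul_t_omega, omega] at h1 h2
    simp at h1 h2
    apply Complex.ext <;> simp <;> linarith
  · intro hz g
    ext
    · simp [add_comm]
    · simp [hz, add_comm]

theorem zpow_z (a : Heis) (k : ℤ) : (a ^ k).z = k * a.z := by
  have h : proj (a ^ k) = proj a ^ k := map_zpow _ _ _
  have h' := congrArg Multiplicative.toAdd h
  rw [toAdd_zpow] at h'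
  simpa [proj, zsmul_eq_mul] using h'

theorem commutator_eq (a b : Heis) : a * b * a⁻¹ * b⁻¹ = ⟨0, omega a.z b.z⟩ := by
  ext
  · simp
  · simp only [mul_t_omega, inv_t, inv_z, mul_z, omega, Complex.neg_re, Complex.neg_im,
      Complex.add_re, Complex.add_im]
    ring

theorem mk_zero_mul (t t' : ℝ) : (⟨0, t⟩ * ⟨0, t'⟩ : Heis) = ⟨0, t + t'⟩ := by
  ext
  · simp
  · simp

/-- The inclusion of the centre. -/
def centerHom : Multiplicative ℝ →* Heis where
  toFun t := ⟨0, t.toAdd⟩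
  map_one' := rfl
  map_mul' _ _ := (mk_zero_mul _ _).symm

theorem mk_zero_zpow (t : ℝ) (k : ℤ) : (⟨0, t⟩ ^ k : Heis) = ⟨0, k * t⟩ := by
  have := (map_zpow centerHom (Multiplicative.ofAdd t) k).symm
  rw [← ofAdd_zsmul] at this
  simpa [centerHom] using this

/-- Dividing an element by a product of powers of a and b with the same projection leaves a central
element. A subgroup is thus determined by its central part and by lifts of generators of its
projection. -/
theorem le_of_generators {Λ Λ' : Subgroup Heis} (hc : ∀ t, (⟨0, t⟩ : Heis) ∈ Λ → ⟨0, t⟩ ∈ Λ')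
    {a b : Heis} (ha : a ∈ Λ) (hb : b ∈ Λ) (ha' : a ∈ Λ') (hb' : b ∈ Λ')
    (h : ∀ x ∈ Λ, ∃ k l : ℤ, x.z = k * a.z + l * b.z) : Λ ≤ Λ' := by
  intro x hx
  obtain ⟨k, l, hkl⟩ := h x hx
  have hy : a ^ k * b ^ l ∈ Λ := mul_mem (zpow_mem ha _) (zpow_mem hb _)
  have hy' : a ^ k * b ^ l ∈ Λ' := mul_mem (zpow_mem ha' _) (zpow_mem hb' _)
  have hxy : x * (a ^ k * b ^ l)⁻¹ ∈ Λ := mul_mem hx (inv_mem hy)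
  have hz : (x * (a ^ k * b ^ l)⁻¹).z = 0 := by
    simp [zpow_z, hkl]
  have heq : x * (a ^ k * b ^ l)⁻¹ = ⟨0, (x * (a ^ k * b ^ l)⁻¹).t⟩ := by
    ext1
    · exact hz
    · rfl
  rw [heq] at hxy
  have h2 := hc _ hxy
  rw [← heq] at h2
  simpa only [inv_mul_cancel_right] using mul_mem h2 hy'

theorem eq_of_generators {Λ Λ' : Subgroup Heis} (hc : ∀ t, (⟨0, t⟩ : Heis) ∈ Λ ↔ ⟨0, t⟩ ∈ Λ')
    {a b : Heis} (ha : a ∈ Λ) (hb : b ∈ Λ) (ha' : a ∈ Λ') (hb' : b ∈ Λ')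
    (h : ∀ x ∈ Λ, ∃ k l : ℤ, x.z = k * a.z + l * b.z)
    (h' : ∀ x ∈ Λ', ∃ k l : ℤ, x.z = k * a.z + l * b.z) : Λ = Λ' :=
  le_antisymm (le_of_generators (fun t => (hc t).1) ha hb ha' hb' h)
    (le_of_generators (fun t => (hc t).2) ha' hb' ha hb h')

end Heis

/-- Positively oriented bases `(u 0, u 1)` of `ℂ`, the orientation being such that
`u 0 / u 1` lies in the upper half plane. -/
abbrev PosBasis : Type := {u : Fin 2 → ℂ // 0 < omega (u 1) (u 0)}

namespace PosBasis

/-- The covolume of the lattice spanned by a basis. -/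
def covol (u : PosBasis) : ℝ := omega (u.1 1) (u.1 0)

theorem covol_pos (u : PosBasis) : 0 < u.covol := u.2

theorem covol_ne_zero (u : PosBasis) : u.covol ≠ 0 := u.2.ne'

@[fun_prop]
theorem continuous_val_apply {X : Type*} [TopologicalSpace X] {f : X → PosBasis}
    (hf : Continuous f) (i : Fin 2) : Continuous fun x => (f x).1 i :=
  (continuous_apply i).comp (continuous_subtype_val.comp hf)

@[fun_prop]
theorem continuous_covol : Continuous covol := by
  exact continuous_omega (continuous_val_apply continuous_id 1)
    (continuous_val_apply continuous_id 0)

/-- The integral combinations of a basis. -/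
def comb (u : PosBasis) (k : ℤ × ℤ) : ℂ := k.1 * u.1 0 + k.2 * u.1 1

/-- The real coordinates with respect to a basis. -/
def coord (u : PosBasis) (z : ℂ) : ℝ × ℝ := (omega (u.1 1) z / u.covol, omega z (u.1 0) / u.covol)

theorem continuous_coord : Continuous fun p : PosBasis × ℂ => coord p.1 p.2 := by
  unfold coord
  have h : ∀ p : PosBasis × ℂ, p.1.covol ≠ 0 := fun p => p.1.covol_ne_zero
  exact Continuous.prodMk
    ((continuous_omega (continuous_val_apply continuous_fst 1) continuous_snd).div (by fun_prop) h)
    ((continuous_omega continuous_snd (continuous_val_apply continuous_fst 0)).div (by fun_prop) h)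

theorem coord_real_comb (u : PosBasis) (x y : ℝ) : u.coord (x * u.1 0 + y * u.1 1) = (x, y) := by
  have := u.covol_ne_zero
  unfold coord
  ext
  · simp only
    rw [div_eq_iff this]
    simp [omega, covol]
    ring
  · simp only
    rw [div_eq_iff this]
    simp [omega, covol]
    ring

theorem coord_comb (u : PosBasis) (k : ℤ × ℤ) : u.coord (u.comb k) = ((k.1 : ℝ), (k.2 : ℝ)) := by
  simpa [comb] using u.coord_real_comb k.1 k.2

theorem real_comb_coord (u : PosBasis) (z : ℂ) :
    (u.coord z).1 * u.1 0 + (u.coord z).2 * u.1 1 = z := by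
  have h := u.covol_ne_zero
  have hc : u.covol = omega (u.1 1) (u.1 0) := rfl
  unfold coord
  rw [hc] at h ⊢
  unfold omega at h ⊢
  apply Complex.ext
  · simp only [Complex.add_re, Complex.re_ofReal_mul]
    field_simp
    ring
  · simp only [Complex.add_im, Complex.im_ofReal_mul]
    field_simp
    ring

theorem comb_injective (u : PosBasis) : Function.Injective u.comb := by
  intro k l h
  have h' := congrArg u.coord h
  rw [coord_comb, coord_comb, Prod.mk.injEq] at h'
  exact Prod.ext (by exact_mod_cast h'.1) (by exact_mod_cast h'.2)

theorem omega_comb (u : PosBasis) (k l : ℤ × ℤ) :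
    omega (u.comb k) (u.comb l) = u.covol * (k.2 * l.1 - k.1 * l.2) := by
  simp [omega, covol, comb]
  ring

theorem comb_add (u : PosBasis) (k l : ℤ × ℤ) : u.comb (k + l) = u.comb k + u.comb l := by
  simp [comb]
  ring

theorem comb_neg (u : PosBasis) (k : ℤ × ℤ) : u.comb (-k) = -u.comb k := by
  simp [comb]
  ring

@[simp] theorem comb_zero (u : PosBasis) : u.comb 0 = 0 := by simp [comb]

end PosBasis

/-- The elements of the lattice with basis `u` of its projection, and parameters `s`. -/
def heisElt (n : ℕ+) (u : PosBasis) (s : Fin 2 → ℝ) (k : ℤ × ℤ) (j : ℤ) : Heis :=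
  -- The quadratic term makes the set closed under products. Its linear part selects the form of Arf
  -- invariant one modulo 2, which is what makes the action of SL₂(ℤ) on s free of correction terms.
  ⟨u.comb k, u.covol * ((k.1 + k.2 + k.1 * k.2) / 2 + (s 0 * k.1 + s 1 * k.2) / n + j / n)⟩

/-- The lattice of the Heisenberg group whose projection has basis `u`, generated by
`(u i, covol u * (1 / 2 + s i / n))` and `(0, covol u / n)`. -/
def heisLattice (n : ℕ+) (u : PosBasis) (s : Fin 2 → ℝ) : Subgroup Heis where
  carrier := range fun i : (ℤ × ℤ) × ℤ => heisElt n u s i.1 i.2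
  mul_mem' := by
    rintro _ _ ⟨⟨k, j⟩, rfl⟩ ⟨⟨k', j'⟩, rfl⟩
    -- The polarisation of k₁ + k₂ + k₁k₂ is k₁k₂' + k₂k₁'. Its half and the half of `omega` differ
    -- by the integer k₁k₂', which amounts to n k₁k₂' central steps.
    refine ⟨(k + k', j + j' - n * (k.1 * k'.2)), ?_⟩
    have hn : ((n : ℕ) : ℝ) ≠ 0 := by positivity
    ext1
    · exact u.comb_add k k'
    · rw [Heis.mul_t_omega]
      simp only [heisElt, u.omega_comb, Prod.fst_add, Prod.snd_add]
      push_cast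
      field_simp
      ring
  one_mem' := ⟨0, by ext1 <;> simp [heisElt]⟩
  inv_mem' := by
    rintro _ ⟨⟨k, j⟩, rfl⟩
    refine ⟨(-k, -j - n * (k.1 * k.2)), ?_⟩
    have hn : ((n : ℕ) : ℝ) ≠ 0 := by positivity
    ext1
    · exact u.comb_neg k
    · simp only [heisElt, Heis.inv_t, Prod.fst_neg, Prod.snd_neg]
      push_cast
      field_simp
      ring

theorem mem_heisLattice {n : ℕ+} {u : PosBasis} {s : Fin 2 → ℝ} {x : Heis} :
    x ∈ heisLattice n u s ↔ ∃ k j, heisElt n u s k j = x := by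
  constructor
  · rintro ⟨⟨k, j⟩, h⟩
    exact ⟨k, j, h⟩
  · rintro ⟨k, j, h⟩
    exact ⟨⟨k, j⟩, h⟩

theorem mk_zero_mem_heisLattice {n : ℕ+} {u : PosBasis} {s : Fin 2 → ℝ} {t : ℝ} :
    (⟨0, t⟩ : Heis) ∈ heisLattice n u s ↔ ∃ j : ℤ, t = j * (u.covol / n) := by
  rw [mem_heisLattice]
  constructor
  · rintro ⟨k, j, h⟩
    rw [Heis.ext_iff] at h
    obtain ⟨h1, h2⟩ := h
    have hk : k = 0 := u.comb_injective (by rw [u.comb_zero]; exact h1)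
    refine ⟨j, ?_⟩
    simp only [heisElt, hk] at h2
    rw [← h2]
    simp
    ring
  · rintro ⟨j, rfl⟩
    refine ⟨0, j, ?_⟩
    ext1
    · simp [heisElt]
    · simp [heisElt]
      ring

theorem exists_comb_of_mem_heisLattice {n : ℕ+} {u : PosBasis} {s : Fin 2 → ℝ} {x : Heis}
    (hx : x ∈ heisLattice n u s) : ∃ k, x.z = u.comb k := by
  obtain ⟨k, j, rfl⟩ := mem_heisLattice.1 hx
  exact ⟨k, rfl⟩

/-- The generators over the basis vectors. -/
def heisGen (n : ℕ+) (u : PosBasis) (s : Fin 2 → ℝ) (i : Fin 2) : Heis :=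
  ⟨u.1 i, u.covol * (1 / 2 + s i / n)⟩

theorem heisGen_mem (n : ℕ+) (u : PosBasis) (s : Fin 2 → ℝ) (i : Fin 2) :
    heisGen n u s i ∈ heisLattice n u s := by
  rw [mem_heisLattice]
  fin_cases i
  · exact ⟨(1, 0), 0, by ext1 <;> simp [heisElt, heisGen, PosBasis.comb]⟩
  · exact ⟨(0, 1), 0, by ext1 <;> simp [heisElt, heisGen, PosBasis.comb]⟩

/-- A subgroup is one of the standard lattices as soon as it has the right centre, the right
projection, and contains the generators. -/
theorem eq_heisLattice {n : ℕ+} {u : PosBasis} {s : Fin 2 → ℝ} {Λ : Subgroup Heis}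
    (hc : ∀ t, (⟨0, t⟩ : Heis) ∈ Λ ↔ ∃ j : ℤ, t = j * (u.covol / n))
    (hz : ∀ x ∈ Λ, ∃ k, x.z = u.comb k) (hg : ∀ i, heisGen n u s i ∈ Λ) :
    Λ = heisLattice n u s := by
  refine Heis.eq_of_generators (fun t => (hc t).trans mk_zero_mem_heisLattice.symm) (hg 0) (hg 1)
    (heisGen_mem n u s 0) (heisGen_mem n u s 1) ?_ ?_
  · intro x hx
    obtain ⟨k, hk⟩ := hz x hx
    exact ⟨k.1, k.2, hk⟩
  · intro x hx
    obtain ⟨k, hk⟩ := exists_comb_of_mem_heisLattice hx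
    exact ⟨k.1, k.2, hk⟩

end

section

open Filter Set MeasureTheory

/-! ### The standard lattices are lattices -/

/-- Real coordinates on the Heisenberg group that are integral on `heisLattice n u s`. -/
def heisCoord (n : ℕ+) (p : (PosBasis × (Fin 2 → ℝ)) × Heis) : (ℝ × ℝ) × ℝ :=
  (p.1.1.coord p.2.z, n * (p.2.t / p.1.1.covol - ((p.1.1.coord p.2.z).1 + (p.1.1.coord p.2.z).2 +
    (p.1.1.coord p.2.z).1 * (p.1.1.coord p.2.z).2) / 2) -
    (p.1.2 0 * (p.1.1.coord p.2.z).1 + p.1.2 1 * (p.1.1.coord p.2.z).2))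

theorem continuous_heisCoord (n : ℕ+) : Continuous (heisCoord n) := by
  have h1 : Continuous fun p : (PosBasis × (Fin 2 → ℝ)) × Heis => p.1.1.coord p.2.z :=
    PosBasis.continuous_coord.comp (by fun_prop :
      Continuous fun p : (PosBasis × (Fin 2 → ℝ)) × Heis => (p.1.1, p.2.z))
  have h2 : Continuous fun p : (PosBasis × (Fin 2 → ℝ)) × Heis => p.2.t / p.1.1.covol :=
    Continuous.div (by fun_prop) (by fun_prop) fun p => p.1.1.covol_ne_zero
  have h3 := continuous_fst.comp h1
  have h4 := continuous_snd.comp h1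
  have h5 : Continuous fun p : (PosBasis × (Fin 2 → ℝ)) × Heis => p.1.2 0 := by fun_prop
  have h6 : Continuous fun p : (PosBasis × (Fin 2 → ℝ)) × Heis => p.1.2 1 := by fun_prop
  exact h1.prodMk ((continuous_const.mul
    (h2.sub (((h3.add h4).add (h3.mul h4)).div_const 2))).sub ((h5.mul h3).add (h6.mul h4)))

theorem heisCoord_heisElt (n : ℕ+) (p : PosBasis × (Fin 2 → ℝ)) (k : ℤ × ℤ) (j : ℤ) :
    heisCoord n (p, heisElt n p.1 p.2 k j) = (((k.1 : ℝ), (k.2 : ℝ)), (j : ℝ)) := by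
  have hn : ((n : ℕ) : ℝ) ≠ 0 := by positivity
  have hc := p.1.covol_ne_zero
  simp only [heisCoord, heisElt, PosBasis.coord_comb]
  congr 1
  field_simp
  ring

theorem heisCoord_one (n : ℕ+) (p : PosBasis × (Fin 2 → ℝ)) : heisCoord n (p, 1) = 0 := by
  have h := heisCoord_heisElt n p 0 0
  have h1 : heisElt n p.1 p.2 0 0 = 1 := by ext1 <;> simp [heisElt]
  rw [h1] at h
  rw [h]
  simp

theorem int_eq_zero_of_norm_lt {k : ℤ} (h : ‖(k : ℝ)‖ < 1) : k = 0 := by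
  rw [Real.norm_eq_abs, ← Int.cast_abs] at h
  exact Int.abs_lt_one_iff.1 (by exact_mod_cast h)

instance discreteTopology_heisLattice (n : ℕ+) (u : PosBasis) (s : Fin 2 → ℝ) :
    DiscreteTopology (heisLattice n u s) := by
  rw [discreteTopology_iff_isOpen_singleton_one]
  have hopen : IsOpen {x : heisLattice n u s | ‖heisCoord n ((u, s), x.1)‖ < 1} :=
    isOpen_lt (((continuous_heisCoord n).comp (by fun_prop)).norm) continuous_const
  convert hopen using 1
  ext ⟨x, hx⟩
  simp only [mem_singleton_iff, mem_ofPred_eq]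
  constructor
  · intro h
    rw [Subgroup.mk_eq_one] at h
    simp [h, heisCoord_one]
  · intro h
    obtain ⟨k, j, rfl⟩ := mem_heisLattice.1 hx
    rw [heisCoord_heisElt n (u, s) k j, Prod.norm_def, Prod.norm_def, sup_lt_iff, sup_lt_iff] at h
    have h1 := int_eq_zero_of_norm_lt h.1.1
    have h2 := int_eq_zero_of_norm_lt h.1.2
    have h3 := int_eq_zero_of_norm_lt h.2
    rw [Subgroup.mk_eq_one]
    ext1 <;> simp [heisElt, PosBasis.comb, h1, h2, h3]

instance countable_heisLattice (n : ℕ+) (u : PosBasis) (s : Fin 2 → ℝ) :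
    Countable (heisLattice n u s) :=
  (countable_range fun i : (ℤ × ℤ) × ℤ => heisElt n u s i.1 i.2).to_subtype

instance : MeasurableSpace Heis := borel Heis

instance : BorelSpace Heis := ⟨rfl⟩

namespace Heis

/-- Lebesgue measure, which is a Haar measure, on the Heisenberg group. -/
def haarVolume : Measure Heis := (volume : Measure (ℂ × ℝ)).map homeoProd.symm

theorem measurePreserving_homeoProd_symm :
    MeasurePreserving homeoProd.symm (volume : Measure (ℂ × ℝ)) haarVolume :=
  ⟨homeoProd.symm.measurable, rfl⟩

theorem measurePreserving_homeoProd :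
    MeasurePreserving homeoProd haarVolume (volume : Measure (ℂ × ℝ)) :=
  measurePreserving_homeoProd_symm.symm homeoProd.symm.toMeasurableEquiv

theorem measurePreserving_shear (w : ℂ) (f : ℂ → ℝ) (hf : Continuous f) :
    MeasurePreserving (fun p : ℂ × ℝ => (w + p.1, f p.1 + p.2)) volume volume :=
  MeasurePreserving.skew_product (g := fun z t => f z + t) (measurePreserving_add_left volume w)
    (by
      apply Continuous.measurable
      simp only [Function.uncurry_def]
      fun_prop)
    (Eventually.of_forall fun z => (measurePreserving_add_left volume (f z)).map_eq)

theorem measurePreserving_mul_left (g : Heis) :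
    MeasurePreserving (fun x => g * x) haarVolume haarVolume := by
  convert (measurePreserving_homeoProd_symm.comp (measurePreserving_shear g.z
    (fun z => g.t + omega g.z z / 2) (by fun_prop))).comp measurePreserving_homeoProd using 1
  ext1 x
  ext1
  · rfl
  · rw [mul_t_omega]
    change _ = g.t + omega g.z x.z / 2 + x.t
    ring

theorem measurePreserving_mul_right (g : Heis) :
    MeasurePreserving (fun x => x * g) haarVolume haarVolume := by
  convert (measurePreserving_homeoProd_symm.comp (measurePreserving_shear g.z
    (fun z => g.t + omega z g.z / 2) (by fun_prop))).comp measurePreserving_homeoProd using 1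
  ext1 x
  ext1
  · exact add_comm _ _
  · rw [mul_t_omega]
    change _ = g.t + omega x.z g.z / 2 + x.t
    ring

end Heis

/-- A fundamental domain for `heisLattice n u s`. -/
def heisDomain (n : ℕ+) (u : PosBasis) : Set Heis :=
  {x | u.coord x.z ∈ Ico (0 : ℝ) 1 ×ˢ Ico (0 : ℝ) 1 ∧ n * x.t / u.covol ∈ Ico (0 : ℝ) 1}

theorem measurableSet_heisDomain (n : ℕ+) (u : PosBasis) : MeasurableSet (heisDomain n u) := by
  have h1 : Continuous fun x : Heis => u.coord x.z :=
    PosBasis.continuous_coord.comp (by fun_prop : Continuous fun x : Heis => (u, x.z))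
  have h2 : Continuous fun x : Heis => n * x.t / u.covol := by fun_prop
  exact (h1.measurable (measurableSet_Ico.prod measurableSet_Ico)).inter
    (h2.measurable measurableSet_Ico)

theorem add_intCast_mem_Ico_iff {a : ℝ} {k : ℤ} : a + k ∈ Ico (0 : ℝ) 1 ↔ k = -⌊a⌋ := by
  rw [eq_comm, neg_eq_iff_eq_neg, Int.floor_eq_iff, mem_Ico]
  push_cast
  constructor
  · rintro ⟨h1, h2⟩
    constructor <;> linarith
  · rintro ⟨h1, h2⟩
    constructor <;> linarith

theorem PosBasis.coord_add_comb (u : PosBasis) (z : ℂ) (k : ℤ × ℤ) :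
    u.coord (z + u.comb k) = ((u.coord z).1 + k.1, (u.coord z).2 + k.2) := by
  conv_lhs => rw [← u.real_comb_coord z]
  rw [← u.coord_real_comb]
  congr 1
  simp [comb]
  ring

/-- Right translation shifts the two plane coordinates by integers, which forces k through the
floors. Once k is fixed, the normalised central coordinate is shifted by j, which forces j. Right
translation is used because the quotient consists of left cosets. -/
theorem heisLattice_existsUnique (n : ℕ+) (u : PosBasis) (s : Fin 2 → ℝ) (x : Heis) :
    ∃! g : (heisLattice n u s).op, g • x ∈ heisDomain n u := by
  have hn : ((n : ℕ) : ℝ) ≠ 0 := by positivity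
  have hc := u.covol_ne_zero
  have key : ∀ k j, x * heisElt n u s k j ∈ heisDomain n u ↔
      (k.1 = -⌊(u.coord x.z).1⌋ ∧ k.2 = -⌊(u.coord x.z).2⌋) ∧
      j = -⌊n * (x * heisElt n u s k 0).t / u.covol⌋ := by
    intro k j
    have ht : n * (x * heisElt n u s k j).t / u.covol =
        n * (x * heisElt n u s k 0).t / u.covol + j := by
      rw [Heis.mul_t_omega, Heis.mul_t_omega]
      simp only [heisElt]
      field_simp
      push_cast
      ring
    have hz : u.coord (x * heisElt n u s k j).z =
        ((u.coord x.z).1 + k.1, (u.coord x.z).2 + k.2) := u.coord_add_comb _ _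
    rw [heisDomain, mem_ofPred_eq, ht, hz, mem_prod, add_intCast_mem_Ico_iff,
      add_intCast_mem_Ico_iff, add_intCast_mem_Ico_iff]
  let k : ℤ × ℤ := (-⌊(u.coord x.z).1⌋, -⌊(u.coord x.z).2⌋)
  let j : ℤ := -⌊n * (x * heisElt n u s k 0).t / u.covol⌋
  refine ⟨⟨MulOpposite.op (heisElt n u s k j), mem_heisLattice.2 ⟨k, j, rfl⟩⟩,
    (key k j).2 ⟨⟨rfl, rfl⟩, rfl⟩, ?_⟩
  rintro ⟨g, hg⟩ hgx
  obtain ⟨k', j', hkj⟩ := mem_heisLattice.1 hg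
  have hgx' : x * heisElt n u s k' j' ∈ heisDomain n u := by
    rw [hkj]
    exact hgx
  obtain ⟨⟨h1, h2⟩, h3⟩ := (key k' j').1 hgx'
  have hk : k' = k := Prod.ext h1 h2
  subst hk
  refine Subtype.ext (MulOpposite.unop_injective ?_)
  rw [← hkj, h3]
  rfl

theorem haarVolume_heisDomain_ne_zero (n : ℕ+) (u : PosBasis) :
    Heis.haarVolume (heisDomain n u) ≠ 0 := by
  have hn : ((n : ℕ) : ℝ) ≠ 0 := by positivity
  have hc := u.covol_ne_zero
  let V : Set Heis := {x | u.coord x.z ∈ Ioo (0 : ℝ) 1 ×ˢ Ioo (0 : ℝ) 1 ∧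
    n * x.t / u.covol ∈ Ioo (0 : ℝ) 1}
  have hV : IsOpen V := by
    have h1 : Continuous fun x : Heis => u.coord x.z :=
      PosBasis.continuous_coord.comp (by fun_prop : Continuous fun x : Heis => (u, x.z))
    have h2 : Continuous fun x : Heis => n * x.t / u.covol := by fun_prop
    exact ((isOpen_Ioo.prod isOpen_Ioo).preimage h1).inter (isOpen_Ioo.preimage h2)
  have hne : V.Nonempty := by
    refine ⟨⟨((1 / 2 : ℝ) : ℂ) * u.1 0 + ((1 / 2 : ℝ) : ℂ) * u.1 1, u.covol / (2 * n)⟩, ?_, ?_⟩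
    · simp only [u.coord_real_comb]
      norm_num
    · have : n * (u.covol / (2 * n)) / u.covol = 1 / 2 := by field_simp
      simp only [this]
      norm_num
  have hsub : V ⊆ heisDomain n u := fun x hx =>
    ⟨prod_mono Ioo_subset_Ico_self Ioo_subset_Ico_self hx.1, Ioo_subset_Ico_self hx.2⟩
  have hpos : Heis.haarVolume V ≠ 0 := by
    rw [Heis.haarVolume, Measure.map_apply Heis.homeoProd.symm.measurable hV.measurableSet]
    exact ((hV.preimage Heis.homeoProd.symm.continuous).measure_pos volume
      (hne.preimage Heis.homeoProd.symm.surjective)).ne'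
  exact fun h => hpos (measure_mono_null hsub h)

theorem haarVolume_heisDomain_ne_top (n : ℕ+) (u : PosBasis) :
    Heis.haarVolume (heisDomain n u) ≠ ⊤ := by
  have hn : ((n : ℕ) : ℝ) ≠ 0 := by positivity
  have hc := u.covol_ne_zero
  let f : (ℝ × ℝ) × ℝ → Heis := fun p => ⟨p.1.1 * u.1 0 + p.1.2 * u.1 1, u.covol * p.2 / n⟩
  have hf : Continuous f := by fun_prop
  let K : Set Heis := f '' ((Icc 0 1 ×ˢ Icc 0 1) ×ˢ Icc 0 1)
  have hK : IsCompact K := ((isCompact_Icc.prod isCompact_Icc).prod isCompact_Icc).image hf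
  have hsub : heisDomain n u ⊆ K := by
    rintro x ⟨h1, h2⟩
    refine ⟨(u.coord x.z, n * x.t / u.covol), ⟨prod_mono Ico_subset_Icc_self Ico_subset_Icc_self h1,
      Ico_subset_Icc_self h2⟩, ?_⟩
    ext1
    · exact u.real_comb_coord x.z
    · simp only [f]
      field_simp
  have hfin : Heis.haarVolume K ≠ ⊤ := by
    rw [Heis.haarVolume, Measure.map_apply Heis.homeoProd.symm.measurable hK.measurableSet]
    exact (Heis.homeoProd.symm.isCompact_preimage.2 hK).measure_lt_top.ne
  exact ne_top_of_le_ne_top hfin (measure_mono hsub)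

/-- A discrete subgroup with a fundamental domain of finite volume for a bi-invariant measure is a
lattice. -/
theorem isLattice_of_domain {G : Type*} [Group G] [TopologicalSpace G] [IsTopologicalGroup G]
    [MeasurableSpace G] [BorelSpace G] (ν : Measure G) (hl : ∀ g, MeasurePreserving (g * ·) ν ν)
    (hr : ∀ g, MeasurePreserving (· * g) ν ν) (Λ : Subgroup G) [DiscreteTopology Λ] [Countable Λ]
    (F : Set G) (hF : MeasurableSet F) (hF0 : ν F ≠ 0) (hFt : ν F ≠ ⊤)
    (hex : ∀ x, ∃! g : Λ.op, g • x ∈ F) : IsLattice Λ := by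
  refine ⟨inferInstance, ?_⟩
  let : MeasurableSpace (G ⧸ Λ) := borel (G ⧸ Λ)
  have : BorelSpace (G ⧸ Λ) := ⟨rfl⟩
  have hmk : Measurable (QuotientGroup.mk : G → G ⧸ Λ) := QuotientGroup.continuous_mk.measurable
  have : SMulInvariantMeasure Λ.op G ν := by
    refine ⟨fun c A hA => ?_⟩
    exact (hr c.1.unop).measure_preimage hA.nullMeasurableSet
  have : SMulInvariantMeasure G G ν :=
    ⟨fun c A hA => (hl c).measure_preimage hA.nullMeasurableSet⟩
  have hdom : IsFundamentalDomain Λ.op F ν := IsFundamentalDomain.mk' hF.nullMeasurableSet hex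
  refine ⟨(ν F)⁻¹ • (ν.restrict F).map QuotientGroup.mk, ⟨?_⟩, ⟨fun g A hA => ?_⟩⟩
  · rw [Measure.smul_apply, Measure.map_apply hmk MeasurableSet.univ]
    simp [ENNReal.inv_mul_cancel hF0 hFt]
  · have hgA : MeasurableSet ((fun x : G ⧸ Λ => g • x) ⁻¹' A) :=
      (continuous_const_smul g).measurable hA
    rw [Measure.smul_apply, Measure.smul_apply, Measure.map_apply hmk hgA,
      Measure.map_apply hmk hA, Measure.restrict_apply (hmk hgA), Measure.restrict_apply (hmk hA)]
    congr 1
    -- Left translates commute with the right action, so F and gF are both fundamental domains. They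
    -- give the same measure to the preimage of A, which is invariant on the right.
    have hdom' : IsFundamentalDomain Λ.op (g • F) ν := hdom.smul_of_comm g
    rw [hdom.measure_set_eq hdom' (hmk hA)
      (fun c => by
        ext x
        have : (QuotientGroup.mk (c • x) : G ⧸ Λ) = QuotientGroup.mk x :=
          QuotientGroup.mk_mul_of_mem x c.2
        simp [this])]
    rw [← (hl g).measure_preimage ((hmk hA).inter (hF.const_smul g)).nullMeasurableSet]
    congr 1
    ext x
    simp [← smul_eq_mul]

theorem isLattice_heisLattice (n : ℕ+) (u : PosBasis) (s : Fin 2 → ℝ) :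
    IsLattice (heisLattice n u s) :=
  isLattice_of_domain Heis.haarVolume Heis.measurePreserving_mul_left
    Heis.measurePreserving_mul_right _ (heisDomain n u) (measurableSet_heisDomain n u)
    (haarVolume_heisDomain_ne_zero n u) (haarVolume_heisDomain_ne_top n u)
    (heisLattice_existsUnique n u s)

end

section

open Filter Set MeasureTheory

/-! ### Lattices in the plane -/

/-- The lattice of the plane with basis `u`. -/
def planeLattice (u : PosBasis) : Subgroup (Multiplicative ℂ) where
  carrier := range fun k : ℤ × ℤ => Multiplicative.ofAdd (u.comb k)
  mul_mem' := by
    rintro _ _ ⟨k, rfl⟩ ⟨l, rfl⟩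
    exact ⟨k + l, congrArg Multiplicative.ofAdd (u.comb_add k l)⟩
  one_mem' := ⟨0, congrArg Multiplicative.ofAdd u.comb_zero⟩
  inv_mem' := by
    rintro _ ⟨k, rfl⟩
    exact ⟨-k, congrArg Multiplicative.ofAdd (u.comb_neg k)⟩

theorem ofAdd_mem_planeLattice {u : PosBasis} {z : ℂ} :
    Multiplicative.ofAdd z ∈ planeLattice u ↔ ∃ k, z = u.comb k := by
  constructor
  · rintro ⟨k, hk⟩
    exact ⟨k, (Multiplicative.ofAdd.injective hk).symm⟩
  · rintro ⟨k, rfl⟩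
    exact ⟨k, rfl⟩

theorem map_proj_heisLattice (n : ℕ+) (u : PosBasis) (s : Fin 2 → ℝ) :
    (heisLattice n u s).map Heis.proj = planeLattice u := by
  ext x
  rw [Subgroup.mem_map]
  constructor
  · rintro ⟨y, hy, rfl⟩
    exact ofAdd_mem_planeLattice.2 (exists_comb_of_mem_heisLattice hy)
  · intro hx
    obtain ⟨k, hk⟩ := ofAdd_mem_planeLattice.1 (show Multiplicative.ofAdd x.toAdd ∈ _ from hx)
    exact ⟨heisElt n u s k 0, mem_heisLattice.2 ⟨k, 0, rfl⟩,
      congrArg Multiplicative.ofAdd hk.symm⟩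

theorem continuous_proj : Continuous Heis.proj := by
  have : Continuous fun h : Heis => Multiplicative.ofAdd h.z :=
    continuous_ofAdd.comp Heis.continuous_z
  exact this

theorem proj_surjective : Function.Surjective Heis.proj := fun x => ⟨⟨x.toAdd, 0⟩, rfl⟩

instance discreteTopology_planeLattice (u : PosBasis) : DiscreteTopology (planeLattice u) := by
  rw [discreteTopology_iff_isOpen_singleton_one]
  have hcont : Continuous fun x : planeLattice u => u.coord x.1.toAdd :=
    PosBasis.continuous_coord.comp (continuous_const.prodMk
      (continuous_toAdd.comp continuous_subtype_val))
  have hopen : IsOpen {x : planeLattice u | ‖u.coord x.1.toAdd‖ < 1} :=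
    isOpen_lt hcont.norm continuous_const
  convert hopen using 1
  ext ⟨x, hx⟩
  simp only [mem_singleton_iff, mem_ofPred_eq]
  constructor
  · intro h
    rw [Subgroup.mk_eq_one] at h
    have := u.coord_comb 0
    rw [u.comb_zero] at this
    simp [h, this]
  · intro h
    obtain ⟨k, rfl⟩ := hx
    rw [toAdd_ofAdd, u.coord_comb, Prod.norm_def, sup_lt_iff] at h
    have hk : k = 0 := Prod.ext (int_eq_zero_of_norm_lt h.1) (int_eq_zero_of_norm_lt h.2)
    refine Subtype.ext ?_
    change Multiplicative.ofAdd (u.comb k) = 1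
    rw [hk, u.comb_zero, ofAdd_zero]

/-- If the image of a lattice under a continuous homomorphism is discrete, it is a lattice. -/
theorem IsLattice.map {G H : Type*} [Group G] [TopologicalSpace G] [IsTopologicalGroup G]
    [Group H] [TopologicalSpace H] [IsTopologicalGroup H] {Λ : Subgroup G} (hΛ : IsLattice Λ)
    (f : G →* H) (hf : Continuous f) (hs : Function.Surjective f) [DiscreteTopology (Λ.map f)] :
    IsLattice (Λ.map f) := by
  obtain ⟨-, μ, hμ, hinv⟩ := hΛ
  refine ⟨inferInstance, ?_⟩
  let : MeasurableSpace (G ⧸ Λ) := borel (G ⧸ Λ)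
  have : BorelSpace (G ⧸ Λ) := ⟨rfl⟩
  let : MeasurableSpace (H ⧸ Λ.map f) := borel (H ⧸ Λ.map f)
  have : BorelSpace (H ⧸ Λ.map f) := ⟨rfl⟩
  let φ : G ⧸ Λ → H ⧸ Λ.map f := Quotient.map' f (by
    intro a b hab
    rw [QuotientGroup.leftRel_apply] at hab ⊢
    exact ⟨_, hab, by simp⟩)
  have hφ : Continuous φ := hf.quotient_map' _
  have hφs : ∀ (g : G) (x : G ⧸ Λ), φ (g • x) = f g • φ x := by
    intro g x
    induction x using QuotientGroup.induction_on with
    | H x => exact congrArg QuotientGroup.mk (map_mul f g x)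
  refine ⟨μ.map φ, Measure.isProbabilityMeasure_map hφ.measurable.aemeasurable, ⟨fun h A hA => ?_⟩⟩
  obtain ⟨g, rfl⟩ := hs h
  have hgA : MeasurableSet ((fun x : H ⧸ Λ.map f => f g • x) ⁻¹' A) :=
    (continuous_const_smul (f g)).measurable hA
  rw [Measure.map_apply hφ.measurable hgA, Measure.map_apply hφ.measurable hA,
    ← hinv.measure_preimage_smul g (hφ.measurable hA)]
  congr 1
  ext x
  simp [hφs]

/-- It is the projection of a Heisenberg lattice, so the invariant measure can be pushed forward and
no fundamental domain in the plane is needed. -/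
theorem isLattice_planeLattice (u : PosBasis) : IsLattice (planeLattice u) := by
  have h := map_proj_heisLattice 1 u 0
  have : DiscreteTopology ((heisLattice 1 u 0).map Heis.proj) := by
    rw [h]
    infer_instance
  rw [← h]
  exact (isLattice_heisLattice 1 u 0).map _ continuous_proj proj_surjective

/-- A lattice is not contained in the kernel of a nontrivial real character. -/
theorem IsLattice.exists_ne_zero {G : Type*} [Group G] [TopologicalSpace G] [IsTopologicalGroup G]
    {Λ : Subgroup G} (hΛ : IsLattice Λ) (f : G → ℝ) (hf : Continuous f)
    (hmul : ∀ a b, f (a * b) = f a + f b) {g : G} (hg : f g ≠ 0) : ∃ x ∈ Λ, f x ≠ 0 := by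
  by_contra! hker
  obtain ⟨-, μ, hμ, hinv⟩ := hΛ
  let : MeasurableSpace (G ⧸ Λ) := borel (G ⧸ Λ)
  have : BorelSpace (G ⧸ Λ) := ⟨rfl⟩
  let φ : G ⧸ Λ → ℝ := Quotient.lift f (by
    intro a b hab
    have h := hker _ (QuotientGroup.leftRel_apply.1 hab)
    have h2 : f (a * (a⁻¹ * b)) = f a := by rw [hmul, h, add_zero]
    rw [← h2, mul_inv_cancel_left])
  have hφ : Continuous φ := hf.quotient_lift _
  have hφs : ∀ (g : G) (x : G ⧸ Λ), φ (g • x) = f g + φ x := by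
    intro g x
    induction x using QuotientGroup.induction_on with
    | H x => exact hmul g x
  have hf1 : f 1 = 0 := by
    have := hmul 1 1
    rw [mul_one] at this
    linarith
  have hpow : ∀ k : ℤ, f (g ^ k) = k * f g := by
    let F : G →* Multiplicative ℝ := ⟨⟨fun x => Multiplicative.ofAdd (f x), by rw [hf1]; rfl⟩,
      fun a b => congrArg Multiplicative.ofAdd (hmul a b)⟩
    intro k
    have h := congrArg Multiplicative.toAdd (map_zpow F g k)
    rw [toAdd_zpow] at h
    simpa [F, zsmul_eq_mul] using h
  -- The character descends to the quotient, where g shifts it by f g. The slices of width f g are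
  -- countably many disjoint sets of equal measure, which cannot add up to 1.
  let S : ℤ → Set (G ⧸ Λ) := fun k => {x | ⌊φ x / f g⌋ = k}
  have hS : ∀ k, MeasurableSet (S k) := fun k =>
    (Int.measurable_floor.comp (hφ.measurable.div_const _)) (measurableSet_singleton k)
  have hSk : ∀ k, μ (S k) = μ (S 0) := by
    intro k
    rw [← hinv.measure_preimage_smul (g ^ k) (hS k)]
    congr 1
    ext x
    simp only [S, mem_preimage, mem_ofPred_eq, hφs, hpow]
    rw [add_div, mul_div_cancel_right₀ _ hg, Int.floor_intCast_add]
    simp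
  have hdisj : Pairwise (Function.onFun Disjoint S) := by
    intro i j hij
    refine Set.disjoint_left.2 fun x hx hx' => hij ?_
    exact hx.symm.trans hx'
  have huniv : ⋃ k, S k = univ := eq_univ_of_forall fun x => mem_iUnion.2 ⟨_, rfl⟩
  have hone : μ (⋃ k, S k) = 1 := by rw [huniv, measure_univ]
  rw [measure_iUnion hdisj hS] at hone
  simp only [hSk] at hone
  by_cases h0 : μ (S 0) = 0
  · simp [h0] at hone
  · rw [ENNReal.tsum_const_eq_top_of_ne_zero h0] at hone
    exact ENNReal.top_ne_one hone

/-- The subgroup of `ℂ` underlying a subgroup of `Multiplicative ℂ`. -/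
def toIntSubmodule (L : Subgroup (Multiplicative ℂ)) : Submodule ℤ ℂ :=
  AddSubgroup.toIntSubmodule (Subgroup.toAddSubgroup' L)

theorem mem_toIntSubmodule {L : Subgroup (Multiplicative ℂ)} {z : ℂ} :
    z ∈ toIntSubmodule L ↔ Multiplicative.ofAdd z ∈ L := Iff.rfl

/-- Otherwise a nonzero linear functional kills the projection, and its composition with π is a
nontrivial real character that vanishes on Λ. -/
theorem IsLattice.span_eq_top {G : Type*} [Group G] [TopologicalSpace G] [IsTopologicalGroup G]
    {Λ : Subgroup G} (hΛ : IsLattice Λ) (π : G →* Multiplicative ℂ) (hπ : Continuous π)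
    (hs : Function.Surjective π) :
    Submodule.span ℝ (toIntSubmodule (Λ.map π) : Set ℂ) = ⊤ := by
  by_contra h
  obtain ⟨f, hf, hle⟩ := Submodule.exists_le_ker_of_lt_top _ (lt_top_iff_ne_top.2 h)
  obtain ⟨z, hz⟩ : ∃ z, f z ≠ 0 := by
    by_contra! hz
    exact hf (LinearMap.ext hz)
  obtain ⟨g, hg⟩ := hs (Multiplicative.ofAdd z)
  have hfc : Continuous fun x : G => f (π x).toAdd :=
    (LinearMap.continuous_of_finiteDimensional f).comp (continuous_toAdd.comp hπ)
  obtain ⟨x, hx, hx0⟩ := hΛ.exists_ne_zero (fun x => f (π x).toAdd) hfc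
    (fun a b => by rw [map_mul, toAdd_mul, map_add]) (g := g) (by rw [hg]; exact hz)
  exact hx0 (hle (Submodule.subset_span (show (π x).toAdd ∈ _ from
    mem_toIntSubmodule.2 ⟨x, hx, rfl⟩)))

/-- An integral basis of L is a real basis of the plane, so `omega` does not vanish on it.
Exchanging the two vectors corrects the orientation if necessary. -/
theorem exists_posBasis (L : Submodule ℤ ℂ) [DiscreteTopology L]
    (hL : Submodule.span ℝ (L : Set ℂ) = ⊤) : ∃ u : PosBasis, ∀ z, z ∈ L ↔ ∃ k, z = u.comb k := by
  have : IsZLattice ℝ L := ⟨hL⟩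
  have : Module.Finite ℤ L := ZLattice.module_finite ℝ L
  have : Module.Free ℤ L := ZLattice.module_free ℝ L
  have hrank : Module.finrank ℤ L = 2 := by rw [ZLattice.rank ℝ, Complex.finrank_real_complex]
  let b := Module.finBasisOfFinrankEq ℤ L hrank
  have hmem : ∀ z, z ∈ L ↔ ∃ k l : ℤ, z = k * (b 0 : ℂ) + l * (b 1 : ℂ) := by
    intro z
    constructor
    · intro hz
      refine ⟨b.repr ⟨z, hz⟩ 0, b.repr ⟨z, hz⟩ 1, ?_⟩
      have h := congrArg Subtype.val (b.sum_repr ⟨z, hz⟩)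
      rw [Fin.sum_univ_two] at h
      simpa [zsmul_eq_mul] using h.symm
    · rintro ⟨k, l, rfl⟩
      rw [← zsmul_eq_mul, ← zsmul_eq_mul]
      exact L.add_mem (L.smul_mem _ (b 0).2) (L.smul_mem _ (b 1).2)
  have hreal : ∀ z : ℂ, ∃ x y : ℝ, z = x * (b 0 : ℂ) + y * (b 1 : ℂ) := by
    intro z
    refine ⟨(b.ofZLatticeBasis ℝ L).repr z 0, (b.ofZLatticeBasis ℝ L).repr z 1, ?_⟩
    have h := (b.ofZLatticeBasis ℝ L).sum_repr z
    rw [Fin.sum_univ_two] at h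
    simpa using h.symm
  have hne : omega (b 1) (b 0) ≠ 0 := by
    intro h0
    obtain ⟨x, y, h1⟩ := hreal 1
    obtain ⟨x', y', h2⟩ := hreal Complex.I
    have h3 : omega 1 Complex.I = (y * x' - x * y') * omega (b 1) (b 0) := by
      conv_lhs => rw [h1, h2]
      simp [omega]
      ring
    rw [h0] at h3
    simp [omega] at h3
  rcases hne.lt_or_gt with h | h
  · refine ⟨⟨![b 1, b 0], by simp [omega] at h ⊢; linarith⟩, fun z => ?_⟩
    rw [hmem]
    constructor
    · rintro ⟨k, l, rfl⟩
      exact ⟨(l, k), by simp [PosBasis.comb, add_comm]⟩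
    · rintro ⟨k, rfl⟩
      exact ⟨k.2, k.1, by simp [PosBasis.comb, add_comm]⟩
  · refine ⟨⟨![b 0, b 1], by simpa using h⟩, fun z => ?_⟩
    rw [hmem]
    constructor
    · rintro ⟨k, l, rfl⟩
      exact ⟨(k, l), by simp [PosBasis.comb]⟩
    · rintro ⟨k, rfl⟩
      exact ⟨k.1, k.2, by simp [PosBasis.comb]⟩

theorem IsLattice.exists_eq_planeLattice {L : Subgroup (Multiplicative ℂ)} (hL : IsLattice L) :
    ∃ u, L = planeLattice u := by
  have hspan := hL.span_eq_top (MonoidHom.id _) continuous_id Function.surjective_id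
  rw [Subgroup.map_id] at hspan
  have : DiscreteTopology (toIntSubmodule L) := hL.1
  obtain ⟨u, hu⟩ := exists_posBasis _ hspan
  refine ⟨u, ?_⟩
  ext x
  exact (hu x.toAdd).trans ofAdd_mem_planeLattice.symm

end

section

open Filter Set MeasureTheory

/-! ### Classification of the lattices of the Heisenberg group -/

theorem mem_zpowers_mk_zero {d : ℝ} {x : Heis} :
    x ∈ Subgroup.zpowers (⟨0, d⟩ : Heis) ↔ ∃ j : ℤ, x = ⟨0, j * d⟩ := by
  rw [Subgroup.mem_zpowers_iff]
  simp only [Heis.mk_zero_zpow, eq_comm]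

/-- The injection k ↦ (0, k d / n) of ℤ reduces this to the index of nℤ. -/
theorem relIndex_zpowers (n : ℕ+) {d : ℝ} (hd : d ≠ 0) :
    (Subgroup.zpowers (⟨0, d⟩ : Heis)).relIndex (Subgroup.zpowers ⟨0, d / n⟩) = n := by
  have hn : ((n : ℕ) : ℝ) ≠ 0 := by positivity
  let f : Multiplicative ℤ →* Heis := zpowersHom Heis ⟨0, d / n⟩
  have hf : ∀ k : ℤ, f (Multiplicative.ofAdd k) = ⟨0, k * (d / n)⟩ := fun k => by
    rw [zpowersHom_apply, Heis.mk_zero_zpow]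
    rfl
  have hinj : Function.Injective f := by
    intro a b hab
    have h : f (Multiplicative.ofAdd a.toAdd) = f (Multiplicative.ofAdd b.toAdd) := hab
    rw [hf, hf, Heis.mk.injEq] at h
    have h2 := mul_right_cancel₀ (div_ne_zero hd hn) h.2
    exact Multiplicative.toAdd.injective (by exact_mod_cast h2)
  have h1 : Subgroup.zpowers (⟨0, d⟩ : Heis) =
      (AddSubgroup.toSubgroup (AddSubgroup.zmultiples ((n : ℕ) : ℤ))).map f := by
    ext x
    rw [mem_zpowers_mk_zero, Subgroup.mem_map]
    constructor
    · rintro ⟨j, rfl⟩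
      refine ⟨Multiplicative.ofAdd (j * ((n : ℕ) : ℤ)),
        show j * ((n : ℕ) : ℤ) ∈ AddSubgroup.zmultiples ((n : ℕ) : ℤ) from
          AddSubgroup.mem_zmultiples_iff.2 ⟨j, smul_eq_mul _ _⟩, ?_⟩
      rw [hf]
      congr 1
      push_cast
      field_simp
    · rintro ⟨y, hy, rfl⟩
      obtain ⟨j, hj⟩ := AddSubgroup.mem_zmultiples_iff.1
        (show y.toAdd ∈ AddSubgroup.zmultiples ((n : ℕ) : ℤ) from hy)
      have hy' : y = Multiplicative.ofAdd (j * ((n : ℕ) : ℤ)) := by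
        rw [← smul_eq_mul, hj, ofAdd_toAdd]
      refine ⟨j, ?_⟩
      rw [hy', hf]
      congr 1
      push_cast
      field_simp
  have h2 : Subgroup.zpowers (⟨0, d / n⟩ : Heis) = (⊤ : Subgroup (Multiplicative ℤ)).map f := by
    ext x
    rw [mem_zpowers_mk_zero, Subgroup.mem_map]
    constructor
    · rintro ⟨j, rfl⟩
      exact ⟨Multiplicative.ofAdd j, trivial, hf j⟩
    · rintro ⟨y, -, rfl⟩
      exact ⟨y.toAdd, hf y.toAdd⟩
  rw [h1, h2, Subgroup.relIndex_map_map_of_injective _ _ hinj, Subgroup.relIndex_top_right,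
    AddSubgroup.index_toSubgroup, Int.index_zmultiples]
  simp

/-- Commutators see only the projections, and `omega` takes values in covol u · ℤ on integral
combinations of u. The generator itself comes from lifts of u 1 and u 0, in this order. -/
theorem commutator_eq_zpowers {Λ : Subgroup Heis} (u : PosBasis)
    (hz : ∀ x ∈ Λ, ∃ k, x.z = u.comb k) (hl : ∀ i, ∃ x ∈ Λ, x.z = u.1 i) :
    ⁅Λ, Λ⁆ = Subgroup.zpowers ⟨0, u.covol⟩ := by
  apply le_antisymm
  · rw [Subgroup.commutator_le]
    intro a ha b hb
    obtain ⟨k, hk⟩ := hz a ha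
    obtain ⟨l, hl⟩ := hz b hb
    rw [commutatorElement_def, Heis.commutator_eq, mem_zpowers_mk_zero, hk, hl, u.omega_comb]
    refine ⟨k.2 * l.1 - k.1 * l.2, ?_⟩
    congr 1
    push_cast
    ring
  · rw [Subgroup.zpowers_le]
    obtain ⟨a, ha, ha'⟩ := hl 0
    obtain ⟨b, hb, hb'⟩ := hl 1
    have h := Subgroup.commutator_mem_commutator hb ha
    rw [commutatorElement_def, Heis.commutator_eq, ha', hb'] at h
    exact h

theorem heisLattice_inf_center (n : ℕ+) (u : PosBasis) (s : Fin 2 → ℝ) :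
    heisLattice n u s ⊓ Subgroup.center Heis = Subgroup.zpowers ⟨0, u.covol / n⟩ := by
  ext x
  rw [Subgroup.mem_inf, Heis.mem_center_iff, mem_zpowers_mk_zero]
  constructor
  · rintro ⟨h, hz⟩
    have hx : x = ⟨0, x.t⟩ := Heis.ext hz rfl
    rw [hx, mk_zero_mem_heisLattice] at h
    obtain ⟨j, hj⟩ := h
    exact ⟨j, hx.trans (by rw [hj])⟩
  · rintro ⟨j, rfl⟩
    exact ⟨mk_zero_mem_heisLattice.2 ⟨j, rfl⟩, rfl⟩

theorem commutator_heisLattice (n : ℕ+) (u : PosBasis) (s : Fin 2 → ℝ) :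
    ⁅heisLattice n u s, heisLattice n u s⁆ = Subgroup.zpowers ⟨0, u.covol⟩ :=
  commutator_eq_zpowers u (fun _ hx => exists_comb_of_mem_heisLattice hx)
    fun i => ⟨_, heisGen_mem n u s i, rfl⟩

theorem relIndex_heisLattice (n : ℕ+) (u : PosBasis) (s : Fin 2 → ℝ) :
    ⁅heisLattice n u s, heisLattice n u s⁆.relIndex
      (heisLattice n u s ⊓ Subgroup.center Heis) = n := by
  rw [commutator_heisLattice, heisLattice_inf_center, relIndex_zpowers n u.covol_ne_zero]

/-- The projection of a lattice of the Heisenberg group is discrete. -/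
theorem IsLattice.discreteTopology_proj {Λ : Subgroup Heis} (hΛ : IsLattice Λ) :
    DiscreteTopology (toIntSubmodule (Λ.map Heis.proj)) := by
  have hspan := hΛ.span_eq_top Heis.proj continuous_proj proj_surjective
  have hmem : ∀ z, z ∈ toIntSubmodule (Λ.map Heis.proj) ↔ ∃ x ∈ Λ, x.z = z := fun z => Iff.rfl
  -- If Λ had no nontrivial central element, its commutators would be trivial and `omega` would
  -- vanish on the projection. The projection spans the plane, so `omega` would vanish against every
  -- vector, contradicting the existence of an element with nonzero real part.
  obtain ⟨c, hc0, hc⟩ : ∃ c : ℝ, c ≠ 0 ∧ (⟨0, c⟩ : Heis) ∈ Λ := by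
    by_contra! hcon
    have homega : ∀ a ∈ Λ, ∀ b ∈ Λ, omega a.z b.z = 0 := by
      intro a ha b hb
      by_contra h
      refine hcon _ h ?_
      rw [← Heis.commutator_eq]
      exact mul_mem (mul_mem (mul_mem ha hb) (inv_mem ha)) (inv_mem hb)
    have h1 : ∀ a ∈ Λ, ∀ w, omega a.z w = 0 := by
      intro a ha w
      have hw : w ∈ Submodule.span ℝ (toIntSubmodule (Λ.map Heis.proj) : Set ℂ) := by
        rw [hspan]
        trivial
      induction hw using Submodule.span_induction with
      | mem x hx =>
        obtain ⟨b, hb, rfl⟩ := (hmem x).1 hx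
        exact homega a ha b hb
      | zero => simp [omega]
      | add x y _ _ hx hy =>
        simp only [omega, Complex.add_re, Complex.add_im] at hx hy ⊢
        linarith
      | smul r x _ hx =>
        simp only [omega, Complex.real_smul, Complex.re_ofReal_mul, Complex.im_ofReal_mul] at hx ⊢
        linear_combination r * hx
    obtain ⟨x, hx, hx0⟩ := hΛ.exists_ne_zero (fun h => h.z.re)
      (Complex.continuous_re.comp Heis.continuous_z) (fun a b => rfl) (g := ⟨1, 0⟩) (by simp)
    have := h1 x hx Complex.I
    simp [omega] at this
    exact hx0 this
  -- Multiplication by powers of the central element brings t into [0, |c|] without changing z.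
  -- Projected points of the unit disc thus come from the finite set K ∩ Λ.
  let K : Set Heis := Heis.homeoProd ⁻¹' (Metric.closedBall 0 1 ×ˢ Icc 0 |c|)
  have hK : IsCompact K :=
    Heis.homeoProd.isCompact_preimage.2 ((isCompact_closedBall 0 1).prod isCompact_Icc)
  have := hΛ.1
  have hfin : (K ∩ Λ).Finite := hK.inter_right (Subgroup.isClosed_of_discrete (H := Λ)) |>.finite
    (DiscreteTopology.isDiscrete.mono inter_subset_right)
  have hfin2 : (Metric.closedBall 0 1 ∩ (toIntSubmodule (Λ.map Heis.proj) : Set ℂ)).Finite := by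
    refine (hfin.image Heis.z).subset ?_
    rintro z ⟨hz, hzL⟩
    obtain ⟨x, hx, rfl⟩ := (hmem z).1 hzL
    have hcp : 0 < |c| := abs_pos.2 hc0
    have hc' : (⟨0, |c|⟩ : Heis) ∈ Λ := by
      rcases abs_choice c with h | h
      · rwa [h]
      · rw [h]
        have := inv_mem hc
        have heq : (⟨0, c⟩ : Heis)⁻¹ = ⟨0, -c⟩ := Heis.ext (by simp) (by simp)
        rwa [heq] at this
    refine ⟨x * ⟨0, |c|⟩ ^ (-⌊x.t / |c|⌋), ⟨⟨?_, ?_⟩, mul_mem hx (zpow_mem hc' _)⟩, ?_⟩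
    · change (x * _ : Heis).z ∈ _
      rw [Heis.mk_zero_zpow]
      simpa using hz
    · change (x * _ : Heis).t ∈ _
      rw [Heis.mk_zero_zpow]
      have h1 := Int.floor_le (x.t / |c|)
      have h2 := (Int.lt_floor_add_one (x.t / |c|)).le
      rw [le_div_iff₀ hcp] at h1
      rw [div_le_iff₀ hcp] at h2
      simp only [Heis.mul_t, mul_zero, Complex.zero_im, zero_div, add_zero, mem_Icc]
      push_cast
      constructor <;> linarith
    · rw [Heis.mk_zero_zpow]
      simp
  have hopen : IsOpen (Metric.ball (0 : ℂ) 1 ∩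
      ((Metric.closedBall 0 1 ∩ (toIntSubmodule (Λ.map Heis.proj) : Set ℂ)) \ {0})ᶜ) :=
    Metric.isOpen_ball.inter (hfin2.subset sdiff_subset).isClosed.isOpen_compl
  have : DiscreteTopology (toIntSubmodule (Λ.map Heis.proj)).toAddSubgroup := by
    rw [discreteTopology_iff_isOpen_singleton_zero]
    convert hopen.preimage (continuous_subtype_val :
      Continuous fun x : (toIntSubmodule (Λ.map Heis.proj)).toAddSubgroup => (x : ℂ)) using 1
    ext ⟨x, hx⟩
    have hx' : x ∈ toIntSubmodule (Λ.map Heis.proj) := hx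
    simp only [mem_singleton_iff, mem_preimage, mem_inter_iff, mem_compl_iff, Set.mem_sdiff, not_and,
      not_not, AddSubgroup.mk_eq_zero, SetLike.mem_coe, and_imp]
    constructor
    · rintro rfl
      simp
    · rintro ⟨h1, h2⟩
      exact h2 (Metric.ball_subset_closedBall h1) hx'
  exact this

/-- Every lattice for which the commutator subgroup has index `n` in the intersection with the
centre is one of the standard ones. -/
theorem exists_eq_heisLattice {n : ℕ+} {Λ : Subgroup Heis} (hΛ : IsLattice Λ)
    (hn : ⁅Λ, Λ⁆.relIndex (Λ ⊓ Subgroup.center Heis) = n) : ∃ u s, Λ = heisLattice n u s := by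
  have hspan := hΛ.span_eq_top Heis.proj continuous_proj proj_surjective
  have := hΛ.discreteTopology_proj
  obtain ⟨u, hu⟩ := exists_posBasis _ hspan
  have hmem : ∀ z, (∃ x ∈ Λ, x.z = z) ↔ ∃ k, z = u.comb k := hu
  have hz : ∀ x ∈ Λ, ∃ k, x.z = u.comb k := fun x hx => (hmem _).1 ⟨x, hx, rfl⟩
  have hl : ∀ i, ∃ x ∈ Λ, x.z = u.1 i := by
    intro i
    rw [hmem]
    fin_cases i
    · exact ⟨(1, 0), by simp [PosBasis.comb]⟩
    · exact ⟨(0, 1), by simp [PosBasis.comb]⟩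
  have hnR : ((n : ℕ) : ℝ) ≠ 0 := by positivity
  have hcom := commutator_eq_zpowers u hz hl
  rw [hcom] at hn
  have hle1 : Subgroup.zpowers (⟨0, u.covol⟩ : Heis) ≤ Λ ⊓ Subgroup.center Heis := by
    rw [← hcom, le_inf_iff]
    refine ⟨Subgroup.commutator_le_self Λ, ?_⟩
    rw [hcom, Subgroup.zpowers_le, Heis.mem_center_iff]
  -- A central element of Λ has its n-th power in the subgroup of index n. In coordinates, n t is an
  -- integral multiple of covol u.
  have hle2 : Λ ⊓ Subgroup.center Heis ≤ Subgroup.zpowers ⟨0, u.covol / n⟩ := by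
    intro x hx
    have hxz : x.z = 0 := Heis.mem_center_iff.1 hx.2
    have hxeq : x = ⟨0, x.t⟩ := Heis.ext hxz rfl
    have hpow : x ^ (n : ℕ) ∈ Subgroup.zpowers (⟨0, u.covol⟩ : Heis) := by
      have hnormal : (Subgroup.zpowers (⟨0, u.covol⟩ : Heis)).Normal := by
        refine ⟨fun y hy g => ?_⟩
        obtain ⟨j, rfl⟩ := mem_zpowers_mk_zero.1 hy
        have hcy := Subgroup.mem_center_iff.1 (Heis.mem_center_iff.2
          (rfl : (⟨0, j * u.covol⟩ : Heis).z = 0)) g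
        rwa [hcy, mul_inv_cancel_right]
      have h := Subgroup.pow_index_mem
        ((Subgroup.zpowers (⟨0, u.covol⟩ : Heis)).subgroupOf (Λ ⊓ Subgroup.center Heis)) ⟨x, hx⟩
      rw [← Subgroup.relIndex, hn] at h
      exact Subgroup.mem_subgroupOf.1 h
    obtain ⟨j, hj⟩ := mem_zpowers_mk_zero.1 hpow
    rw [hxeq, ← zpow_natCast, Heis.mk_zero_zpow, Heis.mk.injEq] at hj
    refine mem_zpowers_mk_zero.2 ⟨j, ?_⟩
    rw [hxeq]
    congr 1
    have := hj.2
    push_cast at this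
    field_simp
    linarith
  have hcen : Λ ⊓ Subgroup.center Heis = Subgroup.zpowers ⟨0, u.covol / n⟩ := by
    refine le_antisymm hle2 ?_
    -- Both inclusions are between [Λ, Λ] and groups in which it has index n, so the remaining index
    -- is 1.
    have h := Subgroup.relIndex_mul_relIndex _ _ _ hle1 hle2
    rw [hn, relIndex_zpowers n u.covol_ne_zero] at h
    exact Subgroup.relIndex_eq_one.1 (Nat.eq_of_mul_eq_mul_left n.pos (by rw [h, mul_one]))
  -- Any lifts of the basis vectors will do. The parameters are their central coordinates, solved
  -- from the formula for `heisGen`.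
  choose a ha haz using hl
  refine ⟨u, fun i => n * ((a i).t / u.covol - 1 / 2), eq_heisLattice ?_ hz ?_⟩
  · intro t
    have : (⟨0, t⟩ : Heis) ∈ Λ ↔ (⟨0, t⟩ : Heis) ∈ Λ ⊓ Subgroup.center Heis := by
      rw [Subgroup.mem_inf, Heis.mem_center_iff]
      simp
    rw [this, hcen, mem_zpowers_mk_zero]
    simp
  · intro i
    have hc := u.covol_ne_zero
    have : heisGen n u (fun i => n * ((a i).t / u.covol - 1 / 2)) i = a i := by
      ext1
      · exact (haz i).symm
      · simp only [heisGen]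
        field_simp
        ring
    rw [this]
    exact ha i

end

section

open Filter Set
open scoped MatrixGroups

/-! ### Consequences of closeness in the Chabauty topology -/

section ChabautyApproximation

variable {G : Type*} [Group G] [TopologicalSpace G] [IsTopologicalGroup G] [LocallyCompactSpace G]

/-- Elements of a closed subgroup are approximated by elements of nearby subgroups. -/
theorem eventually_exists_mem_prod (C : ClosedSubgroup G) {a b : G} (ha : a ∈ C) (hb : b ∈ C)
    {W : Set (G × G)} (hW : W ∈ 𝓝 (a, b)) : ∀ᶠ D in 𝓝 C, ∃ d ∈ D, ∃ e ∈ D, (d, e) ∈ W := by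
  have hcont : ContinuousAt (fun v : G × G => (a * v.1⁻¹, b * v.2⁻¹)) (1, 1) := by fun_prop
  have hpre : (fun v : G × G => (a * v.1⁻¹, b * v.2⁻¹)) ⁻¹' W ∈ 𝓝 ((1 : G), (1 : G)) :=
    hcont.preimage_mem_nhds (by simpa using hW)
  rw [nhds_prod_eq, mem_prod_same_iff] at hpre
  obtain ⟨V, hV, hVW⟩ := hpre
  have h1 : (1 : G) ∈ interior V := mem_interior_iff_mem_nhds.2 hV
  filter_upwards [chabautyNhd_mem_nhds (K := {a, b}) (Set.toFinite _).isCompact isOpen_interior h1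
    C] with D hD
  obtain ⟨d, hd, v, hv, hdv⟩ := hD.2 ⟨ha, by simp⟩
  obtain ⟨e, he, w, hw, hew⟩ := hD.2 ⟨hb, by simp⟩
  have hdv : d * v = a := hdv
  have hew : e * w = b := hew
  refine ⟨d, hd, e, he, ?_⟩
  have := hVW (mk_mem_prod (interior_subset hv) (interior_subset hw))
  simpa [← hdv, ← hew] using this

/-- Subgroups near a closed subgroup avoid a given compact set that it does not meet. -/
theorem eventually_disjoint (C : ClosedSubgroup G) {K : Set G} (hK : IsCompact K)
    (hCK : ∀ x ∈ K, x ∉ C) : ∀ᶠ D in 𝓝 C, ∀ x ∈ K, x ∉ D := by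
  obtain ⟨V, hV, hVC⟩ := compact_open_separated_mul_right hK C.isClosed'.isOpen_compl hCK
  have h1 : (1 : G) ∈ interior V⁻¹ := mem_interior_iff_mem_nhds.2 (inv_mem_nhds_one G hV)
  filter_upwards [chabautyNhd_mem_nhds hK isOpen_interior h1 C] with D hD x hxK hxD
  obtain ⟨c, hc, v, hv, hcv⟩ := hD.1 ⟨hxD, hxK⟩
  have hcv : c * v = x := hcv
  refine hVC (mul_mem_mul hxK (Set.mem_inv.1 (interior_subset hv))) ?_
  rw [← hcv, mul_inv_cancel_right]
  exact hc

end ChabautyApproximation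

/-! ### The parametrisations of the spaces of lattices -/

/-- The point of the space of lattices given by parameters. -/
def heisMk (n : ℕ+) (p : PosBasis × (Fin 2 → ℝ)) : LatticeSpaceN n :=
  ⟨⟨heisLattice n p.1 p.2, Subgroup.isClosed_of_discrete⟩, isLattice_heisLattice n p.1 p.2,
    relIndex_heisLattice n p.1 p.2⟩

/-- The plane lattice with a given basis. -/
def planeMk (u : PosBasis) : LatticeSpace (Multiplicative ℂ) :=
  ⟨⟨planeLattice u, Subgroup.isClosed_of_discrete⟩, isLattice_planeLattice u⟩

theorem heisMk_eq_iff {n : ℕ+} {p q : PosBasis × (Fin 2 → ℝ)} :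
    heisMk n p = heisMk n q ↔ heisLattice n p.1 p.2 = heisLattice n q.1 q.2 := by
  constructor
  · intro h
    exact congrArg (fun Λ : LatticeSpaceN n => Λ.1.toSubgroup) h
  · intro h
    exact Subtype.ext (ClosedSubgroup.toSubgroup_injective h)

theorem planeMk_eq_iff {u v : PosBasis} :
    planeMk u = planeMk v ↔ planeLattice u = planeLattice v := by
  constructor
  · intro h
    exact congrArg (fun Λ : LatticeSpace (Multiplicative ℂ) => Λ.1.toSubgroup) h
  · intro h
    exact Subtype.ext (ClosedSubgroup.toSubgroup_injective h)

theorem heisMk_surjective (n : ℕ+) : Function.Surjective (heisMk n) := by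
  rintro ⟨Λ, h1, h2⟩
  obtain ⟨u, s, h⟩ := exists_eq_heisLattice h1 h2
  exact ⟨(u, s), Subtype.ext (ClosedSubgroup.toSubgroup_injective h.symm)⟩

theorem planeMk_surjective : Function.Surjective planeMk := by
  rintro ⟨Λ, h1⟩
  obtain ⟨u, h⟩ := h1.exists_eq_planeLattice
  exact ⟨u, Subtype.ext (ClosedSubgroup.toSubgroup_injective h.symm)⟩

theorem finite_norm_intCast_lt (R : ℝ) : {k : ℤ | ‖(k : ℝ)‖ < R}.Finite := by
  refine (Set.finite_Icc (-⌈R⌉) ⌈R⌉).subset fun k hk => ?_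
  have hk' : |(k : ℝ)| < R := hk
  rw [abs_lt] at hk'
  have hR := Int.le_ceil R
  constructor
  · have : (-⌈R⌉ : ℝ) < k := by linarith
    exact_mod_cast this.le
  · have : (k : ℝ) < ⌈R⌉ := by linarith
    exact_mod_cast this.le

/-- The function `heisCoord` is jointly continuous and returns the integral index of each lattice
element, so elements staying in a compact set have bounded index. -/
theorem continuous_heisMk (n : ℕ+) : Continuous (heisMk n) := by
  refine Continuous.subtype_mk ?_ _
  refine continuous_closedSubgroup_of_range _
    (fun (p : PosBasis × (Fin 2 → ℝ)) (i : (ℤ × ℤ) × ℤ) => heisElt n p.1 p.2 i.1 i.2)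
    (fun p => rfl) ?_ ?_
  · intro i
    unfold heisElt PosBasis.comb
    fun_prop
  · refine exists_finite_eventually_of_coord _ (heisCoord n) (continuous_heisCoord n)
      (fun i : (ℤ × ℤ) × ℤ => ((((i.1.1 : ℤ) : ℝ), ((i.1.2 : ℤ) : ℝ)), ((i.2 : ℤ) : ℝ))) ?_
      (fun p i => heisCoord_heisElt n p i.1 i.2)
    intro R
    refine (((finite_norm_intCast_lt R).prod (finite_norm_intCast_lt R)).prod
      (finite_norm_intCast_lt R)).subset ?_
    rintro ⟨⟨k, l⟩, j⟩ h
    rw [mem_ofPred_eq, Prod.norm_def, Prod.norm_def, sup_lt_iff, sup_lt_iff] at h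
    exact h

theorem continuous_planeMk : Continuous planeMk := by
  refine Continuous.subtype_mk ?_ _
  refine continuous_closedSubgroup_of_range _
    (fun (u : PosBasis) (i : ℤ × ℤ) => Multiplicative.ofAdd (u.comb i))
    (fun p => rfl) ?_ ?_
  · intro i
    refine continuous_ofAdd.comp ?_
    unfold PosBasis.comb
    fun_prop
  · refine exists_finite_eventually_of_coord _
      (fun p : PosBasis × Multiplicative ℂ => p.1.coord p.2.toAdd)
      (PosBasis.continuous_coord.comp (continuous_fst.prodMk (continuous_toAdd.comp continuous_snd)))
      (fun i : ℤ × ℤ => (((i.1 : ℤ) : ℝ), ((i.2 : ℤ) : ℝ))) ?_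
      (fun u i => u.coord_comb i)
    intro R
    refine ((finite_norm_intCast_lt R).prod (finite_norm_intCast_lt R)).subset ?_
    rintro ⟨k, l⟩ h
    rw [mem_ofPred_eq, Prod.norm_def, sup_lt_iff] at h
    exact h

/-! ### Change of basis -/

namespace PosBasis

theorem omega_matrix (u : PosBasis) (M : Matrix (Fin 2) (Fin 2) ℤ) :
    omega (M 1 0 * u.1 0 + M 1 1 * u.1 1) (M 0 0 * u.1 0 + M 0 1 * u.1 1) =
      M.det * u.covol := by
  rw [Matrix.det_fin_two]
  simp [omega, covol]
  ring

instance : MulAction SL(2, ℤ) PosBasis where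
  smul γ u := ⟨fun i => γ i 0 * u.1 0 + γ i 1 * u.1 1, by
    rw [u.omega_matrix γ.1, γ.2]
    simpa using u.covol_pos⟩
  one_smul u := by
    refine Subtype.ext (funext fun i => ?_)
    change ((1 : SL(2, ℤ)) i 0 : ℂ) * u.1 0 + ((1 : SL(2, ℤ)) i 1 : ℂ) * u.1 1 = u.1 i
    fin_cases i <;> simp
  mul_smul γ δ u := by
    refine Subtype.ext (funext fun i => ?_)
    change ((γ * δ : SL(2, ℤ)) i 0 : ℂ) * u.1 0 + ((γ * δ : SL(2, ℤ)) i 1 : ℂ) * u.1 1 =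
      γ i 0 * (δ 0 0 * u.1 0 + δ 0 1 * u.1 1) + γ i 1 * (δ 1 0 * u.1 0 + δ 1 1 * u.1 1)
    rw [Matrix.SpecialLinearGroup.coe_mul, Matrix.mul_apply, Matrix.mul_apply, Fin.sum_univ_two,
      Fin.sum_univ_two]
    push_cast
    ring

theorem smul_apply (γ : SL(2, ℤ)) (u : PosBasis) (i : Fin 2) :
    (γ • u).1 i = γ i 0 * u.1 0 + γ i 1 * u.1 1 := rfl

@[simp] theorem covol_smul (γ : SL(2, ℤ)) (u : PosBasis) : (γ • u).covol = u.covol := by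
  have h := u.omega_matrix γ.1
  rw [γ.2, Int.cast_one, one_mul] at h
  exact h

theorem exists_comb_smul (γ : SL(2, ℤ)) (u : PosBasis) (k : ℤ × ℤ) :
    ∃ l, (γ • u).comb k = u.comb l := by
  refine ⟨(k.1 * γ 0 0 + k.2 * γ 1 0, k.1 * γ 0 1 + k.2 * γ 1 1), ?_⟩
  simp only [comb, smul_apply]
  push_cast
  ring

end PosBasis

theorem planeLattice_smul (γ : SL(2, ℤ)) (u : PosBasis) :
    planeLattice (γ • u) = planeLattice u := by
  have h : ∀ (γ : SL(2, ℤ)) (u : PosBasis), planeLattice (γ • u) ≤ planeLattice u := by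
    rintro γ u _ ⟨k, rfl⟩
    exact ofAdd_mem_planeLattice.2 (PosBasis.exists_comb_smul γ u k)
  refine le_antisymm (h γ u) ?_
  conv_lhs => rw [← inv_smul_smul γ u]
  exact h _ _

/-- The coordinates of v with respect to u form an integral matrix whose determinant is the ratio of
the covolumes: a positive integer less than 2, hence 1. The slack up to 2 is what later turns
approximate information into equality. -/
theorem exists_smul_eq_of_forall_mem {u v : PosBasis}
    (h : ∀ i, Multiplicative.ofAdd (v.1 i) ∈ planeLattice u) (hc : v.covol < 2 * u.covol) :
    ∃ γ : SL(2, ℤ), v = γ • u := by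
  choose k hk using fun i => ofAdd_mem_planeLattice.1 (h i)
  let M : Matrix (Fin 2) (Fin 2) ℤ := fun i => ![(k i).1, (k i).2]
  have hv : ∀ i, v.1 i = M i 0 * u.1 0 + M i 1 * u.1 1 := hk
  have hcov : v.covol = M.det * u.covol := by
    rw [← u.omega_matrix, ← hv, ← hv]
    rfl
  have hu := u.covol_pos
  have h1 : M.det = 1 := by
    have h2 := v.covol_pos
    rw [hcov] at h2 hc
    have h3 : (0 : ℝ) < M.det := pos_of_mul_pos_left h2 hu.le
    have h4 : (M.det : ℝ) < 2 := lt_of_mul_lt_mul_right hc hu.le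
    have h5 : 0 < M.det := by exact_mod_cast h3
    have h6 : M.det < 2 := by exact_mod_cast h4
    omega
  exact ⟨⟨M, h1⟩, Subtype.ext (funext hv)⟩

theorem ofAdd_apply_mem_planeLattice (u : PosBasis) (i : Fin 2) :
    Multiplicative.ofAdd (u.1 i) ∈ planeLattice u := by
  rw [ofAdd_mem_planeLattice]
  fin_cases i
  · exact ⟨(1, 0), by simp [PosBasis.comb]⟩
  · exact ⟨(0, 1), by simp [PosBasis.comb]⟩

theorem planeLattice_eq_iff {u v : PosBasis} :
    planeLattice v = planeLattice u ↔ ∃ γ : SL(2, ℤ), v = γ • u := by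
  constructor
  · intro h
    have hu := u.covol_pos
    have hv := v.covol_pos
    -- The basis with the smaller covolume satisfies the bound automatically.
    rcases le_total v.covol u.covol with hle | hle
    · exact exists_smul_eq_of_forall_mem (fun i => h ▸ ofAdd_apply_mem_planeLattice v i)
        (by linarith)
    · obtain ⟨γ, hγ⟩ := exists_smul_eq_of_forall_mem
        (fun i => h ▸ ofAdd_apply_mem_planeLattice u i) (u := v) (v := u) (by linarith)
      exact ⟨γ⁻¹, by rw [hγ, inv_smul_smul]⟩
  · rintro ⟨γ, rfl⟩
    exact planeLattice_smul γ u

/-- The Arf-invariant-one quadratic form takes the value one on primitive vectors. -/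
theorem exists_add_add_mul_eq {a b c d : ℤ} (h : Odd (a * d - b * c)) :
    ∃ m, a + b + a * b = 2 * m + 1 := by
  have : ¬ (Even a ∧ Even b) := by
    rintro ⟨ha, hb⟩
    exact (Int.not_even_iff_odd.2 h) ((ha.mul_right d).sub (hb.mul_right c))
  have heven : Even ((a + 1) * (b + 1)) := by
    by_cases ha : Even a
    · have hb := Int.not_even_iff_odd.1 fun hb => this ⟨ha, hb⟩
      exact hb.add_one.mul_left _
    · exact (Int.not_even_iff_odd.1 ha).add_one.mul_right _
  have heq : a + b + a * b = (a + 1) * (b + 1) - 1 := by ring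
  rw [heq]
  exact heven.sub_odd odd_one

/-- The affine action on the parameters over a basis. -/
def affAct (γ : SL(2, ℤ)) (w : Fin 2 → ℤ) (s : Fin 2 → ℝ) (i : Fin 2) : ℝ :=
  γ i 0 * s 0 + γ i 1 * s 1 + w i

theorem exists_row (γ : SL(2, ℤ)) (i : Fin 2) :
    ∃ m, γ i 0 + γ i 1 + γ i 0 * γ i 1 = 2 * m + 1 := by
  have hdet := γ.2
  rw [Matrix.det_fin_two] at hdet
  fin_cases i
  · exact exists_add_add_mul_eq (c := γ 1 0) (d := γ 1 1) ⟨0, by simpa using hdet⟩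
  · exact exists_add_add_mul_eq (a := γ 1 0) (b := γ 1 1) (c := -γ 0 0) (d := -γ 0 1)
      ⟨0, by linarith⟩

/-- Both sides have the same projection and the same central part, so only the new generators need
to be located. The quadratic form is odd on the rows of γ, so its half is 1/2 modulo ℤ, and the
discrepancy is an integral number of central steps. -/
theorem heisLattice_smul (n : ℕ+) (γ : SL(2, ℤ)) (w : Fin 2 → ℤ) (u : PosBasis) (s : Fin 2 → ℝ) :
    heisLattice n (γ • u) (affAct γ w s) = heisLattice n u s := by
  have hn : ((n : ℕ) : ℝ) ≠ 0 := by positivity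
  symm
  refine eq_heisLattice (fun t => ?_) (fun x hx => ?_) (fun i => ?_)
  · rw [mk_zero_mem_heisLattice, PosBasis.covol_smul]
  · obtain ⟨k, hk⟩ := exists_comb_of_mem_heisLattice hx
    have h1 : Multiplicative.ofAdd x.z ∈ planeLattice (γ • u) := by
      rw [planeLattice_smul]
      exact ofAdd_mem_planeLattice.2 ⟨k, hk⟩
    exact ofAdd_mem_planeLattice.1 h1
  · obtain ⟨m, hm⟩ := exists_row γ i
    rw [mem_heisLattice]
    -- The integer m is the excess of half the form over 1/2, and it is worth n m multiples of covol
    -- u / n.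
    refine ⟨(γ i 0, γ i 1), w i - n * m, ?_⟩
    have hm' : (γ i 0 + γ i 1 + γ i 0 * γ i 1 : ℝ) = 2 * m + 1 := by exact_mod_cast hm
    ext1
    · rfl
    · simp only [heisElt, heisGen, PosBasis.covol_smul, hm', affAct]
      push_cast
      field_simp
      ring

/-- The projections determine γ, and comparing the central coordinates of the lifts then gives w.
The right-hand side does not mention n, which is the source of the isomorphisms between the bundles.
-/
theorem heisLattice_eq_iff {n : ℕ+} {u v : PosBasis} {s r : Fin 2 → ℝ} :
    heisLattice n v r = heisLattice n u s ↔
      ∃ (γ : SL(2, ℤ)) (w : Fin 2 → ℤ), v = γ • u ∧ r = affAct γ w s := by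
  constructor
  · intro h
    have hn : ((n : ℕ) : ℝ) ≠ 0 := by positivity
    have hproj : planeLattice v = planeLattice u := by
      rw [← map_proj_heisLattice n v r, h, map_proj_heisLattice]
    obtain ⟨γ, rfl⟩ := planeLattice_eq_iff.1 hproj
    have hex : ∀ i, ∃ w : ℤ, r i = γ i 0 * s 0 + γ i 1 * s 1 + w := by
      intro i
      have hmem : heisGen n (γ • u) r i ∈ heisLattice n u s := h ▸ heisGen_mem n (γ • u) r i
      obtain ⟨k, j, hkj⟩ := mem_heisLattice.1 hmem
      rw [Heis.ext_iff] at hkj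
      obtain ⟨h1, h2⟩ := hkj
      have hk : k = (γ i 0, γ i 1) := u.comb_injective h1
      subst hk
      obtain ⟨m, hm⟩ := exists_row γ i
      have hm' : (γ i 0 + γ i 1 + γ i 0 * γ i 1 : ℝ) = 2 * m + 1 := by exact_mod_cast hm
      refine ⟨j + n * m, ?_⟩
      simp only [heisElt, heisGen, PosBasis.covol_smul, hm'] at h2
      have h3 := mul_left_cancel₀ u.covol_ne_zero h2
      push_cast
      field_simp at h3
      linarith
    choose w hw using hex
    exact ⟨γ, w, rfl, funext hw⟩
  · rintro ⟨γ, w, rfl, rfl⟩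
    exact heisLattice_smul n γ w u s

end

section

open Filter Set
open scoped MatrixGroups

/-! ### Openness of the parametrisations -/

/-- The pairs of vectors that form a positively oriented basis. -/
def posPairs : Set (ℂ × ℂ) := {d | 0 < omega d.2 d.1}

theorem isOpen_posPairs : IsOpen posPairs := isOpen_lt continuous_const (by fun_prop)

/-- A pair of vectors as a basis. -/
def pairBasis (d : posPairs) : PosBasis := ⟨![d.1.1, d.1.2], d.2⟩

theorem continuous_pairBasis : Continuous pairBasis := by
  refine Continuous.subtype_mk (continuous_pi fun i => ?_) _
  fin_cases i
  · exact continuous_fst.comp continuous_subtype_val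
  · exact continuous_snd.comp continuous_subtype_val

theorem pairBasis_eta (u : PosBasis) : pairBasis ⟨(u.1 0, u.1 1), u.2⟩ = u := by
  refine Subtype.ext (funext fun i => ?_)
  fin_cases i <;> rfl

/-- Approximating vectors live in ℂ × ℂ, not in the subtype of bases. Positivity is an open
condition, so neighbourhoods of a basis transfer. -/
theorem eventually_pairBasis {u : PosBasis} {N : Set PosBasis} (hN : N ∈ 𝓝 u) :
    ∀ᶠ d in 𝓝 (u.1 0, u.1 1), ∃ h : d ∈ posPairs, pairBasis ⟨d, h⟩ ∈ N := by
  have h1 : pairBasis ⁻¹' N ∈ 𝓝 (⟨(u.1 0, u.1 1), u.2⟩ : posPairs) :=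
    continuous_pairBasis.continuousAt.preimage_mem_nhds (by rwa [pairBasis_eta])
  have h2 := image_mem_map (m := Subtype.val) h1
  rw [isOpen_posPairs.isOpenEmbedding_subtypeVal.map_nhds_eq] at h2
  filter_upwards [h2]
  rintro _ ⟨⟨d, hd⟩, hdN, rfl⟩
  exact ⟨hd, hdN⟩

/-- A subgroup of the plane that contains `ℤ²`, but no vector whose norm is in `[1/4, 1/2]`,
is `ℤ²`. -/
theorem exists_int_of_mem (S : AddSubgroup (ℝ × ℝ)) (hZ : ∀ k l : ℤ, ((k : ℝ), (l : ℝ)) ∈ S)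
    (hS : ∀ y ∈ S, ¬ (1 / 4 ≤ ‖y‖ ∧ ‖y‖ ≤ 1 / 2)) {y : ℝ × ℝ} (hy : y ∈ S) :
    ∃ k l : ℤ, y = ((k : ℝ), (l : ℝ)) := by
  -- A nonzero vector of S of norm at most 1/2 could be doubled until its norm fell in the forbidden
  -- range, so the norm is at most every power of 1/2. Rounding reduces a general vector to this
  -- case.
  have hsmall : ∀ (m : ℕ) (y : ℝ × ℝ), y ∈ S → ‖y‖ ≤ 1 / 2 → ‖y‖ ≤ (1 / 2) ^ m := by
    intro m
    induction m with
    | zero =>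
      intro y _ hy2
      norm_num
      linarith
    | succ m ih =>
      intro y hy hy2
      have h1 : ‖y‖ < 1 / 4 := by
        by_contra! h
        exact hS y hy ⟨h, hy2⟩
      have h2 : ‖y + y‖ = 2 * ‖y‖ := by
        rw [← two_smul ℝ y, norm_smul]
        simp
      have h3 := ih (y + y) (S.add_mem hy hy) (by rw [h2]; linarith)
      rw [h2] at h3
      rw [pow_succ]
      linarith
  have hr : y - ((round y.1 : ℝ), (round y.2 : ℝ)) ∈ S := S.sub_mem hy (hZ _ _)
  have hr2 : ‖y - ((round y.1 : ℝ), (round y.2 : ℝ))‖ ≤ 1 / 2 := by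
    rw [Prod.norm_def, sup_le_iff]
    exact ⟨abs_sub_round y.1, abs_sub_round y.2⟩
  have h0 : ‖y - ((round y.1 : ℝ), (round y.2 : ℝ))‖ ≤ 0 :=
    ge_of_tendsto (tendsto_pow_atTop_nhds_zero_of_lt_one (by norm_num : (0 : ℝ) ≤ 1 / 2)
      (by norm_num)) (Eventually.of_forall fun m => hsmall m _ hr hr2)
  exact ⟨round y.1, round y.2, sub_eq_zero.1 (norm_le_zero_iff.1 h0)⟩

/-- A nearby lattice D contains vectors close to u, hence the lattice of a basis b close to u.
Equality holds because D also avoids the annulus 1/4 ≤ ‖y‖ ≤ 1/2 in the coordinates of b, so that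
`exists_int_of_mem` applies. -/
theorem isOpenMap_planeMk : IsOpenMap planeMk := by
  refine IsOpenMap.of_nhds_le fun u S hS => ?_
  have hN : planeMk ⁻¹' S ∈ 𝓝 u := hS
  let g : (ℂ × ℂ) × (ℝ × ℝ) → ℂ := fun p => p.2.1 * p.1.1 + p.2.2 * p.1.2
  have hg : Continuous g := by fun_prop
  let A : Set (ℝ × ℝ) := {y | 1 / 4 ≤ ‖y‖ ∧ ‖y‖ ≤ 1 / 2}
  have hA : IsCompact A := by
    have h1 : A = Metric.closedBall 0 (1 / 2) ∩ {y | 1 / 4 ≤ ‖y‖} := by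
      ext y
      simp [A, and_comm]
    rw [h1]
    exact (isCompact_closedBall _ _).inter_right (isClosed_le continuous_const continuous_norm)
  have hAu : {(u.1 0, u.1 1)} ×ˢ A ⊆ g ⁻¹' {z | Multiplicative.ofAdd z ∉ planeLattice u} := by
    rintro ⟨d, y⟩ ⟨rfl, hy⟩ hmem
    obtain ⟨k, hk⟩ := ofAdd_mem_planeLattice.1 hmem
    have h1 := congrArg u.coord hk
    rw [u.coord_real_comb, u.coord_comb] at h1
    have hy1 : ((k.1 : ℝ), (k.2 : ℝ)) ∈ A := h1 ▸ hy
    have hk0 : k = 0 := by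
      have h2 : ‖((k.1 : ℝ), (k.2 : ℝ))‖ < 1 := hy1.2.trans_lt (by norm_num)
      rw [Prod.norm_def, sup_lt_iff] at h2
      exact Prod.ext (int_eq_zero_of_norm_lt h2.1) (int_eq_zero_of_norm_lt h2.2)
    have h3 := hy1.1
    rw [hk0] at h3
    norm_num at h3
  have hopen : IsOpen (g ⁻¹' {z | Multiplicative.ofAdd z ∉ planeLattice u}) :=
    (((Subgroup.isClosed_of_discrete (H := planeLattice u)).preimage
      continuous_ofAdd).isOpen_compl).preimage hg
  -- The basis b depends on D, so the annuli of all bases near u must be avoided at once. The tube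
  -- lemma and a compact neighbourhood B' put them into one compact set disjoint from the lattice of
  -- u.
  obtain ⟨B, B₂, hB, -, huB, hAB, hBB⟩ :=
    generalized_tube_lemma isCompact_singleton hA hopen hAu
  obtain ⟨B', hB'u, hB'B, hB'c⟩ := local_compact_nhds (hB.mem_nhds (huB rfl))
  have hK : IsCompact (Multiplicative.ofAdd ∘ g '' (B' ×ˢ A)) :=
    (hB'c.prod hA).image (continuous_ofAdd.comp hg)
  have hdis := eventually_disjoint (planeMk u).1 hK (by
    rintro _ ⟨⟨d, y⟩, ⟨hd, hy⟩, rfl⟩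
    exact hBB (mk_mem_prod (hB'B hd) (hAB hy)))
  have hcont : Continuous fun p : Multiplicative ℂ × Multiplicative ℂ => (p.1.toAdd, p.2.toAdd) :=
    (continuous_toAdd.comp continuous_fst).prodMk (continuous_toAdd.comp continuous_snd)
  have happ := eventually_exists_mem_prod (planeMk u).1 (ofAdd_apply_mem_planeLattice u 0)
    (ofAdd_apply_mem_planeLattice u 1) (W := (fun p => (p.1.toAdd, p.2.toAdd)) ⁻¹'
      (B' ∩ {d | ∃ h : d ∈ posPairs, pairBasis ⟨d, h⟩ ∈ planeMk ⁻¹' S}))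
    (hcont.continuousAt.preimage_mem_nhds
      (inter_mem hB'u (eventually_pairBasis hN)))
  filter_upwards [continuous_subtype_val.continuousAt.eventually hdis,
    continuous_subtype_val.continuousAt.eventually happ] with D hD1 hD2
  obtain ⟨d, hd, e, he, hB', hde, hdeS⟩ := hD2
  let b := pairBasis ⟨_, hde⟩
  have hmemD : ∀ k l : ℤ, Multiplicative.ofAdd (k * d.toAdd + l * e.toAdd) ∈ D.1 := by
    intro k l
    have h1 := D.1.toSubgroup.mul_mem (D.1.toSubgroup.zpow_mem hd k)
      (D.1.toSubgroup.zpow_mem he l)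
    have h2 : d ^ k * e ^ l = Multiplicative.ofAdd (k * d.toAdd + l * e.toAdd) := by
      rw [← zsmul_eq_mul, ← zsmul_eq_mul, ofAdd_add, ofAdd_zsmul, ofAdd_zsmul, ofAdd_toAdd,
        ofAdd_toAdd]
    exact h2 ▸ h1
  let F : ℝ × ℝ →+ ℂ :=
    { toFun := fun y => y.1 * d.toAdd + y.2 * e.toAdd
      map_zero' := by simp
      map_add' := fun x y => by
        simp
        ring }
  let S' : AddSubgroup (ℝ × ℝ) := (Subgroup.toAddSubgroup' D.1.toSubgroup).comap F
  suffices hle : D.1.toSubgroup = planeLattice b by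
    have hD : D = planeMk b := Subtype.ext (ClosedSubgroup.toSubgroup_injective hle)
    rw [hD]
    exact hdeS
  refine le_antisymm (fun x hx => ?_) ?_
  · have hxS : b.coord x.toAdd ∈ S' := by
      have h1 : F (b.coord x.toAdd) = x.toAdd := b.real_comb_coord _
      change F (b.coord x.toAdd) ∈ Subgroup.toAddSubgroup' D.1.toSubgroup
      rw [h1]
      exact hx
    obtain ⟨k, l, hkl⟩ := exists_int_of_mem S' (fun k l => by
        have hF : F ((k : ℝ), (l : ℝ)) = k * d.toAdd + l * e.toAdd := by simp [F]
        change F ((k : ℝ), (l : ℝ)) ∈ Subgroup.toAddSubgroup' D.1.toSubgroup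
        rw [hF]
        exact hmemD k l) (fun y hy hyA => hD1 _ ⟨((d.toAdd, e.toAdd), y),
          ⟨hB', hyA⟩, rfl⟩ hy) hxS
    have h2 := b.real_comb_coord x.toAdd
    rw [hkl] at h2
    exact ofAdd_mem_planeLattice.2 ⟨(k, l), h2.symm.trans (by simp [PosBasis.comb])⟩
  · rintro _ ⟨k, rfl⟩
    exact hmemD k.1 k.2

/-- The parameters are continuous functions of the two generators: the basis is their projection,
and s i is n (t / covol - 1/2). -/
theorem eventually_pairBasis_heis {n : ℕ+} {p : PosBasis × (Fin 2 → ℝ)}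
    {N : Set (PosBasis × (Fin 2 → ℝ))} (hN : N ∈ 𝓝 p) :
    ∀ᶠ d in 𝓝 (heisGen n p.1 p.2 0, heisGen n p.1 p.2 1), ∃ h : (d.1.z, d.2.z) ∈ posPairs,
      (pairBasis ⟨_, h⟩, ![n * (d.1.t / (pairBasis ⟨_, h⟩).covol - 1 / 2),
        n * (d.2.t / (pairBasis ⟨_, h⟩).covol - 1 / 2)]) ∈ N := by
  have hn : ((n : ℕ) : ℝ) ≠ 0 := by positivity
  let V : Set (Heis × Heis) := {d | (d.1.z, d.2.z) ∈ posPairs}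
  have hV : IsOpen V := isOpen_posPairs.preimage (by fun_prop)
  let f : V → PosBasis := fun d => pairBasis ⟨_, d.2⟩
  have hf : Continuous f := continuous_pairBasis.comp
    (Continuous.subtype_mk (by fun_prop) _)
  let F : V → PosBasis × (Fin 2 → ℝ) := fun d => (f d,
    ![n * (d.1.1.t / (f d).covol - 1 / 2), n * (d.1.2.t / (f d).covol - 1 / 2)])
  have hc : ∀ d, (f d).covol ≠ 0 := fun d => (f d).covol_ne_zero
  have hF : Continuous F := by
    refine hf.prodMk (continuous_pi fun i => ?_)
    have h0 : Continuous fun d : V => d.1.1.t := by fun_prop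
    have h1 : Continuous fun d : V => d.1.2.t := by fun_prop
    have h2 : Continuous fun d : V => (f d).covol := PosBasis.continuous_covol.comp hf
    fin_cases i
    · exact continuous_const.mul ((h0.div h2 hc).sub continuous_const)
    · exact continuous_const.mul ((h1.div h2 hc).sub continuous_const)
  let v₀ : V := ⟨(heisGen n p.1 p.2 0, heisGen n p.1 p.2 1), p.1.2⟩
  have hfv : f v₀ = p.1 := pairBasis_eta p.1
  have hFv : F v₀ = p := by
    have hcp := p.1.covol_ne_zero
    refine Prod.ext hfv (funext fun i => ?_)
    fin_cases i
    · change n * ((heisGen n p.1 p.2 0).t / (f v₀).covol - 1 / 2) = p.2 0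
      rw [hfv]
      simp only [heisGen]
      field_simp
      ring
    · change n * ((heisGen n p.1 p.2 1).t / (f v₀).covol - 1 / 2) = p.2 1
      rw [hfv]
      simp only [heisGen]
      field_simp
      ring
  have h1 : F ⁻¹' N ∈ 𝓝 v₀ := hF.continuousAt.preimage_mem_nhds (by rwa [hFv])
  have h2 := image_mem_map (m := Subtype.val) h1
  rw [hV.isOpenEmbedding_subtypeVal.map_nhds_eq] at h2
  filter_upwards [h2]
  rintro _ ⟨⟨d, hd⟩, hdN, rfl⟩
  exact ⟨hd, hdN⟩

/-- The covolume bound makes the projections of d and e a basis of the projected lattice, and the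
parameters are chosen so that d and e are exactly the standard generators. -/
theorem eq_heisLattice_pairBasis {n : ℕ+} {u : PosBasis} {s : Fin 2 → ℝ} {d e : Heis}
    (hd : d ∈ heisLattice n u s) (he : e ∈ heisLattice n u s) (h : (d.z, e.z) ∈ posPairs)
    (hlt : omega e.z d.z < 2 * u.covol) :
    heisLattice n u s = heisLattice n (pairBasis ⟨_, h⟩)
      ![n * (d.t / (pairBasis ⟨_, h⟩).covol - 1 / 2),
        n * (e.t / (pairBasis ⟨_, h⟩).covol - 1 / 2)] := by
  have hn : ((n : ℕ) : ℝ) ≠ 0 := by positivity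
  have hmem : ∀ i, Multiplicative.ofAdd ((pairBasis ⟨_, h⟩).1 i) ∈ planeLattice u := by
    intro i
    rw [ofAdd_mem_planeLattice]
    fin_cases i
    · exact exists_comb_of_mem_heisLattice hd
    · exact exists_comb_of_mem_heisLattice he
  obtain ⟨γ, hγ⟩ := exists_smul_eq_of_forall_mem hmem hlt
  have hc := (pairBasis ⟨_, h⟩).covol_ne_zero
  refine eq_heisLattice (fun t => ?_) (fun x hx => ?_) (fun i => ?_)
  · rw [mk_zero_mem_heisLattice, hγ, PosBasis.covol_smul]
  · have h1 := ofAdd_mem_planeLattice.2 (exists_comb_of_mem_heisLattice hx)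
    rw [← planeLattice_smul γ, ← hγ] at h1
    exact ofAdd_mem_planeLattice.1 h1
  · fin_cases i
    · convert hd
      ext1
      · rfl
      · simp only [heisGen, Fin.zero_eta, Matrix.cons_val_zero]
        field_simp
        ring
    · convert he
      ext1
      · rfl
      · simp only [heisGen, Fin.mk_one, Matrix.cons_val_one, Matrix.cons_val_fin_one]
        field_simp
        ring

/-- A nearby lattice contains elements close to the generators; the danger is that they project to a
proper sublattice. In the space for fixed n the covolume is n times the central spacing, so it
suffices to bound that spacing from below by avoiding a compact central interval. -/
theorem isOpenMap_heisMk (n : ℕ+) : IsOpenMap (heisMk n) := by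
  refine IsOpenMap.of_nhds_le fun p S hS => ?_
  have hn : (0 : ℝ) < (n : ℕ) := by positivity
  have hN : heisMk n ⁻¹' S ∈ 𝓝 p := hS
  have hc := p.1.covol_pos
  let c := p.1.covol
  -- The interval from one third to two thirds of c / n contains no multiple of c / n, but it
  -- contains a multiple of every positive spacing up to its right end. Avoiding it forces covol u >
  -- 2c/3, and the area of the approximating pair is below 4c/3 < 2 covol u.
  let K : Set Heis := (fun t : ℝ => ⟨0, t⟩) '' Icc (c / (3 * n)) (2 * c / (3 * n))
  have hK : IsCompact K := isCompact_Icc.image (by fun_prop)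
  have hdis := eventually_disjoint (heisMk n p).1 hK (by
    rintro _ ⟨t, ht, rfl⟩ hmem
    obtain ⟨j, rfl⟩ := mk_zero_mem_heisLattice.1 hmem
    obtain ⟨h1, h2⟩ := ht
    rw [div_le_iff₀ (by positivity)] at h1
    rw [le_div_iff₀ (by positivity)] at h2
    have h3 : j * (p.1.covol / n) * (3 * n) = 3 * j * p.1.covol := by field_simp
    rw [h3] at h1 h2
    have h4 : (1 : ℝ) ≤ 3 * j := le_of_mul_le_mul_right (by linarith) hc
    have h5 : (3 * j : ℝ) ≤ 2 := le_of_mul_le_mul_right (by linarith) hc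
    have h6 : 1 ≤ 3 * j := by exact_mod_cast h4
    have h7 : 3 * j ≤ 2 := by exact_mod_cast h5
    omega)
  have hlt : ∀ᶠ d in 𝓝 (heisGen n p.1 p.2 0, heisGen n p.1 p.2 1),
      omega d.2.z d.1.z < 4 / 3 * c := by
    have hcont : Continuous fun d : Heis × Heis => omega d.2.z d.1.z := by fun_prop
    refine hcont.continuousAt.eventually_lt_const ?_
    change c < 4 / 3 * c
    linarith
  have happ := eventually_exists_mem_prod (heisMk n p).1 (heisGen_mem n p.1 p.2 0)
    (heisGen_mem n p.1 p.2 1) (hlt.and (eventually_pairBasis_heis hN))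
  filter_upwards [continuous_subtype_val.continuousAt.eventually hdis,
    continuous_subtype_val.continuousAt.eventually happ] with D hD1 hD2
  obtain ⟨d, hd, e, he, hde, hpos, hdeS⟩ := hD2
  obtain ⟨⟨u, s⟩, rfl⟩ := heisMk_surjective n D
  have hu := u.covol_pos
  have hcov : 2 / 3 * c < u.covol := by
    by_contra! hle
    -- The first multiple of covol u that is at least c/3. It does not exceed 2c/3: a spacing of at
    -- most c/3 cannot jump over the interval, and for a larger one j is at most 1.
    let j : ℤ := ⌈c / 3 / u.covol⌉
    have hj1 : c / 3 ≤ j * u.covol := (div_le_iff₀ hu).1 (Int.le_ceil _)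
    have hj2 : j * u.covol ≤ 2 * c / 3 := by
      by_cases hsmall : u.covol ≤ c / 3
      · have h1 : (j : ℝ) < c / 3 / u.covol + 1 := Int.ceil_lt_add_one _
        have h2 := mul_lt_mul_of_pos_right h1 hu
        rw [add_mul, div_mul_cancel₀ _ hu.ne'] at h2
        linarith
      · push Not at hsmall
        have h1 : j ≤ 1 := Int.ceil_le.2 (by
          rw [div_le_iff₀ hu]
          push_cast
          linarith)
        have h2 : (j : ℝ) ≤ 1 := by exact_mod_cast h1
        have h3 := mul_le_mul_of_nonneg_right h2 hu.le
        linarith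
    refine hD1 _ ⟨j * (u.covol / n), ⟨?_, ?_⟩, rfl⟩ (mk_zero_mem_heisLattice.2 ⟨j, rfl⟩)
    · rw [div_le_iff₀ (by positivity)]
      have h3 : j * (u.covol / n) * (3 * n) = 3 * (j * u.covol) := by field_simp
      linarith
    · rw [le_div_iff₀ (by positivity)]
      have h3 : j * (u.covol / n) * (3 * n) = 3 * (j * u.covol) := by field_simp
      linarith
  have hlt2 : omega e.z d.z < 2 * u.covol := by linarith
  have hfin := (heisMk_eq_iff (p := (u, s)) (q := (_, _))).2
    (eq_heisLattice_pairBasis hd he hpos hlt2)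
  rw [hfin]
  exact hdeS

end

section

open Filter Set
open scoped MatrixGroups

/-! ### Local injectivity of the parametrisations -/

/-- The coordinates of γ • u with respect to u are the rows of γ. For bases close to each other
these integers differ from those of the identity by less than 1. -/
theorem exists_injOn_planeMk (u₀ : PosBasis) :
    ∃ O, IsOpen O ∧ u₀ ∈ O ∧ ∀ u ∈ O, ∀ γ : SL(2, ℤ), γ • u ∈ O → γ = 1 := by
  let W : Set (PosBasis × PosBasis) :=
    {p | ‖p.1.coord (p.2.1 0) - (1, 0)‖ < 1 ∧ ‖p.1.coord (p.2.1 1) - (0, 1)‖ < 1}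
  have hc : ∀ i, Continuous fun p : PosBasis × PosBasis => p.1.coord (p.2.1 i) := fun i =>
    PosBasis.continuous_coord.comp (continuous_fst.prodMk (PosBasis.continuous_val_apply continuous_snd i))
  have hW : IsOpen W :=
    (isOpen_lt ((hc 0).sub continuous_const).norm continuous_const).inter
      (isOpen_lt ((hc 1).sub continuous_const).norm continuous_const)
  have h0 : (u₀, u₀) ∈ W := by
    have h1 := u₀.coord_real_comb 1 0
    have h2 := u₀.coord_real_comb 0 1
    simp only [Complex.ofReal_one, one_mul, Complex.ofReal_zero, zero_mul, add_zero,
      zero_add] at h1 h2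
    constructor
    · simp [h1]
    · simp [h2]
  obtain ⟨A, hA, B, hB, hAB⟩ := mem_nhds_prod_iff.1 (hW.mem_nhds h0)
  refine ⟨interior (A ∩ B), isOpen_interior, mem_interior_iff_mem_nhds.2 (inter_mem hA hB),
    fun u hu γ hγ => ?_⟩
  obtain ⟨h1, h2⟩ := hAB (mk_mem_prod (interior_subset hu).1 (interior_subset hγ).2)
  have hsm : ∀ i, u.coord ((γ • u).1 i) = ((γ i 0 : ℝ), (γ i 1 : ℝ)) := fun i => by
    have h := u.coord_real_comb (γ i 0 : ℝ) (γ i 1 : ℝ)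
    rw [PosBasis.smul_apply]
    exact_mod_cast h
  simp only [hsm] at h1 h2
  rw [Prod.norm_def, sup_lt_iff] at h1 h2
  simp only [Prod.fst_sub, Prod.snd_sub, sub_zero] at h1 h2
  have e00 : γ 0 0 - 1 = 0 := int_eq_zero_of_norm_lt (by exact_mod_cast h1.1)
  have e01 : γ 0 1 = 0 := int_eq_zero_of_norm_lt h1.2
  have e10 : γ 1 0 = 0 := int_eq_zero_of_norm_lt h2.1
  have e11 : γ 1 1 - 1 = 0 := int_eq_zero_of_norm_lt (by exact_mod_cast h2.2)
  ext i j
  fin_cases i <;> fin_cases j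
  · simpa using sub_eq_zero.1 e00
  · simpa using e01
  · simpa using e10
  · simpa using sub_eq_zero.1 e11

theorem affAct_one (w : Fin 2 → ℤ) (s : Fin 2 → ℝ) : affAct 1 w s = fun i => s i + w i := by
  funext i
  fin_cases i <;> simp [affAct]

theorem exists_injOn_heisMk (n : ℕ+) (p₀ : PosBasis × (Fin 2 → ℝ)) :
    ∃ O, IsOpen O ∧ p₀ ∈ O ∧ InjOn (heisMk n) O := by
  obtain ⟨O, hO, hu, hinj⟩ := exists_injOn_planeMk p₀.1
  -- Two points of a ball of radius 1/2 are at distance less than 1, so they cannot differ by a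
  -- nonzero integral vector.
  refine ⟨O ×ˢ Metric.ball p₀.2 (1 / 2), hO.prod Metric.isOpen_ball,
    ⟨hu, Metric.mem_ball_self (by norm_num)⟩, ?_⟩
  rintro ⟨v, r⟩ ⟨hv, hr⟩ ⟨u, s⟩ ⟨hu, hs⟩ h
  obtain ⟨γ, w, rfl, rfl⟩ := heisLattice_eq_iff.1 (heisMk_eq_iff.1 h)
  obtain rfl := hinj u hu γ hv
  rw [one_smul]
  refine Prod.ext rfl ?_
  have hd : dist (affAct 1 w s) s < 1 := by
    have := dist_triangle_right (affAct 1 w s) s p₀.2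
    simp only [Metric.mem_ball] at hr hs
    linarith
  change affAct 1 w s = s
  rw [affAct_one] at hd ⊢
  funext i
  have hi := (dist_pi_lt_iff one_pos).1 hd i
  rw [dist_eq_norm, add_sub_cancel_left] at hi
  rw [int_eq_zero_of_norm_lt hi]
  simp

/-! ### The bundle over the space of plane lattices -/

theorem isOpenQuotientMap_heisMk (n : ℕ+) : IsOpenQuotientMap (heisMk n) :=
  ⟨heisMk_surjective n, continuous_heisMk n, isOpenMap_heisMk n⟩

theorem isOpenQuotientMap_planeMk : IsOpenQuotientMap planeMk :=
  ⟨planeMk_surjective, continuous_planeMk, isOpenMap_planeMk⟩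

/-- A map is a fibre bundle if it is parametrised, compatibly with a local homeomorphism onto
the base. -/
theorem isFibreBundle_of_parametrisation {B Y E X F : Type*} [TopologicalSpace B]
    [TopologicalSpace Y] [TopologicalSpace E] [TopologicalSpace X] [TopologicalSpace F] [Nonempty Y]
    {p : E → X} {q : B × Y → E} {r : B → X} {t : Y → F} (hq : IsOpenQuotientMap q)
    (hr : IsOpenQuotientMap r) (ht : IsOpenQuotientMap t)
    (hloc : ∀ b, ∃ O, IsOpen O ∧ b ∈ O ∧ InjOn r O) (hpq : ∀ b y, p (q (b, y)) = r b)
    (hqt : ∀ b y y', q (b, y) = q (b, y') ↔ t y = t y')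
    (hfib : ∀ b e, p e = r b → ∃ y, q (b, y) = e) : IsFibreBundle F p := by
  intro x
  obtain ⟨b₀, rfl⟩ := hr.surjective x
  obtain ⟨O, hO, hb₀, hinj⟩ := hloc b₀
  have : Nonempty B := ⟨b₀⟩
  have hU : IsOpen (r '' O) := hr.isOpenMap _ hO
  let A : Set (B × Y) := O ×ˢ univ
  have hA : IsOpen A := hO.prod isOpen_univ
  -- The trivialisation and its inverse pass through arbitrary preimages in A. Two choices have the
  -- same base coordinate, since r is injective on O, and fibre coordinates that q and t identify
  -- simultaneously.
  let g : E → X × F := fun e => Prod.map r t (Function.invFunOn q A e)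
  let g' : X × F → E := fun z => q (Function.invFunOn (Prod.map r t) A z)
  have hrt : IsOpenQuotientMap (Prod.map r t) := hr.prodMap ht
  have hfst : ∀ a a' : B × Y, a ∈ A → a' ∈ A → r a.1 = r a'.1 → a = (a'.1, a.2) :=
    fun a a' ha ha' h => Prod.ext (hinj ha.1 ha'.1 h) rfl
  have hg : ∀ a ∈ A, g (q a) = Prod.map r t a := by
    intro a ha
    have h1 : q (Function.invFunOn q A (q a)) = q a := Function.invFunOn_eq ⟨a, ha, rfl⟩
    have h2 : Function.invFunOn q A (q a) ∈ A := Function.invFunOn_mem ⟨a, ha, rfl⟩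
    have h3 : r (Function.invFunOn q A (q a)).1 = r a.1 := by
      rw [← hpq _ (Function.invFunOn q A (q a)).2, ← hpq _ a.2]
      exact congrArg p h1
    refine Prod.ext h3 ?_
    have h4 := hfst _ _ h2 ha h3
    rw [h4] at h1
    exact (hqt _ _ _).1 h1
  have hg' : ∀ a ∈ A, g' (Prod.map r t a) = q a := by
    intro a ha
    have h1 : Prod.map r t (Function.invFunOn (Prod.map r t) A (Prod.map r t a)) =
      Prod.map r t a := Function.invFunOn_eq ⟨a, ha, rfl⟩
    have h2 : Function.invFunOn (Prod.map r t) A (Prod.map r t a) ∈ A :=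
      Function.invFunOn_mem ⟨a, ha, rfl⟩
    have h4 := hfst _ _ h2 ha (congrArg Prod.fst h1)
    have h5 : t (Function.invFunOn (Prod.map r t) A (Prod.map r t a)).2 = t a.2 :=
      congrArg Prod.snd h1
    change q _ = q a
    rw [h4]
    exact (hqt _ _ _).2 h5
  have hsource : ∀ e, p e ∈ r '' O → ∃ a ∈ A, q a = e := by
    rintro e ⟨b, hb, hbe⟩
    obtain ⟨y, hy⟩ := hfib b e hbe.symm
    exact ⟨(b, y), ⟨hb, trivial⟩, hy⟩
  have htarget : ∀ z : X × F, z ∈ (r '' O) ×ˢ (univ : Set F) → ∃ a ∈ A, Prod.map r t a = z := by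
    rintro ⟨x, f⟩ ⟨⟨b, hb, rfl⟩, -⟩
    obtain ⟨y, rfl⟩ := ht.surjective f
    exact ⟨(b, y), ⟨hb, trivial⟩, rfl⟩
  have hmem : ∀ a ∈ A, p (q a) ∈ r '' O := fun a ha => ⟨a.1, ha.1, (hpq a.1 a.2).symm⟩
  have hcontg : ∀ a ∈ A, ContinuousAt g (q a) := by
    intro a ha
    rw [← hq.continuousAt_comp_iff]
    refine hrt.continuous.continuousAt.congr ?_
    filter_upwards [hA.mem_nhds ha] with a' ha' using (hg a' ha').symm
  have hcontg' : ∀ a ∈ A, ContinuousAt g' (Prod.map r t a) := by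
    intro a ha
    rw [← hrt.continuousAt_comp_iff]
    refine hq.continuous.continuousAt.congr ?_
    filter_upwards [hA.mem_nhds ha] with a' ha' using (hg' a' ha').symm
  have himage : p ⁻¹' (r '' O) = q '' A := by
    ext e
    constructor
    · exact fun he => hsource e he
    · rintro ⟨a, ha, rfl⟩
      exact hmem a ha
  refine ⟨{ toFun := g, invFun := g', source := p ⁻¹' (r '' O), target := (r '' O) ×ˢ univ,
            map_source' := ?_, map_target' := ?_, left_inv' := ?_, right_inv' := ?_,
            open_source := himage ▸ hq.isOpenMap _ hA,
            open_target := hU.prod isOpen_univ, continuousOn_toFun := ?_,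
            continuousOn_invFun := ?_, baseSet := r '' O, open_baseSet := hU, source_eq := rfl,
            target_eq := rfl, proj_toFun := ?_ }, b₀, hb₀, rfl⟩
  · intro e he
    obtain ⟨a, ha, rfl⟩ := hsource e he
    rw [hg a ha]
    exact ⟨⟨a.1, ha.1, rfl⟩, trivial⟩
  · intro z hz
    obtain ⟨a, ha, rfl⟩ := htarget z hz
    rw [hg' a ha]
    exact hmem a ha
  · intro e he
    obtain ⟨a, ha, rfl⟩ := hsource e he
    rw [hg a ha, hg' a ha]
  · intro z hz
    obtain ⟨a, ha, rfl⟩ := htarget z hz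
    rw [hg' a ha, hg a ha]
  · intro e he
    obtain ⟨a, ha, rfl⟩ := hsource e he
    exact (hcontg a ha).continuousWithinAt
  · intro z hz
    obtain ⟨a, ha, rfl⟩ := htarget z hz
    exact (hcontg' a ha).continuousWithinAt
  · intro e he
    obtain ⟨a, ha, rfl⟩ := hsource e he
    change (g (q a)).1 = p (q a)
    rw [hg a ha]
    exact (hpq a.1 a.2).symm

/-- The map from the plane to the torus. -/
def torusMk (s : Fin 2 → ℝ) : Circle × Circle :=
  (Circle.exp (2 * Real.pi * s 0), Circle.exp (2 * Real.pi * s 1))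

theorem isOpenQuotientMap_circleExp :
    IsOpenQuotientMap fun x : ℝ => Circle.exp (2 * Real.pi * x) := by
  have h : IsOpenQuotientMap Circle.exp :=
    ⟨Circle.isAddQuotientCoveringMap_exp.surjective, Circle.isCoveringMap_exp.continuous,
      Circle.isCoveringMap_exp.isLocalHomeomorph.isOpenMap⟩
  have hpi : (2 * Real.pi : ℝ) ≠ 0 := by positivity
  exact h.comp (Homeomorph.mulLeft₀ (2 * Real.pi) hpi).isOpenQuotientMap

theorem isOpenQuotientMap_torusMk : IsOpenQuotientMap torusMk :=
  (isOpenQuotientMap_circleExp.prodMap isOpenQuotientMap_circleExp).comp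
    (Homeomorph.finTwoArrow (X := ℝ)).isOpenQuotientMap

theorem circleExp_eq_iff {x y : ℝ} :
    Circle.exp (2 * Real.pi * x) = Circle.exp (2 * Real.pi * y) ↔ ∃ k : ℤ, x = y + k := by
  have hpi : (2 * Real.pi : ℝ) ≠ 0 := by positivity
  rw [Circle.exp_eq_exp]
  refine exists_congr fun k => ⟨fun h => ?_, fun h => ?_⟩
  · have h1 : 2 * Real.pi * x = 2 * Real.pi * (y + k) := by
      rw [h]
      ring
    exact mul_left_cancel₀ hpi h1
  · rw [h]
    ring

theorem torusMk_eq_iff {s r : Fin 2 → ℝ} :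
    torusMk s = torusMk r ↔ ∃ w : Fin 2 → ℤ, s = fun i => r i + w i := by
  rw [torusMk, torusMk, Prod.mk.injEq, circleExp_eq_iff, circleExp_eq_iff]
  constructor
  · rintro ⟨⟨k, hk⟩, l, hl⟩
    refine ⟨![k, l], funext fun i => ?_⟩
    fin_cases i
    · exact hk
    · exact hl
  · rintro ⟨w, rfl⟩
    exact ⟨⟨w 0, rfl⟩, w 1, rfl⟩

/-- The image of a lattice in the plane. -/
def latticeProj (n : ℕ+) (Λ : LatticeSpaceN n) : LatticeSpace (Multiplicative ℂ) :=
  planeMk (heisMk_surjective n Λ).choose.1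

theorem latticeProj_toSubgroup (n : ℕ+) (Λ : LatticeSpaceN n) :
    (latticeProj n Λ).1.toSubgroup = Λ.1.toSubgroup.map Heis.proj := by
  conv_rhs => rw [← (heisMk_surjective n Λ).choose_spec]
  exact (map_proj_heisLattice n _ _).symm

theorem latticeProj_heisMk (n : ℕ+) (u : PosBasis) (s : Fin 2 → ℝ) :
    latticeProj n (heisMk n (u, s)) = planeMk u := by
  refine Subtype.ext (ClosedSubgroup.toSubgroup_injective ?_)
  rw [latticeProj_toSubgroup]
  exact map_proj_heisLattice n u s

/-- A matrix fixing a basis is the identity, so only the integral translations w remain. -/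
theorem heisMk_same_basis {n : ℕ+} {u : PosBasis} {s r : Fin 2 → ℝ} :
    heisMk n (u, s) = heisMk n (u, r) ↔ torusMk s = torusMk r := by
  rw [heisMk_eq_iff, heisLattice_eq_iff, torusMk_eq_iff]
  constructor
  · rintro ⟨γ, w, h1, h2⟩
    obtain ⟨O, -, hu, hO⟩ := exists_injOn_planeMk u
    obtain rfl := hO u hu γ (h1 ▸ hu)
    exact ⟨w, h2.trans (affAct_one w r)⟩
  · rintro ⟨w, h⟩
    exact ⟨1, w, (one_smul _ _).symm, h.trans (affAct_one w r).symm⟩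

theorem isFibreBundle_latticeProj (n : ℕ+) : IsFibreBundle (Circle × Circle) (latticeProj n) := by
  refine isFibreBundle_of_parametrisation (isOpenQuotientMap_heisMk n) isOpenQuotientMap_planeMk
    isOpenQuotientMap_torusMk (fun u₀ => ?_) (latticeProj_heisMk n)
    (fun u s r => heisMk_same_basis) (fun u Λ h => ?_)
  · obtain ⟨O, hO, hu, hinj⟩ := exists_injOn_planeMk u₀
    refine ⟨O, hO, hu, fun v hv u hu h => ?_⟩
    obtain ⟨γ, rfl⟩ := planeLattice_eq_iff.1 (planeMk_eq_iff.1 h)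
    rw [hinj u hu γ hv, one_smul]
  · obtain ⟨⟨v, r⟩, rfl⟩ := heisMk_surjective n Λ
    rw [latticeProj_heisMk] at h
    obtain ⟨γ, rfl⟩ := planeLattice_eq_iff.1 (planeMk_eq_iff.1 h.symm)
    exact ⟨_, heisMk_eq_iff.2 (heisLattice_smul n γ 0 v r)⟩

/-- The parametrisations for n and n' are quotient maps with the same fibres, so the identity on
parameters descends in both directions. -/
theorem exists_homeomorph_latticeProj (n n' : ℕ+) :
    ∃ e : LatticeSpaceN n ≃ₜ LatticeSpaceN n', ∀ Λ, latticeProj n' (e Λ) = latticeProj n Λ := by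
  have hfac : ∀ (m m' : ℕ+) (p q), heisMk m p = heisMk m q → heisMk m' p = heisMk m' q := by
    intro m m' p q h
    rw [heisMk_eq_iff, heisLattice_eq_iff] at h ⊢
    exact h
  let f : ∀ m m' : ℕ+, LatticeSpaceN m → LatticeSpaceN m' :=
    fun m m' Λ => heisMk m' (heisMk_surjective m Λ).choose
  have hf : ∀ m m' p, f m m' (heisMk m p) = heisMk m' p := fun m m' p =>
    hfac m m' _ _ (heisMk_surjective m (heisMk m p)).choose_spec
  have hcont : ∀ m m', Continuous (f m m') := fun m m' => by
    rw [← (isOpenQuotientMap_heisMk m).continuous_comp_iff]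
    have : f m m' ∘ heisMk m = heisMk m' := funext (hf m m')
    rw [this]
    exact continuous_heisMk m'
  have hinv : ∀ m m' Λ, f m' m (f m m' Λ) = Λ := by
    intro m m' Λ
    obtain ⟨p, rfl⟩ := heisMk_surjective m Λ
    exact (congrArg (f m' m) (hf m m' p)).trans (hf m' m p)
  refine ⟨⟨⟨f n n', f n' n, hinv n n', hinv n' n⟩, hcont n n', hcont n' n⟩, fun Λ => ?_⟩
  obtain ⟨⟨u, s⟩, rfl⟩ := heisMk_surjective n Λ
  change latticeProj n' (f n n' (heisMk n (u, s))) = _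
  rw [hf, latticeProj_heisMk, latticeProj_heisMk]

end

section

open Filter Set

/-! ### The universal covering group acting on a covering space by lifting paths -/

section CoverAction

variable {G B E : Type*} [Group G] [TopologicalSpace G] [IsTopologicalGroup G]
  [TopologicalSpace B] [MulAction G B] [ContinuousSMul G B] [TopologicalSpace E] {π : E → B}
  (hπ : IsCoveringMap π)

/-- The motions of all points of `E` along a path in `G`. -/
def coverTrack (α : basedPaths G) : C(I × E, E) :=
  hπ.liftHomotopy ⟨fun x => α.1 x.1 • π x.2, by
    have := hπ.continuous
    fun_prop⟩ (ContinuousMap.id E) (fun a => by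
      have h : α.1 0 = 1 := α.2
      simp [h])

theorem coverTrack_zero (α : basedPaths G) (e : E) : coverTrack hπ α (0, e) = e :=
  hπ.liftHomotopy_zero _ _ _ e

theorem proj_coverTrack (α : basedPaths G) (t : I) (e : E) :
    π (coverTrack hπ α (t, e)) = α.1 t • π e :=
  congr_fun (hπ.liftHomotopy_lifts _ _ _) (t, e)

/-- Uniqueness of path lifting. It turns the group laws of `basedPaths` into laws for the motions of
E. -/
theorem eq_coverTrack {α : basedPaths G} {e : E} {Γ : I → E} (hΓ : Continuous Γ)
    (h : ∀ t, π (Γ t) = α.1 t • π e) (h0 : Γ 0 = e) (t : I) : Γ t = coverTrack hπ α (t, e) := by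
  refine congr_fun (hπ.eq_of_comp_eq (g₂ := fun t => coverTrack hπ α (t, e)) hΓ (by fun_prop) ?_ 0
    ?_) t
  · funext t
    exact (h t).trans (proj_coverTrack hπ α t e).symm
  · exact h0.trans (coverTrack_zero hπ α e).symm

theorem coverTrack_mul (α β : basedPaths G) (t : I) (e : E) :
    coverTrack hπ (α * β) (t, e) = coverTrack hπ α (t, coverTrack hπ β (t, e)) := by
  refine (eq_coverTrack hπ (Γ := fun t => coverTrack hπ α (t, coverTrack hπ β (t, e)))
    (by fun_prop) (fun t => ?_) ?_ t).symm
  · rw [proj_coverTrack hπ, proj_coverTrack hπ, smul_smul]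
    rfl
  · rw [coverTrack_zero, coverTrack_zero]

theorem coverTrack_one (t : I) (e : E) : coverTrack hπ (1 : basedPaths G) (t, e) = e :=
  (eq_coverTrack hπ (Γ := fun _ => e) continuous_const (fun _ => (one_smul G _).symm) rfl t).symm

/-- The action of based paths on a covering space. -/
def coverPerm : basedPaths G →* Equiv.Perm E where
  toFun α :=
    { toFun := fun e => coverTrack hπ α (1, e)
      invFun := fun e => coverTrack hπ α⁻¹ (1, e)
      left_inv := fun e =>
        (coverTrack_mul hπ α⁻¹ α 1 e).symm.trans (by rw [inv_mul_cancel, coverTrack_one])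
      right_inv := fun e =>
        (coverTrack_mul hπ α α⁻¹ 1 e).symm.trans (by rw [mul_inv_cancel, coverTrack_one]) }
  map_one' := Equiv.ext fun e => coverTrack_one hπ 1 e
  map_mul' α β := Equiv.ext fun e => coverTrack_mul hπ α β 1 e

/-- A null homotopy of α, applied to π e, contracts the loop α(t) • π e relative to its endpoints,
so the lift of this loop ends where it starts. -/
theorem coverPerm_of_mem_nullLoops {α : basedPaths G} (h : α ∈ nullLoops G) :
    coverPerm hπ α = 1 := by
  ext e
  obtain ⟨F⟩ : (α : C(I, G)).HomotopicRel 1 {0, 1} := h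
  let F' : ContinuousMap.HomotopyRel (⟨fun t => α.1 t • π e, by fun_prop⟩ : C(I, B))
      (ContinuousMap.const I (π e)) {0, 1} :=
    ⟨⟨⟨fun x => F x • π e, by fun_prop⟩, fun x => by simp, fun x => by simp⟩, fun t x hx => by
      have h1 := F.eq_fst t hx
      simp [h1]⟩
  have h0 : α.1 0 = 1 := α.2
  have key := hπ.liftPath_apply_one_eq_of_homotopicRel ⟨F'⟩ e (by simp [h0]) (by simp)
  rw [hπ.liftPath_const (by simp)] at key
  refine Eq.trans ?_ key
  refine (eq_coverTrack hπ (ContinuousMap.continuous _) (fun t => ?_) (hπ.liftPath_zero _ e _)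
    1).symm
  exact congr_fun (hπ.liftPath_lifts ⟨fun t => α.1 t • π e, by fun_prop⟩ e _) t

/-- The action of the universal covering group on a covering space. -/
def universalCoverPerm : UniversalCover G →* Equiv.Perm E :=
  QuotientGroup.lift (nullLoops G) (coverPerm hπ) fun _ h => coverPerm_of_mem_nullLoops hπ h

theorem continuous_universalCoverPerm (g : UniversalCover G) :
    Continuous (universalCoverPerm hπ g) := by
  obtain ⟨α, rfl⟩ := QuotientGroup.mk_surjective g
  change Continuous fun e => coverTrack hπ α (1, e)
  fun_prop

theorem proj_universalCoverPerm (g : UniversalCover G) (e : E) :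
    π (universalCoverPerm hπ g e) = coverHom G g • π e := by
  obtain ⟨α, rfl⟩ := QuotientGroup.mk_surjective g
  exact proj_coverTrack hπ α 1 e

theorem universalCoverPerm_mk {α : basedPaths G} {Γ : C(I, E)}
    (h : ∀ t, π (Γ t) = α.1 t • π (Γ 0)) :
    universalCoverPerm hπ (QuotientGroup.mk α) (Γ 0) = Γ 1 :=
  (eq_coverTrack hπ Γ.continuous h rfl 1).symm

/-- If g fixes e, the track of e is a loop in E and contracts. The equivariant map r ∘ π, corrected
by the constant (r (π e))⁻¹, sends the track to α and the contraction to a null homotopy of α. -/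
theorem eq_one_of_universalCoverPerm_eq [SimplyConnectedSpace E] {r : B → G} (hr : Continuous r)
    (hrs : ∀ g b, r (g • b) = g * r b) {g : UniversalCover G} {e : E}
    (h : universalCoverPerm hπ g e = e) : g = 1 := by
  obtain ⟨α, rfl⟩ := QuotientGroup.mk_surjective g
  rw [QuotientGroup.eq_one_iff]
  let Γ : Path e e := ⟨⟨fun t => coverTrack hπ α (t, e), by fun_prop⟩, coverTrack_zero hπ α e, h⟩
  obtain ⟨H⟩ := SimplyConnectedSpace.paths_homotopic Γ (Path.refl e)
  have hc := hπ.continuous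
  have hα : ∀ t, r (π (Γ t)) * (r (π e))⁻¹ = α.1 t := fun t => by
    change r (π (coverTrack hπ α (t, e))) * _ = _
    rw [proj_coverTrack hπ, hrs, mul_inv_cancel_right]
  refine ⟨⟨⟨⟨fun x => r (π (H x)) * (r (π e))⁻¹, by fun_prop⟩, fun x => ?_, fun x => ?_⟩,
    fun t x hx => ?_⟩⟩
  · have h1 : H (0, x) = Γ x := H.apply_zero x
    change r (π (H (0, x))) * _ = _
    rw [h1, hα]
  · have h1 : H (1, x) = e := H.apply_one x
    change r (π (H (1, x))) * _ = _
    rw [h1, mul_inv_cancel]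
    rfl
  · have h1 : H (t, x) = Γ x := H.eq_fst t hx
    change r (π (H (t, x))) * _ = _
    rw [h1, hα]

end CoverAction

/-- Over U × Y the sheets are the products of the sheets over U with Y, so the fibre of f over x
still indexes them. -/
theorem IsCoveringMap.prodMap_id {E X : Type*} [TopologicalSpace E] [TopologicalSpace X]
    {f : E → X} (hf : IsCoveringMap f) (Y : Type*) [TopologicalSpace Y] :
    IsCoveringMap (Prod.map f (id : Y → Y)) := by
  rw [isCoveringMap_iff_isCoveringMapOn_univ]
  rintro ⟨x, y⟩ -
  refine IsEvenlyCovered.to_isEvenlyCovered_preimage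
    (show IsEvenlyCovered _ _ (f ⁻¹' {x}) from ?_)
  obtain ⟨hd, U, hx, hU, hfU, H, hH⟩ := hf x
  have hfc := hf.continuous
  have hH' : ∀ z, f (H.symm z).1 = z.1.1 := fun z => by
    rw [← hH, H.apply_symm_apply]
  refine ⟨hd, U ×ˢ univ, ⟨hx, trivial⟩, hU.prod isOpen_univ,
    (hU.prod isOpen_univ).preimage (hfc.prodMap continuous_id), ⟨⟨fun p =>
      (⟨(f p.1.1, p.1.2), p.2⟩, (H ⟨p.1.1, p.2.1⟩).2), fun q =>
      ⟨((H.symm (⟨q.1.1.1, q.1.2.1⟩, q.2)).1, q.1.1.2),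
        ⟨(H.symm (⟨q.1.1.1, q.1.2.1⟩, q.2)).2, trivial⟩⟩, ?_, ?_⟩, ?_, ?_⟩, ?_⟩
  · rintro ⟨⟨a, b⟩, h⟩
    have h1 : ((⟨f a, h.1⟩ : U), (H ⟨a, h.1⟩).2) = H ⟨a, h.1⟩ :=
      Prod.ext (Subtype.ext (hH ⟨a, h.1⟩).symm) rfl
    simp only [h1, H.symm_apply_apply]
  · rintro ⟨⟨⟨a, b⟩, h⟩, c⟩
    refine Prod.ext (Subtype.ext (Prod.ext ?_ rfl)) ?_
    · exact hH' _
    · change (H (H.symm _)).2 = c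
      rw [H.apply_symm_apply]
  · fun_prop
  · fun_prop
  · intro p
    rfl

end

section

open Filter Set

/-! ### Spaces covered by a real vector space -/

theorem contractibleSpace_cube (k : ℕ) : ContractibleSpace (Fin k → I) := by
  rw [contractible_iff_id_nullhomotopic]
  refine ⟨0, ⟨⟨⟨fun x i => σ x.1 * x.2 i, by fun_prop⟩, fun y => ?_, fun y => ?_⟩⟩⟩
  · funext i
    simp
  · funext i
    simp

/-- Clamping coordinates retracts ℝᵏ onto the cube, which is therefore a quotient of a locally path
connected space. -/
theorem locallyPathConnectedSpace_cube (k : ℕ) : LocallyPathConnectedSpace (Fin k → I) := by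
  let f : (Fin k → ℝ) → Fin k → I := fun y i => projIcc 0 1 zero_le_one (y i)
  have hf : Continuous f := continuous_pi fun i => continuous_projIcc.comp (continuous_apply i)
  refine (Topology.IsQuotientMap.of_inverse (f := fun (y : Fin k → I) i => (y i : ℝ)) (by fun_prop)
    hf fun y => ?_).locallyPathConnectedSpace
  funext i
  exact projIcc_val zero_le_one (y i)

theorem isPreconnected_cube_boundary {k : ℕ} (hk : 2 ≤ k) :
    IsPreconnected (Cube.boundary (Fin k)) := by
  have : Nontrivial (Fin k) := Fin.nontrivial_iff_two_le.2 hk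
  have hzero : ∀ y : Fin k → I, ∀ i, y i = 0 → ∃ t ⊆ Cube.boundary (Fin k), 0 ∈ t ∧ y ∈ t ∧
      IsPreconnected t := by
    intro y i hi
    refine ⟨range fun (t : I) i => t * y i, ?_, ⟨0, ?_⟩, ⟨1, ?_⟩, isPreconnected_range (by fun_prop)⟩
    · rintro _ ⟨t, rfl⟩
      exact ⟨i, Or.inl (by simp [hi])⟩
    · funext j
      simp
    · funext j
      simp
  refine isPreconnected_of_forall 0 ?_
  rintro y ⟨i, hi | hi⟩
  · exact hzero y i hi
  · obtain ⟨j, hj⟩ := exists_ne i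
    obtain ⟨t, ht, h0, hy, hc⟩ := hzero (Function.update y j 0) j (by simp)
    have hcont : Continuous fun s : I => Function.update y j (s * y j) := by fun_prop
    refine ⟨t ∪ range fun s : I => Function.update y j (s * y j), union_subset ht ?_, Or.inl h0,
      Or.inr ⟨1, by simp⟩, hc.union _ hy ⟨0, by simp⟩ (isPreconnected_range hcont)⟩
    rintro _ ⟨s, rfl⟩
    exact ⟨i, Or.inr (by simp [hj.symm, hi])⟩

/-- A map of the cube lifts to E. Its lift is constant on the connected boundary, so the
straight-line homotopy to e in E projects to a homotopy relative to the boundary. -/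
theorem subsingleton_homotopyGroup_of_isCoveringMap {E X : Type*} [AddCommGroup E] [Module ℝ E]
    [TopologicalSpace E] [IsTopologicalAddGroup E] [ContinuousSMul ℝ E] [TopologicalSpace X]
    {q : E → X} (hq : IsCoveringMap q) (hsurj : Function.Surjective q) {k : ℕ} (hk : 2 ≤ k)
    (x : X) : Subsingleton (HomotopyGroup.Pi k X x) := by
  have := contractibleSpace_cube k
  have := locallyPathConnectedSpace_cube k
  have hqc := hq.continuous
  obtain ⟨e, rfl⟩ := hsurj x
  suffices h : ∀ f : GenLoop (Fin k) X (q e), GenLoop.Homotopic f GenLoop.const by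
    refine ⟨fun a b => ?_⟩
    induction a using Quotient.inductionOn with | _ f
    induction b using Quotient.inductionOn with | _ g
    exact Quotient.sound ((h f).trans (h g).symm)
  intro f
  have h0 : (0 : Fin k → I) ∈ Cube.boundary (Fin k) := ⟨⟨0, by omega⟩, Or.inl rfl⟩
  obtain ⟨F, ⟨hF0, hF⟩, -⟩ := hq.existsUnique_continuousMap_lifts f.1 0 e (f.2 0 h0).symm
  have hF' : ∀ y, q (F y) = f.1 y := congr_fun hF
  have hconst : ∀ y ∈ Cube.boundary (Fin k), F y = e := by
    intro y hy
    rw [← hF0]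
    refine hq.constOn_of_comp (isPreconnected_cube_boundary hk) F.continuous.continuousOn
      (fun a ha b hb => ?_) hy h0
    rw [hF', hF', f.2 a ha, f.2 b hb]
  refine ⟨⟨⟨⟨fun p => q ((1 - (p.1 : ℝ)) • F p.2 + (p.1 : ℝ) • e), by fun_prop⟩, fun y => ?_,
    fun y => ?_⟩, fun t y hy => ?_⟩⟩
  · simpa using hF' y
  · simp
  · change q ((1 - (t : ℝ)) • F y + (t : ℝ) • e) = f.1 y
    rw [hconst y hy, f.2 y hy, ← add_smul, sub_add_cancel, one_smul]

theorem isTopologicalManifold_of_isLocalHomeomorph {d : ℕ} {X : Type*} [TopologicalSpace X]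
    [T2Space X] {q : EuclideanSpace ℝ (Fin d) → X} (hq : IsLocalHomeomorph q)
    (hsurj : Function.Surjective q) : IsTopologicalManifold d X := by
  have hoq : IsOpenQuotientMap q := ⟨hsurj, hq.continuous, hq.isOpenMap⟩
  refine ⟨inferInstance, hoq.isQuotientMap.secondCountableTopology hq.isOpenMap, ?_⟩
  choose s hs using hsurj
  choose φ hφ hφq using hq
  exact ⟨{ atlas := range fun x => (φ (s x)).symm
           chartAt := fun x => (φ (s x)).symm
           mem_chart_source := fun x => by
             have h := (φ (s x)).map_source (hφ (s x))
             rwa [← congr_fun (hφq (s x)) (s x), hs] at h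
           chart_mem_atlas := fun x => ⟨x, rfl⟩ }⟩

end

section

open Filter Set
open scoped MatrixGroups UpperHalfPlane

/-! ### The action of `SL₂(ℝ)` on positively oriented bases -/

theorem omega_matrix_real (u : PosBasis) (M : Matrix (Fin 2) (Fin 2) ℝ) :
    omega (M 1 0 * u.1 0 + M 1 1 * u.1 1) (M 0 0 * u.1 0 + M 0 1 * u.1 1) = M.det * u.covol := by
  rw [Matrix.det_fin_two]
  simp [omega, PosBasis.covol]
  ring

instance : MulAction SL(2, ℝ) PosBasis where
  smul γ u := ⟨fun i => γ i 0 * u.1 0 + γ i 1 * u.1 1, by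
    rw [omega_matrix_real u γ.1, γ.2]
    simpa using u.covol_pos⟩
  one_smul u := by
    refine Subtype.ext (funext fun i => ?_)
    change ((1 : SL(2, ℝ)) i 0 : ℂ) * u.1 0 + ((1 : SL(2, ℝ)) i 1 : ℂ) * u.1 1 = u.1 i
    fin_cases i <;> simp
  mul_smul γ δ u := by
    refine Subtype.ext (funext fun i => ?_)
    change ((γ * δ : SL(2, ℝ)) i 0 : ℂ) * u.1 0 + ((γ * δ : SL(2, ℝ)) i 1 : ℂ) * u.1 1 =
      γ i 0 * (δ 0 0 * u.1 0 + δ 0 1 * u.1 1) + γ i 1 * (δ 1 0 * u.1 0 + δ 1 1 * u.1 1)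
    rw [Matrix.SpecialLinearGroup.coe_mul, Matrix.mul_apply, Matrix.mul_apply, Fin.sum_univ_two,
      Fin.sum_univ_two]
    push_cast
    ring

theorem real_smul_apply (γ : SL(2, ℝ)) (u : PosBasis) (i : Fin 2) :
    (γ • u).1 i = γ i 0 * u.1 0 + γ i 1 * u.1 1 := rfl

theorem covol_real_smul (γ : SL(2, ℝ)) (u : PosBasis) : (γ • u).covol = u.covol := by
  have h := omega_matrix_real u γ.1
  rw [γ.2, one_mul] at h
  exact h

theorem slInclusion_smul (γ : SL(2, ℤ)) (u : PosBasis) : slInclusion γ • u = γ • u := by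
  refine Subtype.ext (funext fun i => ?_)
  rw [real_smul_apply, PosBasis.smul_apply]
  simp [slInclusion]

theorem continuous_sl_apply (i j : Fin 2) : Continuous fun γ : SL(2, ℝ) => γ i j :=
  (continuous_apply_apply i j).comp continuous_subtype_val

instance : ContinuousSMul SL(2, ℝ) PosBasis where
  continuous_smul := by
    refine Continuous.subtype_mk (continuous_pi fun i => ?_) _
    have h := fun j => Complex.continuous_ofReal.comp
      ((continuous_sl_apply i j).comp (continuous_fst (X := SL(2, ℝ)) (Y := PosBasis)))
    exact ((h 0).mul (by fun_prop)).add ((h 1).mul (by fun_prop))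

/-- The normalised matrix of coordinates of a basis. -/
def frame (u : PosBasis) : SL(2, ℝ) :=
  ⟨(√u.covol)⁻¹ • !![(u.1 0).im, (u.1 0).re; (u.1 1).im, (u.1 1).re], by
    have h := u.covol_pos
    have h2 : (√u.covol)⁻¹ ^ 2 * u.covol = 1 := by
      rw [inv_pow, Real.sq_sqrt h.le, inv_mul_cancel₀ h.ne']
    rw [Matrix.det_smul, Matrix.det_fin_two_of, Fintype.card_fin, ← h2]
    congr 1
    simp [PosBasis.covol, omega]
    ring⟩

theorem continuous_frame : Continuous frame := by
  have h : ∀ u : PosBasis, √u.covol ≠ 0 := fun u => (Real.sqrt_pos.2 u.covol_pos).ne'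
  refine Continuous.subtype_mk (Continuous.smul
    ((Real.continuous_sqrt.comp PosBasis.continuous_covol).inv₀ h) ?_) _
  refine continuous_matrix fun i j => ?_
  have h0 : Continuous fun u : PosBasis => u.1 0 := PosBasis.continuous_val_apply continuous_id 0
  have h1 : Continuous fun u : PosBasis => u.1 1 := PosBasis.continuous_val_apply continuous_id 1
  fin_cases i <;> fin_cases j
  · exact Complex.continuous_im.comp h0
  · exact Complex.continuous_re.comp h0
  · exact Complex.continuous_im.comp h1
  · exact Complex.continuous_re.comp h1

theorem frame_apply_zero (u : PosBasis) (i : Fin 2) : frame u i 0 = (√u.covol)⁻¹ * (u.1 i).im := by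
  change ((√u.covol)⁻¹ • !![(u.1 0).im, (u.1 0).re; (u.1 1).im, (u.1 1).re]) i 0 = _
  fin_cases i <;> simp

theorem frame_apply_one (u : PosBasis) (i : Fin 2) : frame u i 1 = (√u.covol)⁻¹ * (u.1 i).re := by
  change ((√u.covol)⁻¹ • !![(u.1 0).im, (u.1 0).re; (u.1 1).im, (u.1 1).re]) i 1 = _
  fin_cases i <;> simp

/-- This is the equivariant map that makes the action of the universal covering group free.
Normalisation costs nothing because SL₂(ℝ) preserves the covolume. -/
theorem frame_smul (γ : SL(2, ℝ)) (u : PosBasis) : frame (γ • u) = γ * frame u := by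
  ext i j
  rw [Matrix.SpecialLinearGroup.coe_mul, Matrix.mul_apply, Fin.sum_univ_two]
  fin_cases j
  · change frame (γ • u) i 0 = γ i 0 * frame u 0 0 + γ i 1 * frame u 1 0
    simp only [frame_apply_zero, covol_real_smul, real_smul_apply, Complex.add_im,
      Complex.im_ofReal_mul]
    ring
  · change frame (γ • u) i 1 = γ i 0 * frame u 0 1 + γ i 1 * frame u 1 1
    simp only [frame_apply_one, covol_real_smul, real_smul_apply, Complex.add_re,
      Complex.re_ofReal_mul]
    ring

theorem eq_of_frame_eq {u v : PosBasis} (hc : u.covol = v.covol) (h : frame u = frame v) :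
    u = v := by
  have hs : (√v.covol)⁻¹ ≠ 0 := inv_ne_zero (Real.sqrt_pos.2 v.covol_pos).ne'
  refine Subtype.ext (funext fun i => Complex.ext ?_ ?_)
  · have h1 : frame u i 1 = frame v i 1 := by rw [h]
    rw [frame_apply_one, frame_apply_one, hc] at h1
    exact mul_left_cancel₀ hs h1
  · have h1 : frame u i 0 = frame v i 0 := by rw [h]
    rw [frame_apply_zero, frame_apply_zero, hc] at h1
    exact mul_left_cancel₀ hs h1

/-! ### The universal covering of the space of bases -/

theorem omega_mul_self (z w : ℂ) : omega z (w * z) = w.im * Complex.normSq z := by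
  simp [omega, Complex.normSq_apply]
  ring

/-- Bases in terms of the second basis vector and the quotient of the basis vectors. -/
def basisHomeo : {z : ℂ // z ≠ 0} × ℍ ≃ₜ PosBasis where
  toFun p := ⟨![p.2 * p.1.1, p.1.1], by
    change 0 < omega p.1.1 (p.2 * p.1.1)
    rw [omega_mul_self]
    exact mul_pos p.2.im_pos (Complex.normSq_pos.2 p.1.2)⟩
  invFun u := (⟨u.1 1, fun h => by
      have := u.2
      rw [h] at this
      simp [omega] at this⟩, ⟨u.1 0 / u.1 1, by
      have h := u.2
      have h1 : u.1 1 ≠ 0 := fun h => by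
        have := u.2
        rw [h] at this
        simp [omega] at this
      rw [← div_mul_cancel₀ (u.1 0) h1, omega_mul_self] at h
      exact pos_of_mul_pos_left h (Complex.normSq_nonneg _)⟩)
  left_inv p := by
    refine Prod.ext (Subtype.ext rfl) (UpperHalfPlane.ext ?_)
    exact mul_div_cancel_right₀ _ p.1.2
  right_inv u := by
    have h1 : u.1 1 ≠ 0 := fun h => by
      have := u.2
      rw [h] at this
      simp [omega] at this
    refine Subtype.ext (funext fun i => ?_)
    fin_cases i
    · exact div_mul_cancel₀ _ h1
    · rfl
  continuous_toFun := by
    refine Continuous.subtype_mk (continuous_pi fun i => ?_) _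
    have h1 : Continuous fun p : {z : ℂ // z ≠ 0} × ℍ => (p.1 : ℂ) := by fun_prop
    have h2 : Continuous fun p : {z : ℂ // z ≠ 0} × ℍ => (p.2 : ℂ) :=
      UpperHalfPlane.continuous_coe.comp continuous_snd
    fin_cases i
    · exact h2.mul h1
    · exact h1
  continuous_invFun := by
    have h0 : Continuous fun u : PosBasis => u.1 0 := PosBasis.continuous_val_apply continuous_id 0
    have h1 : Continuous fun u : PosBasis => u.1 1 := PosBasis.continuous_val_apply continuous_id 1
    refine (Continuous.subtype_mk h1 _).prodMk ?_
    rw [UpperHalfPlane.isEmbedding_coe.continuous_iff]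
    refine h0.div h1 fun u h => ?_
    have := u.2
    rw [h] at this
    simp [omega] at this

/-- The universal covering of the space of positively oriented bases. -/
def expBasis (e : ℂ × ℍ) : PosBasis := basisHomeo (⟨Complex.exp e.1, e.1.exp_ne_zero⟩, e.2)

theorem isCoveringMap_expBasis : IsCoveringMap expBasis :=
  (IsCoveringMap.prodMap_id Complex.isCoveringMap_exp ℍ).homeomorph_comp basisHomeo

theorem expBasis_surjective : Function.Surjective expBasis := by
  intro u
  obtain ⟨⟨z, τ⟩, rfl⟩ := basisHomeo.surjective u
  obtain ⟨ζ, hζ⟩ := Complex.isAddQuotientCoveringMap_exp.surjective z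
  exact ⟨(ζ, τ), congrArg (fun z => basisHomeo (z, τ)) hζ⟩

/-- A real translation in the covering rescales the basis, which allows the covolume to be adjusted
along paths. -/
theorem expBasis_add_real (e : ℂ × ℍ) (x : ℝ) (i : Fin 2) :
    (expBasis (e.1 + x, e.2)).1 i = Real.exp x * (expBasis e).1 i := by
  fin_cases i
  · change e.2 * Complex.exp (e.1 + x) = Real.exp x * (e.2 * Complex.exp e.1)
    rw [Complex.exp_add, Complex.ofReal_exp]
    ring
  · change Complex.exp (e.1 + x) = Real.exp x * Complex.exp e.1
    rw [Complex.exp_add, Complex.ofReal_exp]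
    ring

theorem covol_expBasis_add_real (e : ℂ × ℍ) (x : ℝ) :
    (expBasis (e.1 + x, e.2)).covol = Real.exp (2 * x) * (expBasis e).covol := by
  rw [PosBasis.covol, expBasis_add_real, expBasis_add_real, two_mul, Real.exp_add]
  simp only [PosBasis.covol, omega, Complex.re_ofReal_mul, Complex.im_ofReal_mul]
  ring

/-- Points of the covering space whose images are related by `SL₂(ℝ)` are related by the universal
covering group. -/
theorem exists_universalCoverPerm_eq {e e' : ℂ × ℍ} {γ : SL(2, ℝ)}
    (h : expBasis e' = γ • expBasis e) :
    ∃ g : UniversalCover SL(2, ℝ), coverHom SL(2, ℝ) g = γ ∧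
      universalCoverPerm isCoveringMap_expBasis g e = e' := by
  obtain ⟨P⟩ := PathConnectedSpace.joined e e'
  have hc := isCoveringMap_expBasis.continuous
  let c := (expBasis e).covol
  have hc0 : 0 < c := (expBasis e).covol_pos
  have hcov : ∀ t, 0 < (expBasis (P t)).covol := fun t => (expBasis (P t)).covol_pos
  -- SL₂(ℝ) cannot change the covolume, so the path is rescaled to constant covolume. The factor 1/2
  -- appears because the covolume is quadratic in the basis, and the correction vanishes at both
  -- ends.
  let x : I → ℝ := fun t => Real.log (c / (expBasis (P t)).covol) / 2
  have hx : Continuous x := by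
    refine Continuous.div_const (Continuous.log (continuous_const.div
      (PosBasis.continuous_covol.comp (hc.comp P.continuous)) fun t => (hcov t).ne') fun t => ?_) 2
    exact (div_pos hc0 (hcov t)).ne'
  let Γ : C(I, ℂ × ℍ) := ⟨fun t => ((P t).1 + x t, (P t).2), by fun_prop⟩
  have hΓc : ∀ t, (expBasis (Γ t)).covol = c := fun t => by
    change (expBasis ((P t).1 + x t, (P t).2)).covol = c
    rw [covol_expBasis_add_real, mul_div_cancel₀ _ two_ne_zero,
      Real.exp_log (div_pos hc0 (hcov t)), div_mul_cancel₀ _ (hcov t).ne']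
  have hΓ0 : Γ 0 = e := by
    change ((P 0).1 + (x 0 : ℂ), (P 0).2) = e
    have : x 0 = 0 := by
      change Real.log (c / (expBasis (P 0)).covol) / 2 = 0
      rw [P.source, div_self hc0.ne']
      simp
    rw [this, P.source]
    simp
  have hΓ1 : Γ 1 = e' := by
    change ((P 1).1 + (x 1 : ℂ), (P 1).2) = e'
    have : x 1 = 0 := by
      change Real.log (c / (expBasis (P 1)).covol) / 2 = 0
      rw [P.target, h, covol_real_smul, div_self hc0.ne']
      simp
    rw [this, P.target]
    simp
  -- At constant covolume a basis is determined by its frame, so the quotient of frames is the path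
  -- in SL₂(ℝ) that carries e along Γ.
  let α : basedPaths SL(2, ℝ) := ⟨⟨fun t => frame (expBasis (Γ t)) * (frame (expBasis e))⁻¹, by
    have := continuous_frame
    fun_prop⟩, by
      change frame (expBasis (Γ 0)) * _ = 1
      rw [hΓ0, mul_inv_cancel]⟩
  have hα : ∀ t, expBasis (Γ t) = α.1 t • expBasis (Γ 0) := fun t => by
    refine eq_of_frame_eq ?_ ?_
    · rw [covol_real_smul, hΓc, hΓc]
    · rw [frame_smul, hΓ0]
      exact (inv_mul_cancel_right _ _).symm
  refine ⟨QuotientGroup.mk α, ?_, ?_⟩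
  · change frame (expBasis (Γ 1)) * _ = γ
    rw [hΓ1, h, frame_smul, mul_inv_cancel_right]
  · have := universalCoverPerm_mk isCoveringMap_expBasis hα
    rwa [hΓ0, hΓ1] at this

end

section

open Filter Set
open scoped MatrixGroups UpperHalfPlane

/-! ### The action of `ℤ² ⋊ SL₂(ℤ)~` on the universal covering -/

/-- Composition of affine maps follows the multiplication of the semidirect product, hence the
action of `JacobiTilde`. -/
theorem affAct_mul (γ δ : SL(2, ℤ)) (v w : Fin 2 → ℤ) (s : Fin 2 → ℝ) :
    affAct (γ * δ) (v + γ.1.mulVec w) s = affAct γ v (affAct δ w s) := by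
  funext i
  have h : ∀ j, (γ * δ : SL(2, ℤ)) i j = γ i 0 * δ 0 j + γ i 1 * δ 1 j := fun j => by
    rw [Matrix.SpecialLinearGroup.coe_mul, Matrix.mul_apply, Fin.sum_univ_two]
  simp only [affAct, h, Pi.add_apply, Matrix.mulVec, dotProduct, Fin.sum_univ_two]
  push_cast
  ring

theorem continuous_affAct (γ : SL(2, ℤ)) (w : Fin 2 → ℤ) : Continuous (affAct γ w) := by
  unfold affAct
  fun_prop

theorem slInclusion_toSL2Z (g : SL2ZTilde) :
    slInclusion (SL2ZTilde.toSL2Z g) = coverHom SL(2, ℝ) g.1 := by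
  have h := (MonoidHom.ofInjective slInclusion_injective).apply_symm_apply
    ((coverHom SL(2, ℝ)).subgroupComap slInclusion.range g)
  exact congrArg Subtype.val h

instance : MulAction JacobiTilde ((ℂ × ℍ) × (Fin 2 → ℝ)) where
  smul a x := (universalCoverPerm isCoveringMap_expBasis a.right.1 x.1,
    affAct (SL2ZTilde.toSL2Z a.right) a.left.toAdd x.2)
  one_smul x := by
    change (universalCoverPerm isCoveringMap_expBasis 1 x.1,
      affAct (SL2ZTilde.toSL2Z 1) 0 x.2) = x
    rw [map_one, map_one, affAct_one]
    refine Prod.ext rfl ?_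
    funext i
    simp
  mul_smul a b x := by
    change (universalCoverPerm isCoveringMap_expBasis (a.right.1 * b.right.1) x.1,
      affAct (SL2ZTilde.toSL2Z (a.right * b.right))
        (a.left.toAdd + (SL2ZTilde.toSL2Z a.right).1.mulVec b.left.toAdd) x.2) =
      (universalCoverPerm isCoveringMap_expBasis a.right.1
        (universalCoverPerm isCoveringMap_expBasis b.right.1 x.1), _)
    rw [map_mul, map_mul, affAct_mul]
    rfl

theorem jacobi_smul_def (a : JacobiTilde) (x : (ℂ × ℍ) × (Fin 2 → ℝ)) :
    a • x = (universalCoverPerm isCoveringMap_expBasis a.right.1 x.1,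
      affAct (SL2ZTilde.toSL2Z a.right) a.left.toAdd x.2) := rfl

theorem expBasis_smul (a : JacobiTilde) (x : (ℂ × ℍ) × (Fin 2 → ℝ)) :
    expBasis (a • x).1 = SL2ZTilde.toSL2Z a.right • expBasis x.1 := by
  rw [jacobi_smul_def, proj_universalCoverPerm isCoveringMap_expBasis, ← slInclusion_toSL2Z,
    slInclusion_smul]

theorem eq_one_of_jacobi_smul_eq {a : JacobiTilde} {x : (ℂ × ℍ) × (Fin 2 → ℝ)} (h : a • x = x) :
    a = 1 := by
  rw [jacobi_smul_def] at h
  have h1 : a.right = 1 := Subtype.ext (eq_one_of_universalCoverPerm_eq isCoveringMap_expBasis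
    continuous_frame frame_smul (congrArg Prod.fst h))
  have h2 : affAct (SL2ZTilde.toSL2Z a.right) a.left.toAdd x.2 = x.2 := congrArg Prod.snd h
  rw [h1, map_one, affAct_one] at h2
  refine SemidirectProduct.ext ?_ h1
  refine Multiplicative.toAdd.injective (funext fun i => ?_)
  have h3 := congr_fun h2 i
  have h4 : ((a.left.toAdd i : ℤ) : ℝ) = 0 := by linarith
  exact_mod_cast h4

/-- The universal covering of the space of lattices. -/
def latticeCover (n : ℕ+) (x : (ℂ × ℍ) × (Fin 2 → ℝ)) : LatticeSpaceN n :=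
  heisMk n (expBasis x.1, x.2)

theorem isOpenQuotientMap_latticeCover (n : ℕ+) : IsOpenQuotientMap (latticeCover n) := by
  have h : IsOpenQuotientMap expBasis :=
    ⟨expBasis_surjective, isCoveringMap_expBasis.continuous, isCoveringMap_expBasis.isOpenMap⟩
  exact (isOpenQuotientMap_heisMk n).comp (h.prodMap IsOpenQuotientMap.id)

/-- Equal lattices have bases related by some γ in SL₂(ℤ). `exists_universalCoverPerm_eq` lifts γ to
an element of the universal covering group matching the chosen points upstairs, and this element
lies in `SL2ZTilde` because its image is γ. -/
theorem latticeCover_eq_iff {n : ℕ+} {x y : (ℂ × ℍ) × (Fin 2 → ℝ)} :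
    latticeCover n x = latticeCover n y ↔ x ∈ MulAction.orbit JacobiTilde y := by
  rw [latticeCover, latticeCover, heisMk_eq_iff, heisLattice_eq_iff]
  constructor
  · rintro ⟨γ, w, h1, h2⟩
    rw [← slInclusion_smul] at h1
    obtain ⟨g, hg, hge⟩ := exists_universalCoverPerm_eq h1
    have hmem : g ∈ SL2ZTilde := ⟨γ, hg.symm⟩
    have hγ : SL2ZTilde.toSL2Z ⟨g, hmem⟩ = γ :=
      slInclusion_injective ((slInclusion_toSL2Z _).trans hg)
    refine ⟨⟨Multiplicative.ofAdd w, ⟨g, hmem⟩⟩, Prod.ext hge ?_⟩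
    change affAct (SL2ZTilde.toSL2Z ⟨g, hmem⟩) w y.2 = x.2
    rw [hγ]
    exact h2.symm
  · rintro ⟨a, rfl⟩
    exact ⟨SL2ZTilde.toSL2Z a.right, a.left.toAdd, expBasis_smul a y, rfl⟩

theorem exists_injOn_latticeCover (n : ℕ+) (x : (ℂ × ℍ) × (Fin 2 → ℝ)) :
    ∃ U ∈ 𝓝 x, InjOn (latticeCover n) U := by
  obtain ⟨O, hO, hx, hinj⟩ := exists_injOn_heisMk n (expBasis x.1, x.2)
  obtain ⟨φ, hφ, hφe⟩ := isCoveringMap_expBasis.isLocalHomeomorph x.1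
  have hc : Continuous (Prod.map expBasis (id : (Fin 2 → ℝ) → _)) :=
    isCoveringMap_expBasis.continuous.prodMap continuous_id
  refine ⟨Prod.map expBasis id ⁻¹' O ∩ φ.source ×ˢ univ, inter_mem
    ((hO.preimage hc).mem_nhds hx) ((φ.open_source.prod isOpen_univ).mem_nhds ⟨hφ, trivial⟩), ?_⟩
  intro a ha b hb hab
  have h := hinj ha.1 hb.1 hab
  have h2 : a.2 = b.2 := (Prod.ext_iff.1 h).2
  refine Prod.ext (φ.injOn ha.2.1 hb.2.1 ?_) h2
  rw [← hφe]
  exact congrArg Prod.fst h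

theorem isQuotientCoveringMap_latticeCover (n : ℕ+) :
    IsQuotientCoveringMap (latticeCover n) JacobiTilde where
  toIsQuotientMap := (isOpenQuotientMap_latticeCover n).isQuotientMap
  continuous_const_smul a := by
    have h1 := continuous_universalCoverPerm isCoveringMap_expBasis a.right.1
    have h2 := continuous_affAct (SL2ZTilde.toSL2Z a.right) a.left.toAdd
    exact (h1.comp continuous_fst).prodMk (h2.comp continuous_snd)
  apply_eq_iff_mem_orbit := latticeCover_eq_iff
  disjoint x := by
    -- On a neighbourhood where the cover is injective, a translate that meets it must fix the
    -- common point, and the action is free.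
    obtain ⟨U, hU, hinj⟩ := exists_injOn_latticeCover n x
    refine ⟨U, hU, fun a ⟨z, ⟨y, hy, hyz⟩, hz⟩ => ?_⟩
    refine eq_one_of_jacobi_smul_eq (x := y) ?_
    have hyz : a • y = z := hyz
    rw [hyz]
    refine hinj hz hy (latticeCover_eq_iff.2 ⟨a, hyz⟩)

/-! ### The topology of the space of lattices -/

/-- Logarithmic coordinates on the half plane. -/
def halfPlaneHomeo : ℍ ≃ₜ ℝ × ℝ where
  toFun τ := (τ.re, Real.log τ.im)
  invFun p := ⟨⟨p.1, Real.exp p.2⟩, Real.exp_pos _⟩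
  left_inv τ := UpperHalfPlane.ext (Complex.ext rfl (Real.exp_log τ.im_pos))
  right_inv p := Prod.ext rfl (Real.log_exp p.2)
  continuous_toFun := UpperHalfPlane.continuous_re.prodMk
    (UpperHalfPlane.continuous_im.log fun τ => τ.im_pos.ne')
  continuous_invFun := by
    rw [UpperHalfPlane.isEmbedding_coe.continuous_iff]
    have h : Continuous fun p : ℝ × ℝ => Complex.equivRealProdCLM.symm (p.1, Real.exp p.2) := by
      fun_prop
    exact h

/-- The universal covering space is a Euclidean space. -/
def coverHomeo : EuclideanSpace ℝ (Fin 6) ≃ₜ (ℂ × ℍ) × (Fin 2 → ℝ) :=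
  (ContinuousLinearEquiv.ofFinrankEq (𝕜 := ℝ) (F := (ℂ × (ℝ × ℝ)) × (Fin 2 → ℝ))
    (by simp)).toHomeomorph.trans
    (((Homeomorph.refl ℂ).prodCongr halfPlaneHomeo.symm).prodCongr (Homeomorph.refl _))

theorem isCoveringMap_coverHomeo (n : ℕ+) : IsCoveringMap (latticeCover n ∘ coverHomeo) :=
  (isQuotientCoveringMap_latticeCover n).isCoveringMap.comp_homeomorph coverHomeo

theorem surjective_coverHomeo (n : ℕ+) : Function.Surjective (latticeCover n ∘ coverHomeo) :=
  (isOpenQuotientMap_latticeCover n).surjective.comp coverHomeo.surjective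

theorem isTopologicalManifold_latticeSpaceN (n : ℕ+) :
    IsTopologicalManifold 6 (LatticeSpaceN n) := by
  have : T2Space (ClosedSubgroup Heis) := t2Space_closedSubgroup
  exact isTopologicalManifold_of_isLocalHomeomorph (isCoveringMap_coverHomeo n).isLocalHomeomorph
    (surjective_coverHomeo n)

instance pathConnectedSpace_latticeSpaceN (n : ℕ+) : PathConnectedSpace (LatticeSpaceN n) :=
  (surjective_coverHomeo n).pathConnectedSpace (isCoveringMap_coverHomeo n).continuous

theorem isEilenbergMacLane_latticeSpaceN (n : ℕ+) :
    IsEilenbergMacLane JacobiTilde (LatticeSpaceN n) := by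
  refine ⟨inferInstance, fun Λ => ⟨?_, fun k hk => ?_⟩⟩
  · obtain ⟨x, hx⟩ := (isOpenQuotientMap_latticeCover n).surjective Λ
    -- The fundamental group is first identified with the opposite of the deck group; inversion
    -- removes the opposite.
    exact ⟨((isQuotientCoveringMap_latticeCover n).fundamentalGroupEquiv ⟨x, hx⟩).trans
      (MulEquiv.inv' JacobiTilde).symm⟩
  · exact subsingleton_homotopyGroup_of_isCoveringMap (isCoveringMap_coverHomeo n)
      (surjective_coverHomeo n) hk Λ

end

section

open Filter Set

/-! ### The standard lattices -/

/-- The standard basis. -/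
def stdBasis : PosBasis := ⟨![Complex.I, 1], by simp [omega]⟩

theorem covol_stdBasis : stdBasis.covol = 1 := by
  simp [stdBasis, PosBasis.covol, omega]

theorem heisGen_stdBasis_zero (n : ℕ+) : heisGen n stdBasis 0 0 = ⟨Complex.I, 1 / 2⟩ := by
  rw [heisGen, covol_stdBasis]
  ext1
  · rfl
  · simp

theorem heisGen_stdBasis_one (n : ℕ+) : heisGen n stdBasis 0 1 = ⟨1, 1 / 2⟩ := by
  rw [heisGen, covol_stdBasis]
  ext1
  · rfl
  · simp

theorem baseLattice_eq (n : ℕ+) : baseLattice n = heisLattice n stdBasis 0 := by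
  have hle : baseLattice n ≤ heisLattice n stdBasis 0 := by
    rw [baseLattice, Subgroup.closure_le]
    rintro x (rfl | rfl | rfl)
    · rw [← heisGen_stdBasis_one n]
      exact heisGen_mem n stdBasis 0 1
    · rw [← heisGen_stdBasis_zero n]
      exact heisGen_mem n stdBasis 0 0
    · exact mk_zero_mem_heisLattice.2 ⟨1, by rw [covol_stdBasis]; simp⟩
  refine eq_heisLattice (fun t => ⟨fun h => mk_zero_mem_heisLattice.1 (hle h), ?_⟩)
    (fun x hx => exists_comb_of_mem_heisLattice (hle hx)) (fun i => ?_)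
  · rintro ⟨j, rfl⟩
    have h : (⟨0, 1 / (n : ℝ)⟩ : Heis) ∈ baseLattice n := Subgroup.subset_closure (by simp)
    have h2 := (baseLattice n).zpow_mem h j
    rwa [Heis.mk_zero_zpow, ← covol_stdBasis] at h2
  · fin_cases i
    · exact (heisGen_stdBasis_zero n).symm ▸ Subgroup.subset_closure (by simp)
    · exact (heisGen_stdBasis_one n).symm ▸ Subgroup.subset_closure (by simp)

theorem mk_zero_mem_baseLattice {n : ℕ+} {t : ℝ} :
    (⟨0, t⟩ : Heis) ∈ baseLattice n ↔ ∃ j : ℤ, t = j / (n : ℝ) := by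
  rw [baseLattice_eq, mk_zero_mem_heisLattice, covol_stdBasis]
  simp only [mul_one_div]

theorem exists_int_of_mem_baseLattice {n : ℕ+} {x : Heis} (hx : x ∈ baseLattice n) :
    ∃ a c : ℤ, x.z = ⟨a, c⟩ := by
  rw [baseLattice_eq] at hx
  obtain ⟨k, hk⟩ := exists_comb_of_mem_heisLattice hx
  refine ⟨k.2, k.1, hk.trans ?_⟩
  apply Complex.ext <;> simp [PosBasis.comb, stdBasis]

/-- The elements of the standard lattice over primitive vectors. -/
theorem mk_mem_baseLattice_iff {n : ℕ+} {a b c d : ℤ} (hodd : Odd (a * d - b * c)) {t : ℝ} :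
    (⟨⟨a, c⟩, t⟩ : Heis) ∈ baseLattice n ↔ ∃ j : ℤ, t = 1 / 2 + j / (n : ℝ) := by
  have hn : ((n : ℕ) : ℝ) ≠ 0 := by positivity
  obtain ⟨m, hm⟩ := exists_add_add_mul_eq (a := c) (b := a) (c := -d) (d := -b) (by
    convert hodd using 1
    ring)
  have hm' : (c + a + c * a : ℝ) = 2 * m + 1 := by exact_mod_cast hm
  have hcomb : stdBasis.comb (c, a) = ⟨a, c⟩ := by
    apply Complex.ext <;> simp [PosBasis.comb, stdBasis]
  have helt : ∀ j : ℤ, heisElt n stdBasis 0 (c, a) j =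
      ⟨⟨a, c⟩, 1 / 2 + ((j + n * m : ℤ) : ℝ) / (n : ℝ)⟩ := by
    intro j
    ext1
    · exact hcomb
    · simp only [heisElt, covol_stdBasis, hm']
      push_cast
      simp
      field_simp
      ring
  rw [baseLattice_eq, mem_heisLattice]
  constructor
  · rintro ⟨k, j, h⟩
    have hk : k = (c, a) := stdBasis.comb_injective ((congrArg Heis.z h).trans hcomb.symm)
    subst hk
    rw [helt] at h
    exact ⟨_, (congrArg Heis.t h).symm⟩
  · rintro ⟨j, rfl⟩
    refine ⟨(c, a), j - n * m, ?_⟩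
    rw [helt]
    ext1
    · rfl
    · simp

theorem exists_latticeSpaceN_eq_baseLattice (n : ℕ+) :
    ∃ Λ : LatticeSpaceN n, Λ.1.toSubgroup = baseLattice n :=
  ⟨heisMk n (stdBasis, 0), (baseLattice_eq n).symm⟩

/-! ### Affine automorphisms -/

namespace Heis

/-- A linear automorphism followed by the conjugation by a vector. -/
def affMap (w : Fin 2 → ℝ) (M : Matrix (Fin 2) (Fin 2) ℝ) (h : Heis) : Heis :=
  ofVec w * matAct M h * (ofVec w)⁻¹

/-- Conjugation by (w, 0) leaves z alone and adds `omega` of w and z to t. -/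
theorem affMap_eq (w : Fin 2 → ℝ) (M : Matrix (Fin 2) (Fin 2) ℝ) (h : Heis) :
    affMap w M h = ⟨⟨M 0 0 * h.z.re + M 0 1 * h.z.im, M 1 0 * h.z.re + M 1 1 * h.z.im⟩,
      M.det * h.t + (w 0 * (M 1 0 * h.z.re + M 1 1 * h.z.im) -
        w 1 * (M 0 0 * h.z.re + M 0 1 * h.z.im))⟩ := by
  ext1
  · simp [affMap, ofVec, matAct]
  · simp [affMap, ofVec, matAct]
    ring

theorem affMap_affMap (w v : Fin 2 → ℝ) (M N : Matrix (Fin 2) (Fin 2) ℝ) (h : Heis) :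
    affMap w M (affMap v N h) = affMap (w + M.mulVec v) (M * N) h := by
  simp only [affMap_eq, Matrix.det_mul]
  ext1
  · apply Complex.ext
    · simp [Matrix.mul_apply, Fin.sum_univ_two]
      ring
    · simp [Matrix.mul_apply, Fin.sum_univ_two]
      ring
  · simp [Matrix.mul_apply, Fin.sum_univ_two, Matrix.det_fin_two]
    ring

theorem affMap_zero_one (h : Heis) : affMap 0 1 h = h := by
  rw [affMap_eq]
  ext1
  · apply Complex.ext <;> simp
  · simp

theorem affMap_mul (w : Fin 2 → ℝ) (M : Matrix (Fin 2) (Fin 2) ℝ) (h k : Heis) :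
    affMap w M (h * k) = affMap w M h * affMap w M k := by
  simp only [affMap_eq]
  ext1
  · apply Complex.ext
    · simp
      ring
    · simp
      ring
  · simp [Matrix.det_fin_two]
    ring

theorem continuous_affMap (w : Fin 2 → ℝ) (M : Matrix (Fin 2) (Fin 2) ℝ) :
    Continuous (affMap w M) := by
  have h : affMap w M = fun h => ⟨Complex.equivRealProdCLM.symm
      (M 0 0 * h.z.re + M 0 1 * h.z.im, M 1 0 * h.z.re + M 1 1 * h.z.im),
      M.det * h.t + (w 0 * (M 1 0 * h.z.re + M 1 1 * h.z.im) -
        w 1 * (M 0 0 * h.z.re + M 0 1 * h.z.im))⟩ := by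
    funext h
    rw [affMap_eq]
    ext1
    · apply Complex.ext <;> simp
    · rfl
  rw [h]
  fun_prop

end Heis

/-- The group of affine automorphisms of the standard lattice. -/
abbrev AffGroup (n : ℕ+) : Type := Multiplicative (fracLattice n) ⋊[fracAction n] GL (Fin 2) ℤ

namespace AffGroup

variable {n : ℕ+}

/-- The action on the Heisenberg group. -/
def act (p : AffGroup n) (h : Heis) : Heis :=
  Heis.affMap p.left.toAdd.1 (toReal p.right.1) h

theorem act_mul (p q : AffGroup n) (h : Heis) : (p * q).act h = p.act (q.act h) := by
  unfold act
  rw [Heis.affMap_affMap, ← toReal_mul]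
  rfl

theorem act_one (h : Heis) : (1 : AffGroup n).act h = h := by
  refine Eq.trans ?_ (Heis.affMap_zero_one h)
  change Heis.affMap 0 (toReal 1) h = _
  rw [toReal_one]

/-- The action by automorphisms. -/
def toMulAut : AffGroup n →* MulAut Heis where
  toFun p :=
    { toFun := p.act
      invFun := p⁻¹.act
      left_inv := fun h => by rw [← act_mul, inv_mul_cancel, act_one]
      right_inv := fun h => by rw [← act_mul, mul_inv_cancel, act_one]
      map_mul' := Heis.affMap_mul _ _ }
  map_one' := MulEquiv.ext act_one
  map_mul' p q := MulEquiv.ext (act_mul p q)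

theorem isUnit_det (p : AffGroup n) : IsUnit p.right.1.det :=
  (Matrix.isUnit_iff_isUnit_det _).1 p.right.isUnit

theorem odd_det (p : AffGroup n) :
    Odd (p.right.1 0 0 * p.right.1 1 1 - p.right.1 0 1 * p.right.1 1 0) := by
  have h := Int.isUnit_iff.1 p.isUnit_det
  rw [Matrix.det_fin_two] at h
  rcases h with h | h <;> rw [h] <;> decide

theorem act_eq (p : AffGroup n) (h : Heis) : p.act h =
    ⟨⟨p.right.1 0 0 * h.z.re + p.right.1 0 1 * h.z.im,
      p.right.1 1 0 * h.z.re + p.right.1 1 1 * h.z.im⟩,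
      p.right.1.det * h.t + (p.left.toAdd.1 0 * (p.right.1 1 0 * h.z.re + p.right.1 1 1 * h.z.im) -
        p.left.toAdd.1 1 * (p.right.1 0 0 * h.z.re + p.right.1 0 1 * h.z.im))⟩ := by
  have hdet : (toReal p.right.1).det = p.right.1.det := (Int.cast_det p.right.1).symm
  rw [act, Heis.affMap_eq, hdet]
  rfl

/-- It suffices to test the three generators. The first two go to lifts of the columns of an
invertible integral matrix, where the base lattice has central coordinates 1/2 + (1/n)ℤ. -/
theorem map_le (p : AffGroup n) :
    (baseLattice n).map (toMulAut p).toMonoidHom ≤ baseLattice n := by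
  have hn : ((n : ℕ) : ℝ) ≠ 0 := by positivity
  obtain ⟨k, hk⟩ := p.left.toAdd.2 0
  obtain ⟨l, hl⟩ := p.left.toAdd.2 1
  -- The coordinate 1/2 is multiplied by the determinant ±1; oddness keeps it congruent to 1/2
  -- modulo ℤ.
  obtain ⟨e, he⟩ : ∃ e : ℤ, p.right.1.det = 1 + 2 * e := by
    rcases Int.isUnit_iff.1 p.isUnit_det with h | h
    · exact ⟨0, h⟩
    · exact ⟨-1, by rw [h]; norm_num⟩
  have he' : (p.right.1.det : ℝ) = 1 + 2 * e := by exact_mod_cast he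
  rw [Subgroup.map_le_iff_le_comap]
  conv_lhs => rw [baseLattice]
  rw [Subgroup.closure_le]
  rintro x (rfl | rfl | rfl)
  · change p.act _ ∈ baseLattice n
    have h : p.act ⟨1, 1 / 2⟩ = ⟨⟨p.right.1 0 0, p.right.1 1 0⟩,
        1 / 2 + ((n * e + (k * p.right.1 1 0 - l * p.right.1 0 0) : ℤ) : ℝ) / (n : ℝ)⟩ := by
      rw [act_eq, hk, hl, he']
      ext1
      · simp
      · simp
        field_simp
        ring
    rw [h, mk_mem_baseLattice_iff p.odd_det]
    exact ⟨_, rfl⟩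
  · change p.act _ ∈ baseLattice n
    have h : p.act ⟨Complex.I, 1 / 2⟩ = ⟨⟨p.right.1 0 1, p.right.1 1 1⟩,
        1 / 2 + ((n * e + (k * p.right.1 1 1 - l * p.right.1 0 1) : ℤ) : ℝ) / (n : ℝ)⟩ := by
      rw [act_eq, hk, hl, he']
      ext1
      · simp
      · simp
        field_simp
        ring
    rw [h, mk_mem_baseLattice_iff (b := - p.right.1 0 0) (d := - p.right.1 1 0) (by
      convert p.odd_det using 1
      ring)]
    exact ⟨_, rfl⟩
  · change p.act _ ∈ baseLattice n
    have h : p.act ⟨0, 1 / (n : ℝ)⟩ = ⟨0, (p.right.1.det : ℤ) / (n : ℝ)⟩ := by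
      rw [act_eq]
      ext1
      · apply Complex.ext <;> simp
      · simp
        ring
    rw [h, mk_zero_mem_baseLattice]
    exact ⟨_, rfl⟩

theorem map_eq (p : AffGroup n) :
    (baseLattice n).map (toMulAut p).toMonoidHom = baseLattice n := by
  refine le_antisymm (map_le p) fun x hx => ?_
  exact ⟨p⁻¹.act x, map_le p⁻¹ ⟨x, hx, rfl⟩, (toMulAut p).apply_symm_apply x⟩

/-- The action as a homomorphism to the stabiliser. -/
def toStabilizer (n : ℕ+) : AffGroup n →* Heis.stabilizer (baseLattice n) :=
  ((toMulAut (n := n)).codRestrict Heis.contAut fun p => show Continuous p.act ∧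
    Continuous p⁻¹.act from ⟨Heis.continuous_affMap _ _, Heis.continuous_affMap _ _⟩).codRestrict
      (Heis.stabilizer (baseLattice n)) fun p => map_eq p

/-- At (1, 0) and (i, 0) the plane components give the columns of the matrix, and then the central
components give the vector up to sign. -/
theorem toStabilizer_injective (n : ℕ+) : Function.Injective (toStabilizer n) := by
  rw [injective_iff_map_eq_one]
  intro p hp
  have h : ∀ x, p.act x = x := fun x =>
    congrArg (fun Φ : Heis.stabilizer (baseLattice n) => ((Φ : Heis.contAut) : MulAut Heis) x) hp
  have h1 := h ⟨1, 0⟩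
  have h2 := h ⟨Complex.I, 0⟩
  rw [act_eq, Heis.ext_iff] at h1 h2
  obtain ⟨h1, h1'⟩ := h1
  obtain ⟨h2, h2'⟩ := h2
  rw [Complex.ext_iff] at h1 h2
  simp at h1 h1' h2 h2'
  have hg : p.right = 1 := by
    refine Units.ext (Matrix.ext fun i j => ?_)
    fin_cases i <;> fin_cases j
    · simpa using h1.1
    · simpa using h2.1
    · simpa using h1.2
    · simpa using h2.2
  refine SemidirectProduct.ext ?_ hg
  refine Multiplicative.toAdd.injective (Subtype.ext (funext fun i => ?_))
  simp only [h1.1, h1.2, h2.1, h2.2] at h1' h2'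
  fin_cases i
  · simpa using h2'
  · simpa using h1'

end AffGroup

end

/-! ### Continuous automorphisms of the Heisenberg group and the stabiliser -/

section

open Filter Set

namespace Heis

theorem mul_eq (a b : Heis) : a * b = ⟨a.z + b.z, a.t + b.t + omega a.z b.z / 2⟩ := by
  ext1
  · rfl
  · exact mul_t_omega a b

theorem eq_mul_mk_zero (h : Heis) : h = ⟨h.z, 0⟩ * ⟨0, h.t⟩ := by
  rw [mul_eq]
  ext1 <;> simp [omega]

/-- A continuous automorphism is linear in coordinates. -/
theorem exists_eq_of_continuous {Φ : MulAut Heis} (hΦ : Continuous Φ) :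
    ∃ (f : ℂ →ₗ[ℝ] ℂ) (χ : ℂ →ₗ[ℝ] ℝ) (r : ℝ), (∀ h, Φ h = ⟨f h.z, r * h.t + χ h.z⟩) ∧
      ∀ z w, omega (f z) (f w) = r * omega z w := by
  -- An automorphism preserves the centre; on the centre it is a continuous additive map of ℝ, hence
  -- a scaling.
  have hcz : ∀ t, (Φ ⟨0, t⟩).z = 0 := by
    intro t
    have h1 : (⟨0, t⟩ : Heis) ∈ Subgroup.center Heis := mem_center_iff.2 rfl
    refine mem_center_iff.1 (Subgroup.mem_center_iff.2 fun g => ?_)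
    obtain ⟨g, rfl⟩ := Φ.surjective g
    rw [← map_mul, ← map_mul, Subgroup.mem_center_iff.1 h1 g]
  let lam : ℝ →+ ℝ := AddMonoidHom.mk' (fun t => (Φ ⟨0, t⟩).t) fun s t => by
    rw [← mk_zero_mul, map_mul, mul_eq, hcz]
    simp [omega]
  have hlam : ∀ t, lam t = lam 1 * t := by
    intro t
    have hc : Continuous lam := continuous_t.comp (hΦ.comp (by fun_prop))
    have h := (lam.toRealLinearMap hc).map_smul t 1
    rw [smul_eq_mul, mul_one, smul_eq_mul, mul_comm] at h
    exact h
  have hcent : ∀ t, Φ ⟨0, t⟩ = ⟨0, lam 1 * t⟩ := fun t => by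
    ext1
    · exact hcz t
    · exact hlam t
  have hdecomp : ∀ h, Φ h = ⟨(Φ ⟨h.z, 0⟩).z, lam 1 * h.t + (Φ ⟨h.z, 0⟩).t⟩ := by
    intro h
    conv_lhs => rw [eq_mul_mk_zero h, map_mul, hcent, mul_eq]
    ext1
    · simp
    · simp [omega]
      ring
  let f : ℂ →+ ℂ := AddMonoidHom.mk' (fun z => (Φ ⟨z, 0⟩).z) fun z w => by
    have h := congrArg Heis.z (map_mul Φ ⟨z, 0⟩ ⟨w, 0⟩)
    rw [hdecomp] at h
    exact h
  -- Applying the automorphism to a commutator compares `omega` of the images with the scaling on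
  -- the centre. This also makes the correction terms cancel in the additivity of χ.
  have homega : ∀ z w, omega (f z) (f w) = lam 1 * omega z w := by
    intro z w
    have h := congrArg Φ (commutator_eq ⟨z, 0⟩ ⟨w, 0⟩)
    rw [map_mul, map_mul, map_mul, map_inv, map_inv, commutator_eq, hcent] at h
    exact congrArg Heis.t h
  let χ : ℂ →+ ℝ := AddMonoidHom.mk' (fun z => (Φ ⟨z, 0⟩).t) fun z w => by
    have h := congrArg Heis.t (map_mul Φ ⟨z, 0⟩ ⟨w, 0⟩)
    have h2 : omega (Φ ⟨z, 0⟩).z (Φ ⟨w, 0⟩).z = lam 1 * omega z w := homega z w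
    rw [hdecomp, mul_eq, mul_eq, h2] at h
    simp only [add_zero, zero_add] at h
    linarith
  have hf : Continuous f := continuous_z.comp (hΦ.comp (by fun_prop))
  have hχ : Continuous χ := continuous_t.comp (hΦ.comp (by fun_prop))
  exact ⟨(f.toRealLinearMap hf).toLinearMap, (χ.toRealLinearMap hχ).toLinearMap, lam 1, hdecomp,
    homega⟩

end Heis

/-- The linear form of the automorphism is read off on the generators: the central one gives r = ±1,
the plane ones give an integral matrix of determinant r and values of χ in (1/n)ℤ. Nondegeneracy of
`omega` then yields the conjugating vector. -/
theorem AffGroup.toStabilizer_surjective (n : ℕ+) :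
    Function.Surjective (AffGroup.toStabilizer n) := by
  have hn : ((n : ℕ) : ℝ) ≠ 0 := by positivity
  rintro ⟨⟨Φ, hΦ, hΦ'⟩, hstab⟩
  have hstab : (baseLattice n).map Φ.toMonoidHom = baseLattice n := hstab
  obtain ⟨f, χ, r, hf, homega⟩ := Heis.exists_eq_of_continuous hΦ
  have hmem : ∀ x ∈ baseLattice n, Φ x ∈ baseLattice n := fun x hx => by
    rw [← hstab]
    exact ⟨x, hx, rfl⟩
  -- the action on the centre
  have hgen : (⟨0, 1 / (n : ℝ)⟩ : Heis) ∈ baseLattice n :=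
    mk_zero_mem_baseLattice.2 ⟨1, by simp⟩
  obtain ⟨D, hD⟩ : ∃ D : ℤ, r = D := by
    have h1 := hmem _ hgen
    rw [hf] at h1
    simp only [map_zero, add_zero] at h1
    obtain ⟨j, hj⟩ := mk_zero_mem_baseLattice.1 h1
    exact ⟨j, by field_simp at hj; exact hj⟩
  subst hD
  have hDu : D = 1 ∨ D = -1 := by
    rw [← Int.isUnit_iff]
    -- The central generator has a preimage in the lattice, necessarily central, which provides an
    -- integral inverse of D.
    obtain ⟨x, hx, hxg⟩ : (⟨0, 1 / (n : ℝ)⟩ : Heis) ∈ (baseLattice n).map Φ.toMonoidHom := by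
      rw [hstab]
      exact hgen
    have hxg : Φ x = ⟨0, 1 / (n : ℝ)⟩ := hxg
    have hxz : x.z = 0 := by
      rw [← Heis.mem_center_iff, Subgroup.mem_center_iff]
      intro g
      apply Φ.injective
      rw [map_mul, map_mul, hxg]
      exact Subgroup.mem_center_iff.1 (Heis.mem_center_iff.2 rfl) _
    have hx0 : x = ⟨0, x.t⟩ := by
      ext1
      · exact hxz
      · rfl
    rw [hx0] at hx
    obtain ⟨j, hj⟩ := mk_zero_mem_baseLattice.1 hx
    rw [hf, hxz, hj] at hxg
    have h1 := congrArg Heis.t hxg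
    simp only [map_zero, add_zero] at h1
    field_simp at h1
    exact IsUnit.of_mul_eq_one j (by exact_mod_cast h1)
  -- the action on the plane
  have h1mem : (⟨1, 1 / 2⟩ : Heis) ∈ baseLattice n := Subgroup.subset_closure (by simp)
  have hImem : (⟨Complex.I, 1 / 2⟩ : Heis) ∈ baseLattice n := Subgroup.subset_closure (by simp)
  have h1 := hmem _ h1mem
  have hI := hmem _ hImem
  obtain ⟨a, c, hac⟩ := exists_int_of_mem_baseLattice h1
  obtain ⟨b, d, hbd⟩ := exists_int_of_mem_baseLattice hI
  rw [hf] at h1 hI hac hbd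
  have hac : f 1 = ⟨a, c⟩ := hac
  have hbd : f Complex.I = ⟨b, d⟩ := hbd
  have hdet : a * d - b * c = D := by
    have h := homega 1 Complex.I
    rw [hac, hbd] at h
    simp [omega] at h
    have h' : a * d - c * b = D := by exact_mod_cast h
    linarith
  have hodd : Odd (a * d - b * c) := by
    rw [hdet]
    rcases hDu with h | h <;> rw [h] <;> decide
  have hodd' : Odd (b * (-c) - (-a) * d) := by
    convert hodd using 1
    ring
  -- the translation part
  obtain ⟨e, he⟩ : ∃ e : ℤ, D = 1 + 2 * e := by
    rcases hDu with h | h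
    · exact ⟨0, h⟩
    · exact ⟨-1, by rw [h]; norm_num⟩
  have he' : (D : ℝ) = 1 + 2 * e := by exact_mod_cast he
  obtain ⟨k, hk⟩ : ∃ k : ℤ, χ 1 = k / (n : ℝ) := by
    simp only [hac] at h1
    obtain ⟨j, hj⟩ := (mk_mem_baseLattice_iff hodd).1 h1
    refine ⟨j - n * e, ?_⟩
    rw [he'] at hj
    push_cast
    field_simp at hj ⊢
    linarith
  obtain ⟨l, hl⟩ : ∃ l : ℤ, χ Complex.I = l / (n : ℝ) := by
    simp only [hbd] at hI
    obtain ⟨j, hj⟩ := (mk_mem_baseLattice_iff hodd').1 hI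
    refine ⟨j - n * e, ?_⟩
    rw [he'] at hj
    push_cast
    field_simp at hj ⊢
    linarith
  have hDD : D * D = 1 := by rcases hDu with h | h <;> rw [h] <;> norm_num
  have hunit : IsUnit (!![a, b; c, d] : Matrix (Fin 2) (Fin 2) ℤ) := by
    rw [Matrix.isUnit_iff_isUnit_det, Matrix.det_fin_two_of, hdet]
    exact IsUnit.of_mul_eq_one D hDD
  obtain ⟨g, hg⟩ := hunit
  -- Cramer's rule for w₀c - w₁a = k/n and w₀d - w₁b = l/n, which say that `omega` of w and f z is χ
  -- z. Division by the determinant D is multiplication by D, since D² = 1.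
  let w : Fin 2 → ℝ := ![((a * l - b * k) * D : ℤ) / (n : ℝ), ((c * l - d * k) * D : ℤ) / (n : ℝ)]
  have hw : w ∈ fracLattice n := by
    intro i
    fin_cases i
    · exact ⟨_, rfl⟩
    · exact ⟨_, rfl⟩
  refine ⟨⟨Multiplicative.ofAdd ⟨w, hw⟩, g⟩, Subtype.ext (Subtype.ext (MulEquiv.ext fun h => ?_))⟩
  change AffGroup.act ⟨Multiplicative.ofAdd ⟨w, hw⟩, g⟩ h = Φ h
  have hz : h.z = h.z.re • (1 : ℂ) + h.z.im • Complex.I := by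
    apply Complex.ext <;> simp
  have hfz : f h.z = ⟨a * h.z.re + b * h.z.im, c * h.z.re + d * h.z.im⟩ := by
    rw [hz, map_add, map_smul, map_smul, hac, hbd, ← hz]
    apply Complex.ext
    · simp
      ring
    · simp
      ring
  have hχz : χ h.z = h.z.re * (k / (n : ℝ)) + h.z.im * (l / (n : ℝ)) := by
    rw [hz, map_add, map_smul, map_smul, hk, hl, ← hz]
    rfl
  have hDD' : (D * D : ℝ) = 1 := by exact_mod_cast hDD
  have hdet' : (a * d - b * c : ℝ) = D := by exact_mod_cast hdet
  rw [AffGroup.act_eq, hf, hfz, hχz]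
  have hgdet : g.1.det = D := by rw [hg, Matrix.det_fin_two_of, hdet]
  have hw0 : w 0 = ((a * l - b * k) * D : ℤ) / (n : ℝ) := rfl
  have hw1 : w 1 = ((c * l - d * k) * D : ℤ) / (n : ℝ) := rfl
  rw [hgdet]
  simp only [hg, Matrix.of_apply, Matrix.cons_val_zero, Matrix.cons_val_one,
    Matrix.cons_val_fin_one, toAdd_ofAdd, hw0, hw1]
  ext1
  · rfl
  · simp only
    have key : ∀ x y : ℝ, ((a * l - b * k) * D : ℝ) * (c * x + d * y) -
        (c * l - d * k) * D * (a * x + b * y) = D * D * (x * k + y * l) := by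
      intro x y
      rw [mul_assoc (D : ℝ) D, ← hdet']
      ring
    have h2 := key h.z.re h.z.im
    rw [hDD', one_mul] at h2
    push_cast
    field_simp
    linear_combination h2

/-- The stabiliser of the standard lattice. -/
def affEquivStabilizer (n : ℕ+) : AffGroup n ≃* Heis.stabilizer (baseLattice n) :=
  MulEquiv.ofBijective (AffGroup.toStabilizer n)
    ⟨AffGroup.toStabilizer_injective n, AffGroup.toStabilizer_surjective n⟩

end

end HeisLattice

end

theorem proposition7p7 :
    -- `p n` is the map that sends a lattice to its image under `(z, t) ↦ z`
    (∃ p : ∀ n : ℕ+, HeisLattice.LatticeSpaceN n → HeisLattice.LatticeSpace (Multiplicative ℂ),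
      (∀ (n : ℕ+) (Λ : HeisLattice.LatticeSpaceN n),
        (p n Λ).1.toSubgroup = Λ.1.toSubgroup.map HeisLattice.Heis.proj) ∧
      (∀ n : ℕ+, HeisLattice.IsFibreBundle (Circle × Circle) (p n)) ∧
      (∀ n n' : ℕ+, ∃ e : HeisLattice.LatticeSpaceN n ≃ₜ HeisLattice.LatticeSpaceN n',
        ∀ Λ : HeisLattice.LatticeSpaceN n, p n' (e Λ) = p n Λ)) ∧
    (∀ n : ℕ+,
      ConnectedSpace (HeisLattice.LatticeSpaceN n) ∧
      HeisLattice.IsTopologicalManifold 6 (HeisLattice.LatticeSpaceN n) ∧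
      HeisLattice.IsEilenbergMacLane HeisLattice.JacobiTilde (HeisLattice.LatticeSpaceN n)) ∧
    (∀ n : ℕ+,
      (∃ Λ : HeisLattice.LatticeSpaceN n, Λ.1.toSubgroup = HeisLattice.baseLattice n) ∧
      -- the stabiliser of the base lattice consists of the automorphisms
      -- `h ↦ (w, 0) (g h) (w, 0)⁻¹`, and is the semidirect product
      (∃ E : Multiplicative (HeisLattice.fracLattice n) ⋊[HeisLattice.fracAction n] GL (Fin 2) ℤ ≃*
          HeisLattice.Heis.stabilizer (HeisLattice.baseLattice n),
        ∀ (w : HeisLattice.fracLattice n) (g : GL (Fin 2) ℤ) (h : HeisLattice.Heis),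
          (E ⟨Multiplicative.ofAdd w, g⟩ : MulAut HeisLattice.Heis) h =
            HeisLattice.Heis.ofVec w *
              HeisLattice.Heis.matAct (HeisLattice.toReal (g : Matrix (Fin 2) (Fin 2) ℤ)) h *
              (HeisLattice.Heis.ofVec w)⁻¹)) := by
  refine ⟨⟨HeisLattice.latticeProj, HeisLattice.latticeProj_toSubgroup,
    HeisLattice.isFibreBundle_latticeProj, HeisLattice.exists_homeomorph_latticeProj⟩,
    fun n => ⟨inferInstance, HeisLattice.isTopologicalManifold_latticeSpaceN n,
      HeisLattice.isEilenbergMacLane_latticeSpaceN n⟩,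
    fun n => ⟨HeisLattice.exists_latticeSpaceN_eq_baseLattice n,
      HeisLattice.affEquivStabilizer n, fun w g h => rfl⟩⟩
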